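/- **Setting.** Let $d\in\{2,3\}$ and let $\Omega\subset\mathbb R^d$ be a bounded polytopal domain, partitioned into a finite mesh $\mathcal T_h$ of disjoint open polytopal elements, with a finite set $\mathcal F_h$ of flat $(d-1)$-dimensional (relatively open, disjoint) faces; each face inside $\Omega$ is shared by exactly two elements, each face on $\partial\Omega$ belongs to exactly one. $\mathcal F_h(K)$ is the set of faces on $\partial K$, $\boldsymbol n$ the outward unit normal of $K$, $(\cdot,\cdot)_D$ the $L^2(D)$ inner product, and $\mathbb P_k$ the polynomials of degree at most $k$. Let $f\in L^2(\Omega)$ and let $u\in H^1_0(\Omega)$ satisfy $(\nabla u,\nabla v)_\Omega=(f,v)_\Omega$ for all $v\in H^1_0(\Omega)$. Assume that on each element the normal trace $\nabla u\cdot\boldsymbol n$ (defined weakly through Green's formula) is an integrable function on the faces, so that the pairings below make sense as integrals. Put $V_h(K)=\{v\in H^1(K):\Delta v=0\text{ in }K,\ \nabla v\cdot\boldsymbol n|_F\in\mathbb P_0(F)\ \forall F\in\mathcal F_h(K)\}$ and $$V_h=\Bigl\{v\in L^2(\Omega): v|_K\in V_h(K)\ \forall K\in\mathcal T_h,\ \int_F[\![v]\!]\,dS=0\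 \forall F\in\mathcal F_h\Bigr\},$$ where $[\![v]\!]$ is the jump of the traces across an interior face, and $[\![v]\!]=v|_F$ on a boundary face. Let $\chi_F(v)=Q_Fv=|F|^{-1}\int_F v\,dS$. The interpolant $u_I\in V_h$ of $u$ satisfies $\chi_F(u_I)=\chi_F(u)$ for all $F\in\mathcal F_h$. For each $K\in\mathcal T_h$ let $\omega_K$ be a union of elements of $\mathcal T_h$ that contains $K$ (possibly $\omega_K=K$). For $v\in V_h$ let $\Pi_Kv,\Pi_{\omega_K}v\in\mathbb P_1$ be given by $$(\nabla\Pi_Kv,\nabla q)_K=(\nabla v,\nabla q)_K,\qquad(\nabla\Pi_{\omega_K}v,\nabla q)_{\omega_K}=\sum_{K'\subset\omega_K}(\nabla v,\nabla q)_{K'}\qquad\forall q\in\mathbb P_1,$$ $$\int_{\partial\omega_K}\Pi_Kv\,dS=\int_{\partial\omega_K}\Pi_{\omega_K}v\,dS=\int_{\partial\omega_K}v\,dS .$$ For each $K$ let $S_K$ be an arbitrary bilinear form on $V_h(K)$, and put $$a_h(v,w)=\sum_{K\in\mathcal T_h}\Bigl\{(\nabla\Pi_Kv,\nabla\Pi_Kw)_K+S_K\bigl(v-\Pi_{\omega_K}v,\,w-\Pi_{\omega_K}w\bigr)\Bigr\}.$$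 Let $u_h\in V_h$ satisfy $a_h(u_h,v_h)=\sum_{K\in\mathcal T_h}(f,\Pi_Kv_h)_K$ for all $v_h\in V_h$. **Lemma (an error equation).** For every piecewise linear polynomial $u_\pi$ on $\mathcal T_h$ (that is, $u_\pi|_K\in\mathbb P_1$ for each $K$, without continuity) and every $v_h\in V_h$, $$a_h(u_h-u_I,v_h)=\sum_{K\in\mathcal T_h}\sum_{F\in\mathcal F_h(K)}\bigl\langle\nabla(u-u_\pi)\cdot\boldsymbol n,\;Q_Fv_h-\Pi_Kv_h\bigr\rangle_F-\sum_{K\in\mathcal T_h}S_K\bigl(u_I-\Pi_{\omega_K}u_I,\;v_h-\Pi_{\omega_K}v_h\bigr).$$ -/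

import Mathlib

open MeasureTheory Filter Topology
open scoped ContDiff RealInnerProductSpace Gradient

namespace NCVEM

noncomputable section

open scoped Classical

/-- The Euclidean space `ℝ^d`. -/
abbrev E (d : ℕ) : Type := EuclideanSpace ℝ (Fin d)

/-- Polynomials of degree at most one on `ℝ^d`. A polynomial on a set with nonempty interior is
identified with its unique extension to the whole space. -/
abbrev P1 (d : ℕ) : Type := E d →ᵃ[ℝ] ℝ

variable {d : ℕ}

/-- Surface measure on a face: the `(d-1)`-dimensional Hausdorff measure, normalized so that it is
Lebesgue measure on hyperplanes. -/
def surf (F : Set (E d)) : Measure (E d) := (μHE[d - 1] : Measure (E d)).restrict F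

/-! ### Polytopes and meshes -/

/-- A flat face: a nonempty, connected, relatively open subset of a hyperplane, whose relative
boundary lies in finitely many affine subspaces of codimension at least two. -/
structure IsFlatFace (F : Set (E d)) : Prop where
  connected : IsConnected F
  flat : ∃ (n : E d) (b : ℝ) (U : Set (E d)), ‖n‖ = 1 ∧ IsOpen U ∧ F = U ∩ {x | ⟪n, x⟫ = b}
  boundary : ∃ L : Finset (AffineSubspace ℝ (E d)),
    (∀ A ∈ L, Module.finrank ℝ A.direction + 2 ≤ d) ∧
      closure F \ F ⊆ ⋃ A ∈ L, (A : Set (E d))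

/-- `n` is the outward unit normal of `K` along `F`: near each point of `F`, the set `K` is the
open half-space lying on the side of `-n`. -/
def IsOutwardNormal (K F : Set (E d)) (n : E d) : Prop :=
  ‖n‖ = 1 ∧ ∀ x ∈ F, ∃ r > 0, K ∩ Metric.ball x r = {y | ⟪n, y - x⟫ < 0} ∩ Metric.ball x r

/-- `K` is a bounded polytopal domain, whose boundary consists of the flat faces in `Fs`
(relatively open) and of their relative boundaries. -/
structure IsPolytope (K : Set (E d)) (Fs : Finset (Set (E d))) : Prop where
  isOpen : IsOpen K
  connected : IsConnected K
  bounded : Bornology.IsBounded K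
  face : ∀ F ∈ Fs, IsFlatFace F
  normal : ∀ F ∈ Fs, ∃ n, IsOutwardNormal K F n
  frontier_eq : frontier K = ⋃ F ∈ Fs, closure F

/-- The members of `Fs` that lie on the boundary of `D`. -/
def facesOn (Fs : Finset (Set (E d))) (D : Set (E d)) : Finset (Set (E d)) :=
  Fs.filter fun F => F ⊆ frontier D

/-- A polytopal mesh of the polytopal domain `Ω`, with (open) elements `elems` and (relatively
open) faces `faces`. Hanging nodes are allowed: several faces may lie in one hyperplane. -/
structure Mesh (Ω : Set (E d)) where
  elems : Finset (Set (E d))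
  faces : Finset (Set (E d))
  domain : IsPolytope Ω (facesOn faces Ω)
  element : ∀ K ∈ elems, IsPolytope K (facesOn faces K)
  elems_disjoint : (elems : Set (Set (E d))).PairwiseDisjoint id
  faces_disjoint : (faces : Set (Set (E d))).PairwiseDisjoint id
  elems_subset : ∀ K ∈ elems, K ⊆ Ω
  cover : closure Ω = ⋃ K ∈ elems, closure K
  face_cases : ∀ F ∈ faces, F ⊆ Ω ∨ F ⊆ frontier Ω
  interior_face : ∀ F ∈ faces, F ⊆ Ω → (elems.filter fun K => F ⊆ frontier K).card = 2
  boundary_face : ∀ F ∈ faces, F ⊆ frontier Ω → (elems.filter fun K => F ⊆ frontier K).card = 1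

/-- The faces of the element `K`. -/
abbrev Mesh.facesOf {Ω : Set (E d)} (T : Mesh Ω) (K : Set (E d)) : Finset (Set (E d)) :=
  facesOn T.faces K

/-- A choice, for every element `K`, of an extended element patch: a set of elements
containing `K`. -/
structure Patches {Ω : Set (E d)} (T : Mesh Ω) where
  elems : Set (E d) → Finset (Set (E d))
  subset : ∀ K ∈ T.elems, elems K ⊆ T.elems
  self_mem : ∀ K ∈ T.elems, K ∈ elems K

/-- The region `ω_K` covered by the patch of `K`. -/
def Patches.region {Ω : Set (E d)} {T : Mesh Ω} (W : Patches T) (K : Set (E d)) : Set (E d) :=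
  ⋃ K' ∈ W.elems K, closure K'

/-! ### Sobolev functions, traces and normal derivatives -/

/-- Convergence in `L²(μ)`. -/
def TendstoL2 {V : Type*} [NormedAddCommGroup V] (μ : Measure (E d)) (φ : ℕ → E d → V)
    (v : E d → V) : Prop :=
  Tendsto (fun k => eLpNorm (φ k - v) 2 μ) atTop (𝓝 0)

/-- `φ ∈ C_c^∞(D)`. -/
def IsTest (D : Set (E d)) (φ : E d → ℝ) : Prop :=
  ContDiff ℝ ∞ φ ∧ HasCompactSupport φ ∧ tsupport φ ⊆ D

/-- `G ∈ L²(D)` is the weak gradient of `v` on the open set `D`. -/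
def IsWeakGrad (D : Set (E d)) (v : E d → ℝ) (G : E d → E d) : Prop :=
  MemLp G 2 (volume.restrict D) ∧
    ∀ φ, IsTest D φ → ∫ x in D, v x • ∇ φ x = -∫ x in D, φ x • G x

/-- `v ∈ H¹(D)`. -/
def MemH1 (D : Set (E d)) (v : E d → ℝ) : Prop :=
  MemLp v 2 (volume.restrict D) ∧ ∃ G, IsWeakGrad D v G

/-- The weak gradient on `D` (determined almost everywhere on `D`). -/
def grad (D : Set (E d)) (v : E d → ℝ) : E d → E d := Classical.epsilon (IsWeakGrad D v)

/-- `v ∈ H¹₀(D)`: the function `v` is a limit in `H¹(D)` of functions in `C_c^∞(D)`. -/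
def MemH10 (D : Set (E d)) (v : E d → ℝ) : Prop :=
  MemH1 D v ∧ ∃ φ : ℕ → E d → ℝ, (∀ k, IsTest D (φ k)) ∧
    TendstoL2 (volume.restrict D) φ v ∧
    TendstoL2 (volume.restrict D) (fun k => ∇ (φ k)) (grad D v)

/-- `g` is the trace of `v ∈ H¹(K)` on the faces `Fs` of `K`: there are functions, smooth up to
the boundary, that converge to `v` in `H¹(K)` and whose restrictions to the faces converge to `g`
in `L²`. -/
def IsTrace (K : Set (E d)) (Fs : Finset (Set (E d))) (v g : E d → ℝ) : Prop :=
  ∃ φ : ℕ → E d → ℝ, (∀ k, ContDiff ℝ ∞ (φ k)) ∧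
    TendstoL2 (volume.restrict K) φ v ∧
    TendstoL2 (volume.restrict K) (fun k => ∇ (φ k)) (grad K v) ∧
    ∀ F ∈ Fs, MemLp g 2 (surf F) ∧ TendstoL2 (surf F) φ g

/-- The trace of `v` on the faces `Fs` of `K` (determined almost everywhere on the faces). -/
def trace (K : Set (E d)) (Fs : Finset (Set (E d))) (v : E d → ℝ) : E d → ℝ :=
  Classical.epsilon (IsTrace K Fs v)

/-- `l = Δ v` weakly in `K`, and `g = ∇ v ⬝ n` on the faces `Fs` of `K` with respect to the outward
normal, in the usual weak sense: `(∇ v, ∇ φ)_K + (Δ v, φ)_K = ⟨∇ v ⬝ n, φ⟩_{∂ K}` for all `φ` that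
are smooth up to the boundary. -/
def IsNormalDeriv (K : Set (E d)) (Fs : Finset (Set (E d))) (v l g : E d → ℝ) : Prop :=
  MemLp l 2 (volume.restrict K) ∧ (∀ F ∈ Fs, Integrable g (surf F)) ∧
    ∀ φ : E d → ℝ, ContDiff ℝ ∞ φ →
      (∫ x in K, ⟪grad K v x, ∇ φ x⟫) + ∫ x in K, l x * φ x = ∑ F ∈ Fs, ∫ x, g x * φ x ∂(surf F)

/-- The normal derivative of `v` on the faces of `K` is an integrable function. -/
def HasNormalDeriv (K : Set (E d)) (Fs : Finset (Set (E d))) (v : E d → ℝ) : Prop :=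
  ∃ g l, IsNormalDeriv K Fs v l g

/-- The outward normal derivative `∇ v ⬝ n` on the faces `Fs` of `K` (determined almost everywhere
on the faces). -/
def normalDeriv (K : Set (E d)) (Fs : Finset (Set (E d))) (v : E d → ℝ) : E d → ℝ :=
  Classical.epsilon fun g => ∃ l, IsNormalDeriv K Fs v l g

/-- `u ∈ H¹₀(Ω)` and `(∇ u, ∇ v) = (f, v)` for all `v ∈ H¹₀(Ω)`. -/
def IsWeakSolution (Ω : Set (E d)) (f u : E d → ℝ) : Prop :=
  MemH10 Ω u ∧ ∀ v, MemH10 Ω v → ∫ x in Ω, ⟪grad Ω u x, grad Ω v x⟫ = ∫ x in Ω, f x * v x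

/-! ### The nonconforming virtual element method -/

/-- `V_h(K)`: functions in `H¹(K)` (together with their trace on the faces of `K`) that are
harmonic in `K` and whose normal derivative is constant on each face. -/
def localSpace (K : Set (E d)) (Fs : Finset (Set (E d))) : Set (E d → ℝ) :=
  {v | MemH1 K v ∧ (∃ g, IsTrace K Fs v g) ∧
    ∃ g, IsNormalDeriv K Fs v 0 g ∧ ∀ F ∈ Fs, ∃ c : ℝ, ∀ x ∈ F, g x = c}

variable {Ω : Set (E d)}

/-- The mean `χ_F` over the face `F` of the trace from `K`. -/
def Mesh.chi (T : Mesh Ω) (K F : Set (E d)) (v : E d → ℝ) : ℝ :=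
  ((surf F).real Set.univ)⁻¹ * ∫ x, trace K (T.facesOf K) v x ∂(surf F)

/-- The global space `V_h`: piecewise in `V_h(K)`, with jumps of mean zero on all faces; on a
boundary face the jump is the trace itself. -/
def Mesh.space (T : Mesh Ω) : Set (E d → ℝ) :=
  {v | MemLp v 2 (volume.restrict Ω) ∧
    (∀ K ∈ T.elems, v ∈ localSpace K (T.facesOf K)) ∧
    (∀ K ∈ T.elems, ∀ K' ∈ T.elems, ∀ F ∈ T.faces, F ⊆ Ω → F ⊆ frontier K → F ⊆ frontier K' →
      ∫ x, trace K (T.facesOf K) v x ∂(surf F) = ∫ x, trace K' (T.facesOf K') v x ∂(surf F)) ∧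
    ∀ K ∈ T.elems, ∀ F ∈ T.faces, F ⊆ frontier Ω → F ⊆ frontier K →
      ∫ x, trace K (T.facesOf K) v x ∂(surf F) = 0}

/-- `w ∈ V_h` is the canonical interpolant of `u`. -/
def Mesh.IsInterpolant (T : Mesh Ω) (u w : E d → ℝ) : Prop :=
  w ∈ T.space ∧ ∀ K ∈ T.elems, ∀ F ∈ T.facesOf K, T.chi K F u = T.chi K F w

namespace Patches

variable {T : Mesh Ω} (W : Patches T)

/-- The faces on the boundary of the patch `ω_K`. -/
def bdryFaces (K : Set (E d)) : Finset (Set (E d)) := facesOn T.faces (W.region K)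

/-- `∫_{∂ ω_K} v dS`, with traces taken from inside the patch (each boundary face of the patch
belongs to exactly one of its elements). -/
def bdryIntegral (K : Set (E d)) (v : E d → ℝ) : ℝ :=
  ∑ F ∈ W.bdryFaces K, ∑ K' ∈ (W.elems K).filter (fun K' => F ⊆ frontier K'),
    ∫ x, trace K' (T.facesOf K') v x ∂(surf F)

/-- `∫_{∂ ω_K} p dS` for a polynomial. -/
def bdryIntegralP1 (K : Set (E d)) (p : P1 d) : ℝ :=
  ∑ F ∈ W.bdryFaces K, ∫ x, p x ∂(surf F)

/-- The defining conditions of `Π_K v`. The additive constant is fixed on `∂ ω_K`, which is `∂ K`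
when the patch of `K` is `K` itself. -/
def IsProjK (K : Set (E d)) (v : E d → ℝ) (p : P1 d) : Prop :=
  (∀ q : P1 d, ∫ x in K, ⟪∇ p x, ∇ q x⟫ = ∫ x in K, ⟪grad K v x, ∇ q x⟫) ∧
    W.bdryIntegralP1 K p = W.bdryIntegral K v

/-- The elliptic projection `Π_K v`. -/
def projK (K : Set (E d)) (v : E d → ℝ) : P1 d := Classical.epsilon (W.IsProjK K v)

/-- The defining conditions of `Π_{ω_K} v`. -/
def IsProjPatch (K : Set (E d)) (v : E d → ℝ) (p : P1 d) : Prop :=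
  (∀ q : P1 d, ∫ x in W.region K, ⟪∇ p x, ∇ q x⟫ =
      ∑ K' ∈ W.elems K, ∫ x in K', ⟪grad K' v x, ∇ q x⟫) ∧
    W.bdryIntegralP1 K p = W.bdryIntegral K v

/-- The discrete `H¹`-type projection `Π_{ω_K} v` on the patch. -/
def projPatch (K : Set (E d)) (v : E d → ℝ) : P1 d := Classical.epsilon (W.IsProjPatch K v)

/-- The discrete bilinear form `a_h` with stabilization `S`. -/
def ah (S : Set (E d) → (E d → ℝ) → (E d → ℝ) → ℝ) (v w : E d → ℝ) : ℝ :=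
  ∑ K ∈ T.elems, ((∫ x in K, ⟪∇ (W.projK K v) x, ∇ (W.projK K w) x⟫) +
    S K (v - ⇑(W.projPatch K v)) (w - ⇑(W.projPatch K w)))

/-- `u_h ∈ V_h` solves the virtual element discretization with data `f`. -/
def IsVEMSolution (S : Set (E d) → (E d → ℝ) → (E d → ℝ) → ℝ) (f uh : E d → ℝ) : Prop :=
  uh ∈ T.space ∧ ∀ v ∈ T.space, W.ah S uh v = ∑ K ∈ T.elems, ∫ x in K, f x * W.projK K v x

end Patches

/-- `B` is bilinear on the space of functions `V`. -/
def IsBilinearOn (V : Set (E d → ℝ)) (B : (E d → ℝ) → (E d → ℝ) → ℝ) : Prop :=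
  (∀ a : ℝ, ∀ w₁ ∈ V, ∀ w₂ ∈ V, ∀ z ∈ V, B (a • w₁ + w₂) z = a * B w₁ z + B w₂ z) ∧
    ∀ a : ℝ, ∀ w₁ ∈ V, ∀ w₂ ∈ V, ∀ z ∈ V, B z (a • w₁ + w₂) = a * B z w₁ + B z w₂

end

end NCVEM

/-! The identity is Green's formula, element by element. Linearity of `a_h` in its first argument
and the discrete equation leave the sum over `K` of `(f, Π_K v)_K - (∇Π_K u_I, ∇Π_K v)_K`, minus the
stabilization terms of `u_I`. The mean gradient of a function over `K` depends only on its face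
means, so `∇Π_K u_I` may be replaced by `∇u` when paired with an affine function. Since `-Δu = f` on
`K`, what remains is minus the sum over the faces of `⟨∇u·n, Π_K v⟩_F`.

Two quantities that vanish turn this into the asserted right-hand side. First, the pairings `⟨∇u·n,
Q_F v⟩_F` add up to zero over the mesh: on an interior face the two fluxes of `u` cancel while `Q_F
v` is single-valued, and on a boundary face `Q_F v = 0`. Second, on each element `⟨∇u_π·n, Q_F v -
Π_K v⟩_F` sums to zero over the faces, because `∇u_π·n` is constant on each face and `Π_K` preserves
the mean gradient.

The analytic foundation is Green's formula on a polytope (`IsPolytope.integral_fderiv`). Its defect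
is additive in the test function, so a partition of unity reduces it to local statements, which are
trivial off the boundary and follow from the half-space case at a face point. The relative
boundaries of the faces have codimension two and are cut away: a tube of radius `ε` has volume of
order `ε²`, which beats the gradient `1/ε` of the cutoff.

Weak gradients, traces, normal derivatives and projections are chosen by `Classical.epsilon`, so
each needs existence and uniqueness. Traces and normal derivatives are unique by testing Green's
formula near a single face. Traces of `u` on the elements exist by a trace inequality on hyperplanes
(`norm_toLp_surf_le`). The projections are well defined and linear because the boundary of a patch
has positive measure (`Patches.bdryMeasure_pos`). Continuity of the flux
(`Mesh.sum_integral_normalDeriv`) comes from testing the weak equation near one interior face. -/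

namespace NCVEM

open scoped Classical

variable {d : ℕ}

/-! ### Green's formula on a half-space -/

/-- Cartesian coordinates adapted to the hyperplane through `x₀` with normal `n`. -/
noncomputable def hyperplaneCoords (n x₀ : E d) (p : ℝ × (ℝ ∙ n)ᗮ) : E d := x₀ + p.1 • n + p.2

theorem hyperplaneCoords_eq_comp {n : E d} (hn : ‖n‖ = 1) (x₀ : E d) :
    hyperplaneCoords n x₀ = ((ℝ ∙ n).measurableEquivProd x₀).symm ∘
      Prod.map (LinearIsometryEquiv.toSpanUnitSingleton (𝕜 := ℝ) n hn) id := by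
  funext p
  simp [hyperplaneCoords, Submodule.measurableEquivProd_symm_apply]
  abel

theorem measurePreserving_hyperplaneCoords {n : E d} (hn : ‖n‖ = 1) (x₀ : E d) :
    MeasurePreserving (hyperplaneCoords n x₀) (volume.prod volume) volume := by
  rw [hyperplaneCoords_eq_comp hn]
  have h := (ℝ ∙ n).measurePreserving_measurableEquivProd x₀
  rw [InnerProductSpace.euclideanHausdorffMeasure_eq_volume] at h
  refine MeasurePreserving.comp h.symm ?_
  exact (LinearIsometryEquiv.measurePreserving _).prod (MeasurePreserving.id _)

theorem measurableEmbedding_hyperplaneCoords {n : E d} (hn : ‖n‖ = 1) (x₀ : E d) :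
    MeasurableEmbedding (hyperplaneCoords n x₀) := by
  rw [hyperplaneCoords_eq_comp hn]
  refine (MeasurableEquiv.measurableEmbedding _).comp ?_
  exact ((LinearIsometryEquiv.toSpanUnitSingleton (𝕜 := ℝ) n
    hn).toHomeomorph.toMeasurableEquiv.prodCongr (MeasurableEquiv.refl _)).measurableEmbedding

theorem inner_hyperplaneCoords_sub {n : E d} (hn : ‖n‖ = 1) (x₀ : E d) (p : ℝ × (ℝ ∙ n)ᗮ) :
    ⟪n, hyperplaneCoords n x₀ p - x₀⟫ = p.1 := by
  have h2 : ⟪n, (p.2 : E d)⟫ = 0 := (Submodule.mem_orthogonal_singleton_iff_inner_right.1 p.2.2)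
  have : hyperplaneCoords n x₀ p - x₀ = p.1 • n + p.2 := by
    simp [hyperplaneCoords, add_assoc]
  rw [this, inner_add_right, h2, inner_smul_right, real_inner_self_eq_norm_sq, hn]
  simp

theorem isClosed_hyperplane (n x₀ : E d) : IsClosed {x : E d | ⟪n, x - x₀⟫ = 0} :=
  isClosed_eq (by fun_prop) continuous_const

/-- The surface measure on a hyperplane is Lebesgue measure in Cartesian coordinates. -/
theorem surf_hyperplane {n : E d} (hn : ‖n‖ = 1) (x₀ : E d) :
    surf {x : E d | ⟪n, x - x₀⟫ = 0} =
      (volume : Measure (ℝ ∙ n)ᗮ).map (fun y : (ℝ ∙ n)ᗮ => x₀ + (y : E d)) := by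
  have hn0 : n ≠ 0 := by rintro rfl; simp at hn
  have hd : Module.finrank ℝ (ℝ ∙ n)ᗮ = d - 1 := by
    have h := Submodule.finrank_add_finrank_orthogonal (ℝ ∙ n)
    rw [finrank_span_singleton hn0, finrank_euclideanSpace_fin] at h
    omega
  have hiso : Isometry (fun y : (ℝ ∙ n)ᗮ => x₀ + (y : E d)) :=
    (isometry_add_left x₀).comp isometry_subtype_coe
  rw [← InnerProductSpace.euclideanHausdorffMeasure_eq_volume, hd,
    hiso.map_euclideanHausdorffMeasure, surf]
  congr 1
  ext x
  simp only [Set.mem_ofPred_eq, Set.mem_range]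
  constructor
  · intro h
    exact ⟨⟨x - x₀, Submodule.mem_orthogonal_singleton_iff_inner_right.2 h⟩, by simp⟩
  · rintro ⟨y, rfl⟩
    simpa using Submodule.mem_orthogonal_singleton_iff_inner_right.1 y.2

theorem isometry_hyperplaneCoords_left {n : E d} (hn : ‖n‖ = 1) (x₀ : E d) (y : (ℝ ∙ n)ᗮ) :
    Isometry (fun t : ℝ => hyperplaneCoords n x₀ (t, y)) := by
  refine Isometry.of_dist_eq fun s t => ?_
  simp only [hyperplaneCoords, dist_add_left, dist_add_right]
  rw [dist_eq_norm, ← sub_smul, norm_smul, hn, mul_one, dist_eq_norm]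

theorem isometry_hyperplaneCoords_right (n x₀ : E d) (t : ℝ) :
    Isometry (fun y : (ℝ ∙ n)ᗮ => hyperplaneCoords n x₀ (t, y)) :=
  (isometry_add_left (x₀ + t • n)).comp isometry_subtype_coe

/-- Fubini's theorem on a half-space. -/
theorem integral_halfspace {n : E d} (hn : ‖n‖ = 1) (x₀ : E d) (g : E d → ℝ) :
    ∫ x in {x | ⟪n, x - x₀⟫ < 0}, g x =
      ∫ p in Set.Iio (0 : ℝ) ×ˢ (Set.univ : Set (ℝ ∙ n)ᗮ), g (hyperplaneCoords n x₀ p)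
        ∂(volume.prod volume) := by
  rw [← (measurePreserving_hyperplaneCoords hn x₀).setIntegral_preimage_emb
    (measurableEmbedding_hyperplaneCoords hn x₀)]
  congr 2
  ext p
  simp [inner_hyperplaneCoords_sub hn]

theorem continuous_fderiv_apply_const {ψ : E d → ℝ} (hψ : ContDiff ℝ ∞ ψ) (a : E d) :
    Continuous (fun x => fderiv ℝ ψ x a) :=
  (hψ.continuous_fderiv (by simp)).clm_apply continuous_const

theorem hasCompactSupport_fderiv_apply_const {ψ : E d → ℝ} (hψ : HasCompactSupport ψ) (a : E d) :
    HasCompactSupport (fun x => fderiv ℝ ψ x a) :=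
  hψ.fderiv_apply ℝ a

/-- The integral of a derivative over the whole space vanishes. -/
theorem integral_fderiv_apply_eq_zero {V : Type*} [NormedAddCommGroup V] [NormedSpace ℝ V]
    [MeasurableSpace V] [BorelSpace V] [FiniteDimensional ℝ V] {μ : Measure V}
    [μ.IsAddHaarMeasure] {ψ : V → ℝ} (hψ : ContDiff ℝ ∞ ψ)
    (hc : HasCompactSupport ψ) (a : V) : ∫ x, fderiv ℝ ψ x a ∂μ = 0 := by
  have h1 : Continuous (fun x => fderiv ℝ ψ x a) :=
    (hψ.continuous_fderiv (by simp)).clm_apply continuous_const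
  have := integral_bilinear_hasLineDerivAt_right_eq_neg_left_of_integrable (μ := μ)
    (f := fun _ : V => (1 : ℝ)) (f' := fun _ => 0) (g := ψ) (g' := fun x => fderiv ℝ ψ x a)
    (v := a) (B := ContinuousLinearMap.mul ℝ ℝ) (by simp)
    (by simpa using h1.integrable_of_hasCompactSupport (hc.fderiv_apply ℝ a))
    (by simpa using hψ.continuous.integrable_of_hasCompactSupport hc)
    (fun x _ => by
      have := ((hasFDerivAt_const (𝕜 := ℝ) (1 : ℝ) x).hasLineDerivAt a)
      simpa using this)
    (fun x _ => ((hψ.differentiable (by simp) x).hasFDerivAt).hasLineDerivAt a)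
  simpa using this

theorem integrable_fderiv_comp_hyperplaneCoords {n : E d} (hn : ‖n‖ = 1) (x₀ : E d)
    {ψ : E d → ℝ} (hψ : ContDiff ℝ ∞ ψ) (hc : HasCompactSupport ψ) (a : E d) :
    Integrable (fun p => fderiv ℝ ψ (hyperplaneCoords n x₀ p) a) (volume.prod volume) :=
  ((measurePreserving_hyperplaneCoords hn x₀).integrable_comp_emb
    (measurableEmbedding_hyperplaneCoords hn x₀)).2
    ((continuous_fderiv_apply_const hψ a).integrable_of_hasCompactSupport
      (hasCompactSupport_fderiv_apply_const hc a))

/-- Along each line parallel to `n` this is the fundamental theorem of calculus on a half-line;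
Fubini assembles the lines. -/
theorem integral_halfspace_fderiv_normal {n : E d} (hn : ‖n‖ = 1) (x₀ : E d) {ψ : E d → ℝ}
    (hψ : ContDiff ℝ ∞ ψ) (hc : HasCompactSupport ψ) :
    ∫ x in {x | ⟪n, x - x₀⟫ < 0}, fderiv ℝ ψ x n =
      ∫ x, ψ x ∂(surf {x | ⟪n, x - x₀⟫ = 0}) := by
  have hint := integrable_fderiv_comp_hyperplaneCoords hn x₀ hψ hc n
  rw [integral_halfspace hn x₀, surf_hyperplane hn x₀, integral_map (by fun_prop)
    hψ.continuous.aestronglyMeasurable, ← Measure.prod_restrict, Measure.restrict_univ,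
    integral_prod_symm]
  · refine integral_congr_ae (ae_of_all _ fun y => ?_)
    simp only
    rw [← integral_Iic_eq_integral_Iio]
    have hcomp : ContDiff ℝ 1 (fun t : ℝ => ψ (hyperplaneCoords n x₀ (t, y))) := by
      refine (hψ.of_le (by simp)).comp ?_
      simp only [hyperplaneCoords]
      exact (contDiff_const.add (contDiff_id.smul contDiff_const)).add contDiff_const
    have := HasCompactSupport.integral_Iic_deriv_eq hcomp
      (hc.comp_isClosedEmbedding (isometry_hyperplaneCoords_left hn x₀ y).isClosedEmbedding) 0
    simp only [hyperplaneCoords, zero_smul, add_zero] at this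
    rw [← this]
    refine integral_congr_ae (ae_of_all _ fun t => ?_)
    have h1 : HasDerivAt (fun t : ℝ => x₀ + t • n + (y : E d)) n t := by
      simpa using (((hasDerivAt_id t).smul_const n).const_add x₀).add_const (y : E d)
    exact (((hψ.differentiable (by simp) _).hasFDerivAt).comp_hasDerivAt t h1).deriv.symm
  · have := hint.integrableOn (s := Set.Iio (0 : ℝ) ×ˢ (Set.univ : Set (ℝ ∙ n)ᗮ))
    rwa [IntegrableOn, ← Measure.prod_restrict, Measure.restrict_univ] at this

/-- A tangential direction stays inside each parallel hyperplane, where the integral of a derivative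
of a compactly supported function is zero. -/
theorem integral_halfspace_fderiv_tangential {n : E d} (hn : ‖n‖ = 1) (x₀ : E d) {ψ : E d → ℝ}
    (hψ : ContDiff ℝ ∞ ψ) (hc : HasCompactSupport ψ) {a : E d} (ha : ⟪n, a⟫ = 0) :
    ∫ x in {x | ⟪n, x - x₀⟫ < 0}, fderiv ℝ ψ x a = 0 := by
  have hint := integrable_fderiv_comp_hyperplaneCoords hn x₀ hψ hc a
  rw [integral_halfspace hn x₀, setIntegral_prod _ hint.integrableOn]
  refine integral_eq_zero_of_ae (ae_of_all _ fun t => ?_)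
  simp only [Measure.restrict_univ, Pi.zero_apply]
  let a' : (ℝ ∙ n)ᗮ := ⟨a, Submodule.mem_orthogonal_singleton_iff_inner_right.2 ha⟩
  have hcomp : ContDiff ℝ ∞ (fun y : (ℝ ∙ n)ᗮ => ψ (hyperplaneCoords n x₀ (t, y))) := by
    refine hψ.comp ?_
    simp only [hyperplaneCoords]
    exact (contDiff_const (c := x₀ + t • n)).add (ℝ ∙ n)ᗮ.subtypeL.contDiff
  rw [← integral_fderiv_apply_eq_zero (μ := volume) hcomp
    (hc.comp_isClosedEmbedding (isometry_hyperplaneCoords_right n x₀ t).isClosedEmbedding) a']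
  refine integral_congr_ae (ae_of_all _ fun y => ?_)
  have h1 : HasFDerivAt (fun y : (ℝ ∙ n)ᗮ => hyperplaneCoords n x₀ (t, y)) (ℝ ∙ n)ᗮ.subtypeL y :=
    (ℝ ∙ n)ᗮ.subtypeL.hasFDerivAt.const_add (x₀ + t • n)
  have h2 := ((hψ.differentiable (by simp) _).hasFDerivAt).comp y h1
  have h3 : fderiv ℝ (fun y : (ℝ ∙ n)ᗮ => ψ (hyperplaneCoords n x₀ (t, y))) y = _ := h2.fderiv
  simp only
  rw [h3]
  simp [a']

/-- Green's formula on a half-space. -/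
theorem integral_halfspace_fderiv {n : E d} (hn : ‖n‖ = 1) (x₀ : E d) {ψ : E d → ℝ}
    (hψ : ContDiff ℝ ∞ ψ) (hc : HasCompactSupport ψ) (a : E d) :
    ∫ x in {x | ⟪n, x - x₀⟫ < 0}, fderiv ℝ ψ x a =
      ⟪n, a⟫ * ∫ x, ψ x ∂(surf {x | ⟪n, x - x₀⟫ = 0}) := by
  -- Split `a` into its normal part and a tangential rest; only the normal part contributes.
  have h : ⟪n, a - ⟪n, a⟫ • n⟫ = 0 := by
    rw [inner_sub_right, inner_smul_right, real_inner_self_eq_norm_sq, hn]; simp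
  have hi : ∀ b : E d, Integrable (fun x => fderiv ℝ ψ x b)
      (volume.restrict {x | ⟪n, x - x₀⟫ < 0}) := fun b =>
    ((continuous_fderiv_apply_const hψ b).integrable_of_hasCompactSupport
      (hasCompactSupport_fderiv_apply_const hc b)).integrableOn
  have h0 := integral_halfspace_fderiv_tangential hn x₀ hψ hc h
  simp only [map_sub, map_smul, smul_eq_mul] at h0
  rwa [integral_sub (hi a) ((hi n).const_mul _), integral_const_mul, sub_eq_zero,
    integral_halfspace_fderiv_normal hn x₀ hψ hc] at h0

/-! ### Local structure of a polytope along a face -/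

/-- On the negative side of the hyperplane the ball consists of interior points of `K`, and on the
positive side it misses `K`. -/
theorem frontier_inter_ball_subset {K : Set (E d)} {n x : E d} {r : ℝ}
    (h : K ∩ Metric.ball x r = {y | ⟪n, y - x⟫ < 0} ∩ Metric.ball x r) :
    frontier K ∩ Metric.ball x r ⊆ {y | ⟪n, y - x⟫ = 0} := by
  rintro y ⟨hy, hyr⟩
  have hc : Continuous fun y : E d => ⟪n, y - x⟫ := by fun_prop
  rcases lt_trichotomy ⟪n, y - x⟫ 0 with hlt | heq | hgt
  · exfalso
    have hopen : IsOpen ({y | ⟪n, y - x⟫ < 0} ∩ Metric.ball x r) :=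
      (isOpen_lt hc continuous_const).inter Metric.isOpen_ball
    have : y ∈ interior K := interior_maximal (h ▸ Set.inter_subset_left) hopen ⟨hlt, hyr⟩
    exact hy.2 this
  · exact heq
  · exfalso
    have hopen : IsOpen ({y | 0 < ⟪n, y - x⟫} ∩ Metric.ball x r) :=
      (isOpen_lt continuous_const hc).inter Metric.isOpen_ball
    obtain ⟨z, ⟨hz, hzr⟩, hzK⟩ := mem_closure_iff.1 hy.1 _ hopen ⟨hgt, hyr⟩
    have : z ∈ {y | ⟪n, y - x⟫ < 0} ∩ Metric.ball x r := h ▸ ⟨hzK, hzr⟩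
    exact lt_asymm (a := ⟪n, z - x⟫) this.1 hz

/-- Near a point of a face, the element is a half-space and the face is the hyperplane. -/
theorem IsFlatFace.exists_ball {K F : Set (E d)} {n x : E d} (hF : IsFlatFace F)
    (hFK : F ⊆ frontier K) (hn : IsOutwardNormal K F n) (hx : x ∈ F) :
    ∃ r > 0, K ∩ Metric.ball x r = {y | ⟪n, y - x⟫ < 0} ∩ Metric.ball x r ∧
      frontier K ∩ Metric.ball x r ⊆ {y | ⟪n, y - x⟫ = 0} ∧
      {y | ⟪n, y - x⟫ = 0} ∩ Metric.ball x r ⊆ F := by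
  obtain ⟨m, b, U, hm, hU, rfl⟩ := hF.flat
  obtain ⟨r₀, hr₀, h₀⟩ := hn.2 x hx
  obtain ⟨r₁, hr₁, h₁⟩ := Metric.isOpen_iff.1 hU x hx.1
  have hsub : K ∩ Metric.ball x (min r₀ r₁) =
      {y | ⟪n, y - x⟫ < 0} ∩ Metric.ball x (min r₀ r₁) := by
    have hb : Metric.ball x (min r₀ r₁) ⊆ Metric.ball x r₀ :=
      Metric.ball_subset_ball (min_le_left _ _)
    rw [← Set.inter_eq_self_of_subset_right hb, ← Set.inter_assoc, h₀, Set.inter_assoc]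
  have hfr := frontier_inter_ball_subset hsub
  have hr : 0 < min r₀ r₁ := lt_min hr₀ hr₁
  refine ⟨_, hr, hsub, hfr, ?_⟩
  -- The normal `m` from flatness and the outward normal `n` are parallel. The part `v` of `n`
  -- orthogonal to `m` is tangent to the face, so a short step along `v` stays in `F`, hence in the
  -- frontier, where the `n`-coordinate is zero. This forces `⟪n, v⟫ = 0`, and then `v = 0`.
  have hnm : n = ⟪m, n⟫ • m := by
    set v : E d := n - ⟪m, n⟫ • m with hv
    have hmv : ⟪m, v⟫ = 0 := by
      rw [hv, inner_sub_right, inner_smul_right, real_inner_self_eq_norm_sq, hm]; simp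
    have hnv : ⟪n, v⟫ = 0 := by
      obtain ⟨t, ht, htv⟩ : ∃ t : ℝ, 0 < t ∧ ‖t • v‖ < min r₀ r₁ := by
        refine ⟨min r₀ r₁ / (2 * (‖v‖ + 1)), by positivity, ?_⟩
        rw [norm_smul, Real.norm_of_nonneg (by positivity), div_mul_eq_mul_div,
          div_lt_iff₀ (by positivity)]
        nlinarith [norm_nonneg v]
      have hmem : x + t • v ∈ Metric.ball x (min r₀ r₁) := by simpa [Metric.mem_ball] using htv
      have hF' : x + t • v ∈ U ∩ {x | ⟪m, x⟫ = b} := by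
        refine ⟨h₁ (Metric.ball_subset_ball (min_le_right _ _) hmem), ?_⟩
        have : ⟪m, x⟫ = b := hx.2
        simp [inner_add_right, inner_smul_right, hmv, this]
      have h0 : ⟪n, x + t • v - x⟫ = 0 := hfr ⟨hFK hF', hmem⟩
      rw [add_sub_cancel_left, inner_smul_right] at h0
      exact (mul_eq_zero.1 h0).resolve_left ht.ne'
    have hvv : ⟪v, v⟫ = 0 := by
      nth_rewrite 1 [hv]
      rw [inner_sub_left, hnv, inner_smul_left, hmv]; simp
    exact sub_eq_zero.1 (inner_self_eq_zero.1 hvv)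
  have hmn0 : ⟪m, n⟫ ≠ 0 := by
    intro h
    have h1 := hn.1
    rw [hnm, h, zero_smul, norm_zero] at h1
    exact zero_ne_one h1
  rintro y ⟨hy, hyr⟩
  refine ⟨h₁ (Metric.ball_subset_ball (min_le_right _ _) hyr), ?_⟩
  have hy' : ⟪n, y - x⟫ = 0 := hy
  rw [hnm, inner_smul_left] at hy'
  have h2 : ⟪m, y - x⟫ = 0 := (mul_eq_zero.1 hy').resolve_left (by simpa using hmn0)
  have : ⟪m, x⟫ = b := hx.2
  rw [inner_sub_right, this, sub_eq_zero] at h2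
  exact h2

theorem IsPolytope.face_subset {K : Set (E d)} {Fs : Finset (Set (E d))} (hK : IsPolytope K Fs)
    {F : Set (E d)} (hF : F ∈ Fs) : F ⊆ frontier K := by
  rw [hK.frontier_eq]
  exact subset_closure.trans (Set.subset_biUnion_of_mem (u := fun F => closure F) hF)

/-- Near a point of `F` the whole frontier of `K` lies in `F`, so a face accumulating there would
meet `F`. -/
theorem IsPolytope.disjoint_closure {K : Set (E d)} {Fs : Finset (Set (E d))}
    (hK : IsPolytope K Fs) (hd : (Fs : Set (Set (E d))).PairwiseDisjoint id) {F F' : Set (E d)}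
    (hF : F ∈ Fs) (hF' : F' ∈ Fs) (hne : F ≠ F') : Disjoint F (closure F') := by
  rw [Set.disjoint_left]
  intro x hx hx'
  obtain ⟨n, hn⟩ := hK.normal F hF
  obtain ⟨r, hr, -, h1, h2⟩ := (hK.face F hF).exists_ball (hK.face_subset hF) hn hx
  obtain ⟨y, hyr, hyF'⟩ := mem_closure_iff.1 hx' _ Metric.isOpen_ball (Metric.mem_ball_self hr)
  have hyF : y ∈ F := h2 ⟨h1 ⟨hK.face_subset hF' hyF', hyr⟩, hyr⟩
  exact Set.disjoint_left.1 (hd hF hF' hne) hyF hyF'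

/-- The open set that contains the face `F` and avoids the closures of the other faces. -/
def awayFrom (Fs : Finset (Set (E d))) (F : Set (E d)) : Set (E d) :=
  (⋃ F' ∈ Fs.erase F, closure F')ᶜ

theorem isOpen_awayFrom (Fs : Finset (Set (E d))) (F : Set (E d)) : IsOpen (awayFrom Fs F) :=
  (isClosed_biUnion_finset fun _ _ => isClosed_closure).isOpen_compl

theorem disjoint_awayFrom {Fs : Finset (Set (E d))} {F F' : Set (E d)} (hF' : F' ∈ Fs)
    (hne : F' ≠ F) : Disjoint F' (awayFrom Fs F) := by
  rw [Set.disjoint_left]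
  intro x hx h
  exact h (Set.mem_biUnion (Finset.mem_erase.2 ⟨hne, hF'⟩) (subset_closure hx))

theorem IsPolytope.subset_awayFrom {K : Set (E d)} {Fs : Finset (Set (E d))}
    (hK : IsPolytope K Fs) (hd : (Fs : Set (Set (E d))).PairwiseDisjoint id) {F : Set (E d)}
    (hF : F ∈ Fs) : F ⊆ awayFrom Fs F := by
  intro x hx h
  simp only [Set.mem_iUnion] at h
  obtain ⟨F', hF', hxF'⟩ := h
  rw [Finset.mem_erase] at hF'
  exact Set.disjoint_left.1 (hK.disjoint_closure hd hF hF'.2 hF'.1.symm) hx hxF'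

/-! ### Measures of faces and boundaries -/

theorem IsFlatFace.measurableSet {F : Set (E d)} (hF : IsFlatFace F) : MeasurableSet F := by
  obtain ⟨n, b, U, -, hU, rfl⟩ := hF.flat
  exact hU.measurableSet.inter
    (isClosed_eq (by fun_prop : Continuous fun x : E d => ⟪n, x⟫) continuous_const).measurableSet

theorem IsFlatFace.exists_hyperplane {F : Set (E d)} (hF : IsFlatFace F) :
    ∃ n x₀ : E d, ‖n‖ = 1 ∧ F ⊆ {x | ⟪n, x - x₀⟫ = 0} := by
  obtain ⟨n, b, U, hn, hU, rfl⟩ := hF.flat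
  refine ⟨n, b • n, hn, fun x hx => ?_⟩
  have : ⟪n, x⟫ = b := hx.2
  simp [inner_sub_right, inner_smul_right, this, hn]

theorem surf_eq_restrict {F H : Set (E d)} (h : F ⊆ H) : surf F = (surf H).restrict F := by
  rw [surf, surf, Measure.restrict_restrict_of_subset h]

theorem surf_hyperplane_lt_top {n : E d} (hn : ‖n‖ = 1) (x₀ : E d) {B : Set (E d)}
    (hB : Bornology.IsBounded B) : surf {x : E d | ⟪n, x - x₀⟫ = 0} B < ⊤ := by
  obtain ⟨R, hR⟩ := hB.subset_closedBall x₀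
  refine (measure_mono hR).trans_lt ?_
  rw [surf_hyperplane hn x₀, Measure.map_apply (by fun_prop) Metric.isClosed_closedBall.measurableSet]
  have : (fun y : (ℝ ∙ n)ᗮ => x₀ + (y : E d)) ⁻¹' Metric.closedBall x₀ R = Metric.closedBall 0 R := by
    ext y; simp
  rw [this]
  exact measure_closedBall_lt_top

theorem IsFlatFace.isFiniteMeasure_surf {F : Set (E d)} (hF : IsFlatFace F)
    (hb : Bornology.IsBounded F) : IsFiniteMeasure (surf F) := by
  obtain ⟨n, x₀, hn, h⟩ := hF.exists_hyperplane
  rw [surf_eq_restrict h]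
  exact ⟨by rw [Measure.restrict_apply_univ]; exact surf_hyperplane_lt_top hn x₀ hb⟩

theorem volume_hyperplane {n : E d} (hn : ‖n‖ = 1) (x₀ : E d) :
    volume {x : E d | ⟪n, x - x₀⟫ = 0} = 0 := by
  rw [← (measurePreserving_hyperplaneCoords hn x₀).measure_preimage
    (isClosed_hyperplane n x₀).measurableSet.nullMeasurableSet]
  have : hyperplaneCoords n x₀ ⁻¹' {x : E d | ⟪n, x - x₀⟫ = 0} = {0} ×ˢ Set.univ := by
    ext p; simp [inner_hyperplaneCoords_sub hn]
  rw [this, Measure.prod_prod]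
  simp

theorem IsPolytope.volume_frontier {K : Set (E d)} {Fs : Finset (Set (E d))}
    (hK : IsPolytope K Fs) : volume (frontier K) = 0 := by
  rw [hK.frontier_eq]
  refine (measure_biUnion_null_iff Fs.countable_toSet).2 fun F hF => ?_
  obtain ⟨n, x₀, hn, h⟩ := (hK.face F hF).exists_hyperplane
  exact measure_mono_null (closure_minimal h (isClosed_hyperplane n x₀)) (volume_hyperplane hn x₀)

theorem IsPolytope.isBounded_face {K : Set (E d)} {Fs : Finset (Set (E d))}
    (hK : IsPolytope K Fs) {F : Set (E d)} (hF : F ∈ Fs) : Bornology.IsBounded F :=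
  hK.bounded.closure.subset ((hK.face_subset hF).trans frontier_subset_closure)

theorem IsPolytope.isFiniteMeasure_surf {K : Set (E d)} {Fs : Finset (Set (E d))}
    (hK : IsPolytope K Fs) {F : Set (E d)} (hF : F ∈ Fs) : IsFiniteMeasure (surf F) :=
  (hK.face F hF).isFiniteMeasure_surf (hK.isBounded_face hF)

theorem IsPolytope.isFiniteMeasure_restrict {K : Set (E d)} {Fs : Finset (Set (E d))}
    (hK : IsPolytope K Fs) : IsFiniteMeasure (volume.restrict K) :=
  ⟨by rw [Measure.restrict_apply_univ]; exact hK.bounded.measure_lt_top⟩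

theorem IsPolytope.ae_surf_mem {K : Set (E d)} {Fs : Finset (Set (E d))}
    (hK : IsPolytope K Fs) {F : Set (E d)} (hF : F ∈ Fs) : ∀ᵐ x ∂(surf F), x ∈ F :=
  ae_restrict_mem (hK.face F hF).measurableSet

/-- A continuous function on a bounded set of finite measure is integrable, and lies in all
`L^p`. -/
theorem memLp_of_continuous {V : Type*} [NormedAddCommGroup V]
    {μ : Measure (E d)} [IsFiniteMeasure μ] {B : Set (E d)} (hB : Bornology.IsBounded B)
    (hμ : ∀ᵐ x ∂μ, x ∈ B) {g : E d → V} (hg : Continuous g) (p : ENNReal) : MemLp g p μ := by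
  obtain ⟨C, hC⟩ := (hB.isCompact_closure.image hg).isBounded.exists_norm_le
  refine MemLp.of_bound hg.aestronglyMeasurable C ?_
  filter_upwards [hμ] with x hx
  exact hC _ ⟨x, subset_closure hx, rfl⟩

theorem IsPolytope.memLp_surf {V : Type*} [NormedAddCommGroup V]
    {K : Set (E d)} {Fs : Finset (Set (E d))}
    (hK : IsPolytope K Fs) {F : Set (E d)} (hF : F ∈ Fs) {g : E d → V} (hg : Continuous g)
    (p : ENNReal) : MemLp g p (surf F) :=
  haveI := hK.isFiniteMeasure_surf hF
  memLp_of_continuous (hK.isBounded_face hF) (hK.ae_surf_mem hF) hg p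

theorem IsPolytope.memLp_volume {V : Type*} [NormedAddCommGroup V]
    {K : Set (E d)} {Fs : Finset (Set (E d))}
    (hK : IsPolytope K Fs) {g : E d → V} (hg : Continuous g)
    (p : ENNReal) : MemLp g p (volume.restrict K) :=
  haveI := hK.isFiniteMeasure_restrict
  memLp_of_continuous hK.bounded (ae_restrict_mem hK.isOpen.measurableSet) hg p

theorem IsPolytope.integrable_surf {K : Set (E d)} {Fs : Finset (Set (E d))}
    (hK : IsPolytope K Fs) {F : Set (E d)} (hF : F ∈ Fs) {g : E d → ℝ} (hg : Continuous g) :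
    Integrable g (surf F) :=
  memLp_one_iff_integrable.1 (hK.memLp_surf hF hg 1)

theorem IsPolytope.integrable_volume {K : Set (E d)} {Fs : Finset (Set (E d))}
    (hK : IsPolytope K Fs) {g : E d → ℝ} (hg : Continuous g) :
    Integrable g (volume.restrict K) :=
  memLp_one_iff_integrable.1 (hK.memLp_volume hg 1)

/-! ### Green's formula on a polytope -/

/-- The outward unit normal of `K` along `F`. -/
noncomputable def faceNormal (K F : Set (E d)) : E d := Classical.epsilon (IsOutwardNormal K F)

theorem IsPolytope.faceNormal_spec {K : Set (E d)} {Fs : Finset (Set (E d))}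
    (hK : IsPolytope K Fs) {F : Set (E d)} (hF : F ∈ Fs) :
    IsOutwardNormal K F (faceNormal K F) :=
  Classical.epsilon_spec (hK.normal F hF)

/-- The difference of both sides of Green's formula for the vector field `ψ a`. -/
noncomputable def greenDefect (K : Set (E d)) (Fs : Finset (Set (E d))) (a : E d)
    (ψ : E d → ℝ) : ℝ :=
  (∫ x in K, fderiv ℝ ψ x a) - ∑ F ∈ Fs, ⟪faceNormal K F, a⟫ * ∫ x, ψ x ∂(surf F)

theorem IsPolytope.greenDefect_add {K : Set (E d)} {Fs : Finset (Set (E d))}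
    (hK : IsPolytope K Fs) (a : E d) {ψ η : E d → ℝ} (hψ : ContDiff ℝ ∞ ψ) (hη : ContDiff ℝ ∞ η) :
    greenDefect K Fs a (ψ + η) = greenDefect K Fs a ψ + greenDefect K Fs a η := by
  have h1 : ∫ x in K, fderiv ℝ (ψ + η) x a =
      (∫ x in K, fderiv ℝ ψ x a) + ∫ x in K, fderiv ℝ η x a := by
    rw [← integral_add (hK.integrable_volume (continuous_fderiv_apply_const hψ a))
      (hK.integrable_volume (continuous_fderiv_apply_const hη a))]
    refine integral_congr_ae (ae_of_all _ fun x => ?_)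
    simp only
    rw [fderiv_add (hψ.differentiable (by simp) x) (hη.differentiable (by simp) x)]
    rfl
  have h2 : ∑ F ∈ Fs, ⟪faceNormal K F, a⟫ * ∫ x, (ψ + η) x ∂(surf F) =
      ∑ F ∈ Fs, ⟪faceNormal K F, a⟫ * (∫ x, ψ x ∂(surf F)) +
      ∑ F ∈ Fs, ⟪faceNormal K F, a⟫ * ∫ x, η x ∂(surf F) := by
    rw [← Finset.sum_add_distrib]
    refine Finset.sum_congr rfl fun F hF => ?_
    rw [← mul_add, ← integral_add (hK.integrable_surf hF hψ.continuous)
      (hK.integrable_surf hF hη.continuous)]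
    rfl
  rw [greenDefect, greenDefect, greenDefect, h1, h2]
  ring

theorem fderiv_apply_eq_zero_of_notMem_tsupport {ψ : E d → ℝ} {x : E d} (hx : x ∉ tsupport ψ)
    (a : E d) : fderiv ℝ ψ x a = 0 := by
  have h : fderiv ℝ ψ x = 0 := by
    by_contra h
    exact hx (support_fderiv_subset ℝ h)
  simp [h]

theorem integral_surf_eq_zero {F : Set (E d)} (hF : MeasurableSet F) {ψ : E d → ℝ}
    (h : Disjoint F (tsupport ψ)) : ∫ x, ψ x ∂(surf F) = 0 := by
  refine integral_eq_zero_of_ae ?_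
  filter_upwards [ae_restrict_mem hF] with x hx
  exact image_eq_zero_of_notMem_tsupport (Set.disjoint_left.1 h hx)

theorem IsPolytope.greenDefect_of_tsupport_subset {K : Set (E d)} {Fs : Finset (Set (E d))}
    (hK : IsPolytope K Fs) (a : E d) {ψ : E d → ℝ} (hψ : ContDiff ℝ ∞ ψ)
    (hc : HasCompactSupport ψ) (h : tsupport ψ ⊆ K) : greenDefect K Fs a ψ = 0 := by
  have h1 : ∫ x in K, fderiv ℝ ψ x a = 0 := by
    rw [setIntegral_eq_integral_of_forall_compl_eq_zero]
    · exact integral_fderiv_apply_eq_zero hψ hc a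
    · exact fun x hx => fderiv_apply_eq_zero_of_notMem_tsupport (fun hx' => hx (h hx')) a
  rw [greenDefect, h1, Finset.sum_eq_zero, sub_zero]
  intro F hF
  rw [integral_surf_eq_zero (hK.face F hF).measurableSet, mul_zero]
  refine Set.disjoint_left.2 fun x hx hx' => ?_
  have := hK.face_subset hF hx
  rw [hK.isOpen.frontier_eq] at this
  exact this.2 (h hx')

theorem IsPolytope.greenDefect_of_disjoint {K : Set (E d)} {Fs : Finset (Set (E d))}
    (hK : IsPolytope K Fs) (a : E d) {ψ : E d → ℝ} (h : tsupport ψ ⊆ (closure K)ᶜ) :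
    greenDefect K Fs a ψ = 0 := by
  have h1 : ∫ x in K, fderiv ℝ ψ x a = 0 :=
    setIntegral_eq_zero_of_forall_eq_zero fun x hx =>
      fderiv_apply_eq_zero_of_notMem_tsupport (fun hx' => h hx' (subset_closure hx)) a
  rw [greenDefect, h1, Finset.sum_eq_zero, sub_zero]
  intro F hF
  rw [integral_surf_eq_zero (hK.face F hF).measurableSet, mul_zero]
  exact Set.disjoint_left.2 fun x hx hx' =>
    h hx' (frontier_subset_closure (hK.face_subset hF hx))

/-- In a small ball around `x` the element is a half-space, `F` is its bounding hyperplane and no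
other face is present, so the half-space formula applies verbatim. -/
theorem IsPolytope.exists_greenDefect_eq_zero_of_mem_face {K : Set (E d)}
    {Fs : Finset (Set (E d))} (hK : IsPolytope K Fs)
    (hdis : (Fs : Set (Set (E d))).PairwiseDisjoint id) (a : E d) {F : Set (E d)} (hF : F ∈ Fs)
    {x : E d} (hx : x ∈ F) : ∃ r > 0, ∀ ψ : E d → ℝ, ContDiff ℝ ∞ ψ → HasCompactSupport ψ →
      tsupport ψ ⊆ Metric.ball x r → greenDefect K Fs a ψ = 0 := by
  have hn := hK.faceNormal_spec hF
  obtain ⟨r, hr, h1, h2, h3⟩ := (hK.face F hF).exists_ball (hK.face_subset hF) hn hx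
  refine ⟨r, hr, fun ψ hψ hc hs => ?_⟩
  set n := faceNormal K F with hn_def
  have hother : ∀ F' ∈ Fs, F' ≠ F → ⟪faceNormal K F', a⟫ * ∫ x, ψ x ∂(surf F') = 0 := by
    intro F' hF' hne
    rw [integral_surf_eq_zero (hK.face F' hF').measurableSet, mul_zero]
    refine Set.disjoint_left.2 fun y hy hy' => ?_
    have hyF : y ∈ F := h3 ⟨h2 ⟨hK.face_subset hF' hy, hs hy'⟩, hs hy'⟩
    exact Set.disjoint_left.1 (hdis hF' hF hne) hy hyF
  have hzero : ∀ y, y ∉ Metric.ball x r → ψ y = 0 := fun y hy =>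
    image_eq_zero_of_notMem_tsupport fun h => hy (hs h)
  have hzero' : ∀ y, y ∉ Metric.ball x r → fderiv ℝ ψ y a = 0 := fun y hy =>
    fderiv_apply_eq_zero_of_notMem_tsupport (fun h => hy (hs h)) a
  have hmemK : ∀ y ∈ Metric.ball x r, (y ∈ K ↔ ⟪n, y - x⟫ < 0) := fun y hy => by
    have := Set.ext_iff.1 h1 y
    simpa [hy] using this
  have hvol : ∫ y in K, fderiv ℝ ψ y a = ∫ y in {y | ⟪n, y - x⟫ < 0}, fderiv ℝ ψ y a := by
    have hm : MeasurableSet {y : E d | ⟪n, y - x⟫ < 0} :=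
      (isOpen_lt (by fun_prop) continuous_const).measurableSet
    rw [← integral_indicator hK.isOpen.measurableSet, ← integral_indicator hm]
    refine integral_congr_ae (ae_of_all _ fun y => ?_)
    by_cases hy : y ∈ Metric.ball x r
    · simp only [Set.indicator, hmemK y hy, Set.mem_ofPred_eq]
    · simp only [Set.indicator, hzero' y hy, ite_self]
  have hsurf : ∫ y, ψ y ∂(surf F) = ∫ y, ψ y ∂(surf {y | ⟪n, y - x⟫ = 0}) := by
    rw [surf, surf, ← integral_indicator (hK.face F hF).measurableSet,
      ← integral_indicator (isClosed_hyperplane n x).measurableSet]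
    refine integral_congr_ae (ae_of_all _ fun y => ?_)
    by_cases hy : y ∈ Metric.ball x r
    · have : y ∈ F ↔ y ∈ {y | ⟪n, y - x⟫ = 0} :=
        ⟨fun h => h2 ⟨hK.face_subset hF h, hy⟩, fun h => h3 ⟨h, hy⟩⟩
      simp only [Set.indicator, this]
    · simp only [Set.indicator, hzero y hy, ite_self]
  rw [greenDefect, Finset.sum_eq_single F hother (fun h => absurd hF h), ← hn_def, hvol, hsurf,
    integral_halfspace_fderiv hn.1 x hψ hc, sub_self]

/-- An additive functional on test functions that vanishes locally vanishes. -/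
theorem eq_zero_of_locally_eq_zero (L : (E d → ℝ) → ℝ)
    (hadd : ∀ ψ η : E d → ℝ, ContDiff ℝ ∞ ψ → ContDiff ℝ ∞ η → L (ψ + η) = L ψ + L η)
    {ψ : E d → ℝ} (hψ : ContDiff ℝ ∞ ψ) (hc : HasCompactSupport ψ)
    (hloc : ∀ x ∈ tsupport ψ, ∃ U : Set (E d), IsOpen U ∧ x ∈ U ∧ ∀ η : E d → ℝ,
      ContDiff ℝ ∞ η → HasCompactSupport η → tsupport η ⊆ tsupport ψ → tsupport η ⊆ U →
        L η = 0) :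
    L ψ = 0 := by
  have h0 : L 0 = 0 := by
    have := hadd 0 0 contDiff_const contDiff_const
    rw [add_zero] at this
    linarith
  choose! U hUo hxU hU using hloc
  obtain ⟨f, hf⟩ := SmoothPartitionOfUnity.exists_isSubordinate (modelWithCornersSelf ℝ (E d))
    (isClosed_tsupport ψ) (fun x : tsupport ψ => U x) (fun x => hUo x x.2)
    (fun x hx => Set.mem_iUnion.2 ⟨⟨x, hx⟩, hxU x hx⟩)
  -- Only finitely many members of the partition meet the compact support, so finite additivity of
  -- `L` is enough and no continuity is needed.
  have hfin := f.locallyFinite.finite_nonempty_inter_compact hc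
  set I := hfin.toFinset with hI
  have hsum : ψ = ∑ i ∈ I, fun x => f i x * ψ x := by
    funext x
    rw [Finset.sum_apply, ← Finset.sum_mul]
    by_cases hx : x ∈ tsupport ψ
    · have h1 := f.sum_eq_one hx
      rw [finsum_eq_sum_of_support_subset (s := I)] at h1
      · rw [h1, one_mul]
      · intro i hi
        simp only [hI, Set.Finite.coe_toFinset, Set.mem_ofPred_eq]
        exact ⟨x, hi, hx⟩
    · rw [image_eq_zero_of_notMem_tsupport hx, mul_zero]
  have hsm : ∀ i, ContDiff ℝ ∞ (fun x => f i x * ψ x) := fun i =>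
    (f i).contMDiff.contDiff.mul hψ
  have key : ∀ J : Finset (tsupport ψ), ContDiff ℝ ∞ (∑ i ∈ J, fun x => f i x * ψ x) ∧
      L (∑ i ∈ J, fun x => f i x * ψ x) = 0 := by
    intro J
    induction J using Finset.induction_on with
    | empty => exact ⟨by rw [Finset.sum_empty]; exact contDiff_const, by simpa using h0⟩
    | insert i J hi ih =>
      rw [Finset.sum_insert hi]
      refine ⟨(hsm i).add ih.1, ?_⟩
      rw [hadd _ _ (hsm i) ih.1, ih.2, add_zero]
      refine hU i i.2 _ (hsm i) hc.mul_left ?_ ?_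
      · exact tsupport_mul_subset_right
      · exact tsupport_mul_subset_left.trans (hf i)
  rw [hsum]
  exact (key I).2

/-! ### Removability of sets of codimension two -/

/-- The Hausdorff dimension of `A` is at most `d - 2`, below the dimension `d - 1` of the surface
measure. -/
theorem surf_affineSubspace_eq_zero (A : AffineSubspace ℝ (E d))
    (hA : Module.finrank ℝ A.direction + 2 ≤ d) (F : Set (E d)) : surf F (A : Set (E d)) = 0 := by
  refine le_antisymm ((Measure.restrict_le_self _).trans (le_of_eq ?_)) bot_le
  rw [Measure.euclideanHausdorffMeasure_def, Measure.smul_apply]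
  suffices h : μH[((d - 1 : ℕ) : ℝ)] (A : Set (E d)) = 0 by rw [h]; simp
  rcases (A : Set (E d)).eq_empty_or_nonempty with h | ⟨x₀, hx₀⟩
  · rw [h]; simp
  have hiso : Isometry (fun y : A.direction => x₀ + (y : E d)) :=
    (isometry_add_left x₀).comp isometry_subtype_coe
  have himg : (A : Set (E d)) = (fun y : A.direction => x₀ + (y : E d)) '' Set.univ := by
    ext x
    simp only [Set.image_univ, Set.mem_range]
    constructor
    · intro hx
      exact ⟨⟨x - x₀, AffineSubspace.vsub_mem_direction hx hx₀⟩, by simp⟩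
    · rintro ⟨y, rfl⟩
      have := AffineSubspace.vadd_mem_of_mem_direction y.2 hx₀
      rwa [vadd_eq_add, add_comm] at this
  have hdim : dimH (A : Set (E d)) = Module.finrank ℝ A.direction := by
    rw [himg, hiso.dimH_image, Real.dimH_univ_eq_finrank]
  have := hausdorffMeasure_of_dimH_lt (d := ((d - 1 : ℕ) : NNReal)) (s := (A : Set (E d))) (by
    rw [hdim]
    have : Module.finrank ℝ A.direction < d - 1 := by omega
    exact_mod_cast this)
  rwa [NNReal.coe_natCast] at this

/-- The orthogonal projection onto the orthogonal complement of `V`. -/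
noncomputable def perp (V : Submodule ℝ (E d)) : E d →L[ℝ] Vᗮ := Vᗮ.orthogonalProjectionOnto

/-- The volume of a neighbourhood of an affine subspace. -/
theorem volume_tube_le (V : Submodule ℝ (E d)) (x₀ : E d) (R ε : ℝ) :
    volume {x : E d | ‖perp V (x - x₀)‖ ≤ ε ∧ ‖x - x₀‖ ≤ R} ≤
      volume (Metric.closedBall (0 : V) R) * volume (Metric.closedBall (0 : Vᗮ) ε) := by
  have h := V.measurePreserving_measurableEquivProd x₀
  rw [InnerProductSpace.euclideanHausdorffMeasure_eq_volume] at h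
  rw [← Measure.prod_prod]
  refine le_trans (measure_mono ?_) (h.measure_preimage
    (Metric.isClosed_closedBall.measurableSet.prod
      Metric.isClosed_closedBall.measurableSet).nullMeasurableSet).le
  rintro x ⟨h1, h2⟩
  simp only [Set.mem_preimage, Submodule.measurableEquivProd_apply, Set.mem_prod,
    mem_closedBall_zero_iff, vsub_eq_sub]
  exact ⟨(V.norm_orthogonalProjectionOnto_apply_le _).trans h2, h1⟩

/-- The cross-section is a ball of radius `ε` in a space of dimension `m ≥ 2`, and `ε ^ m ≤ 2 ^ (m -
2) * ε ^ 2` for `ε ≤ 2`. The range up to `2` covers the radii `2 / (k + 1)` of all the cutoffs. -/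
theorem volume_real_tube_le (V : Submodule ℝ (E d)) (hV : Module.finrank ℝ V + 2 ≤ d) (x₀ : E d)
    (R : ℝ) : ∃ C : ℝ, 0 ≤ C ∧ ∀ ε : ℝ, 0 ≤ ε → ε ≤ 2 →
      volume.real {x : E d | ‖perp V (x - x₀)‖ ≤ ε ∧ ‖x - x₀‖ ≤ R} ≤ C * ε ^ 2 := by
  have hm : 2 ≤ Module.finrank ℝ Vᗮ := by
    have h := Submodule.finrank_add_finrank_orthogonal V
    rw [finrank_euclideanSpace_fin] at h
    omega
  set m := Module.finrank ℝ Vᗮ with hm_def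
  refine ⟨volume.real (Metric.closedBall (0 : V) R) *
    (2 ^ (m - 2) * volume.real (Metric.ball (0 : Vᗮ) 1)), by positivity, fun ε h0 h2 => ?_⟩
  have h1 := volume_tube_le V x₀ R ε
  have h3 : volume.real {x : E d | ‖perp V (x - x₀)‖ ≤ ε ∧ ‖x - x₀‖ ≤ R} ≤
      volume.real (Metric.closedBall (0 : V) R) * volume.real (Metric.closedBall (0 : Vᗮ) ε) := by
    rw [measureReal_def, measureReal_def, measureReal_def, ← ENNReal.toReal_mul]
    exact ENNReal.toReal_mono
      (ENNReal.mul_ne_top measure_closedBall_lt_top.ne measure_closedBall_lt_top.ne) h1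
  refine h3.trans ?_
  rw [Measure.addHaar_real_closedBall _ _ h0, mul_assoc, mul_assoc]
  refine mul_le_mul_of_nonneg_left ?_ measureReal_nonneg
  rw [mul_comm (volume.real _) (ε ^ 2), ← mul_assoc]
  refine mul_le_mul_of_nonneg_right ?_ measureReal_nonneg
  obtain ⟨k, hk⟩ := Nat.exists_eq_add_of_le hm
  rw [← hm_def, hk, pow_add, mul_comm]
  simp only [add_tsub_cancel_left]
  exact mul_le_mul_of_nonneg_right (pow_le_pow_left₀ h0 h2 k) (by positivity)

/-- A smooth bump function on `Vᗮ`. -/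
noncomputable def unitBump (V : Submodule ℝ (E d)) : ContDiffBump (0 : Vᗮ) :=
  ⟨1, 2, by norm_num, by norm_num⟩

/-- A smooth function that is `1` near the affine subspace `x₀ + V` and vanishes away from it. -/
noncomputable def tubeCutoff (V : Submodule ℝ (E d)) (x₀ : E d) (k : ℕ) (x : E d) : ℝ :=
  unitBump V (((k : ℝ) + 1) • perp V (x - x₀))

theorem contDiff_tubeCutoff (V : Submodule ℝ (E d)) (x₀ : E d) (k : ℕ) :
    ContDiff ℝ ∞ (tubeCutoff V x₀ k) := by
  unfold tubeCutoff
  exact (unitBump V).contDiff.comp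
    (((perp V).contDiff.comp (contDiff_id.sub contDiff_const)).const_smul _)

theorem tubeCutoff_nonneg (V : Submodule ℝ (E d)) (x₀ : E d) (k : ℕ) (x : E d) :
    0 ≤ tubeCutoff V x₀ k x := ContDiffBump.nonneg _

theorem tubeCutoff_le_one (V : Submodule ℝ (E d)) (x₀ : E d) (k : ℕ) (x : E d) :
    tubeCutoff V x₀ k x ≤ 1 := ContDiffBump.le_one _

theorem tubeCutoff_eq_one {V : Submodule ℝ (E d)} {x₀ : E d} {k : ℕ} {x : E d}
    (h : ((k : ℝ) + 1) * ‖perp V (x - x₀)‖ ≤ 1) : tubeCutoff V x₀ k x = 1 := by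
  refine ContDiffBump.one_of_mem_closedBall _ ?_
  rw [mem_closedBall_zero_iff, norm_smul, Real.norm_of_nonneg (by positivity)]
  exact h

theorem tubeCutoff_eq_zero {V : Submodule ℝ (E d)} {x₀ : E d} {k : ℕ} {x : E d}
    (h : 2 ≤ ((k : ℝ) + 1) * ‖perp V (x - x₀)‖) : tubeCutoff V x₀ k x = 0 := by
  refine ContDiffBump.zero_of_le_dist _ ?_
  rw [dist_zero_right, norm_smul, Real.norm_of_nonneg (by positivity)]
  exact h

theorem fderiv_tubeCutoff_apply (V : Submodule ℝ (E d)) (x₀ a : E d) (k : ℕ) (x : E d) :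
    fderiv ℝ (tubeCutoff V x₀ k) x a = ((k : ℝ) + 1) *
      fderiv ℝ (unitBump V) (((k : ℝ) + 1) • perp V (x - x₀)) (perp V a) := by
  have h1 : HasFDerivAt (fun x : E d => ((k : ℝ) + 1) • perp V (x - x₀))
      (((k : ℝ) + 1) • perp V) x := by
    have h : HasFDerivAt (fun x : E d => perp V (x - x₀)) (perp V) x := by
      simp only [map_sub]
      exact (perp V).hasFDerivAt.sub_const _
    exact h.const_smul ((k : ℝ) + 1)
  have hρ : ContDiff ℝ 1 (unitBump V) := (unitBump V).contDiff
  have h2 := ((hρ.differentiable (by simp) (((k : ℝ) + 1) • perp V (x - x₀))).hasFDerivAt).comp x h1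
  have h3 : fderiv ℝ (tubeCutoff V x₀ k) x = _ := h2.fderiv
  rw [h3]
  simp

theorem exists_abs_fderiv_apply_le {N : Type*} [NormedAddCommGroup N] [NormedSpace ℝ N]
    {ρ : N → ℝ} (hρ : ContDiff ℝ 1 ρ) (hc : HasCompactSupport ρ) :
    ∃ C : ℝ, 0 ≤ C ∧ ∀ y v, |fderiv ℝ ρ y v| ≤ C * ‖v‖ := by
  obtain ⟨C, hC⟩ := (hc.fderiv ℝ).exists_bound_of_continuous (hρ.continuous_fderiv (by simp))
  refine ⟨C, (norm_nonneg _).trans (hC 0), fun y v => ?_⟩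
  exact (ContinuousLinearMap.le_opNorm _ _).trans
    (mul_le_mul_of_nonneg_right (hC _) (norm_nonneg _))

theorem exists_fderiv_tubeCutoff_le (V : Submodule ℝ (E d)) (x₀ a : E d) :
    ∃ C : ℝ, 0 ≤ C ∧ ∀ k x, |fderiv ℝ (tubeCutoff V x₀ k) x a| ≤ C * ((k : ℝ) + 1) := by
  obtain ⟨C, hC0, hC⟩ := exists_abs_fderiv_apply_le (unitBump V).contDiff
    (unitBump V).hasCompactSupport
  refine ⟨C * ‖perp V a‖, by positivity, fun k x => ?_⟩
  rw [fderiv_tubeCutoff_apply, abs_mul, abs_of_nonneg (by positivity : (0 : ℝ) ≤ (k : ℝ) + 1),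
    mul_comm]
  exact mul_le_mul_of_nonneg_right (hC _ _) (by positivity)

theorem exists_bound_of_hasCompactSupport {ψ : E d → ℝ} (hψ : Continuous ψ)
    (hc : HasCompactSupport ψ) : ∃ C : ℝ, 0 ≤ C ∧ ∀ x, |ψ x| ≤ C := by
  obtain ⟨C, hC⟩ := hc.exists_bound_of_continuous hψ
  exact ⟨C, (norm_nonneg _).trans (hC 0), hC⟩

/-- The integrand is of order `k + 1` and lives on a tube of volume of order `(k + 1)⁻²`. This is
where codimension two is needed: in codimension one the two orders would balance. -/
theorem tendsto_integral_fderiv_mul_tubeCutoff {V : Submodule ℝ (E d)}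
    (hV : Module.finrank ℝ V + 2 ≤ d) (x₀ a : E d) {K : Set (E d)} (hK : MeasurableSet K)
    {ψ : E d → ℝ} (hψ : ContDiff ℝ ∞ ψ) (hc : HasCompactSupport ψ) :
    Tendsto (fun k => ∫ x in K, fderiv ℝ (ψ * tubeCutoff V x₀ k) x a) atTop (𝓝 0) := by
  obtain ⟨C₀, hC₀, h₀⟩ := exists_bound_of_hasCompactSupport hψ.continuous hc
  obtain ⟨C₁, hC₁, h₁⟩ := exists_bound_of_hasCompactSupport
    (continuous_fderiv_apply_const hψ a) (hasCompactSupport_fderiv_apply_const hc a)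
  obtain ⟨C₂, hC₂, h₂⟩ := exists_fderiv_tubeCutoff_le V x₀ a
  obtain ⟨R, hR⟩ := hc.isCompact.isBounded.subset_closedBall x₀
  obtain ⟨C, hC, hvol⟩ := volume_real_tube_le V hV x₀ R
  have hbound : ∀ k : ℕ, ‖∫ x in K, fderiv ℝ (ψ * tubeCutoff V x₀ k) x a‖ ≤
      (C₀ * C₂ + C₁) * C * 4 * (1 / ((k : ℝ) + 1)) := by
    intro k
    -- The bump has outer radius `2`, so after scaling by `k + 1` the cutoff vanishes beyond this
    -- distance. Its square produces the factor `4` in the bound.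
    set ε : ℝ := 2 / ((k : ℝ) + 1) with hε
    have hk : (0 : ℝ) < (k : ℝ) + 1 := by positivity
    set S := {x : E d | ‖perp V (x - x₀)‖ ≤ ε ∧ ‖x - x₀‖ ≤ R} with hS
    have hts : tsupport (ψ * tubeCutoff V x₀ k) ⊆ S := by
      have hcl : IsClosed S := by
        refine IsClosed.inter (X := E d) (s₁ := {x | ‖perp V (x - x₀)‖ ≤ ε})
          (s₂ := {x | ‖x - x₀‖ ≤ R}) ?_ ?_
        · exact isClosed_le (by fun_prop) continuous_const
        · exact isClosed_le (by fun_prop) continuous_const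
      refine closure_minimal (fun x hx => ?_) hcl
      have hx' : ψ x * tubeCutoff V x₀ k x ≠ 0 := hx
      constructor
      · by_contra hlt
        refine hx' ?_
        rw [tubeCutoff_eq_zero, mul_zero]
        rw [not_le, hε, div_lt_iff₀ hk] at hlt
        linarith
      · have := hR (subset_tsupport ψ (left_ne_zero_of_mul hx'))
        rwa [mem_closedBall_iff_norm] at this
    have hSfin : volume S < ⊤ := by
      refine (measure_mono (fun x hx => ?_)).trans_lt
        (measure_closedBall_lt_top (x := x₀) (r := R))
      rw [mem_closedBall_iff_norm]
      exact hx.2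
    have hle : ∀ x ∈ S, ‖K.indicator (fun x => fderiv ℝ (ψ * tubeCutoff V x₀ k) x a) x‖ ≤
        (C₀ * C₂ + C₁) * ((k : ℝ) + 1) := by
      intro x _
      refine (norm_indicator_le_norm_self _ _).trans ?_
      rw [fderiv_mul (hψ.differentiable (by simp) x)
        ((contDiff_tubeCutoff V x₀ k).differentiable (by simp) x)]
      simp only [add_apply, smul_apply, smul_eq_mul]
      have e1 : ‖ψ x * fderiv ℝ (tubeCutoff V x₀ k) x a‖ ≤ C₀ * (C₂ * ((k : ℝ) + 1)) := by
        rw [norm_mul]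
        exact mul_le_mul (h₀ x) (h₂ k x) (norm_nonneg _) hC₀
      have e2 : ‖tubeCutoff V x₀ k x * fderiv ℝ ψ x a‖ ≤ 1 * C₁ := by
        rw [norm_mul]
        refine mul_le_mul ?_ (h₁ x) (norm_nonneg _) zero_le_one
        rw [Real.norm_of_nonneg (tubeCutoff_nonneg V x₀ k x)]
        exact tubeCutoff_le_one V x₀ k x
      refine (norm_add_le _ _).trans ((add_le_add e1 e2).trans ?_)
      have : 0 ≤ C₁ * k := by positivity
      nlinarith
    have h3 := norm_setIntegral_le_of_norm_le_const hSfin hle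
    have h4 : ∫ x in S, K.indicator (fun x => fderiv ℝ (ψ * tubeCutoff V x₀ k) x a) x =
        ∫ x in K, fderiv ℝ (ψ * tubeCutoff V x₀ k) x a := by
      rw [setIntegral_eq_integral_of_forall_compl_eq_zero, integral_indicator hK]
      intro x hx
      have := fderiv_apply_eq_zero_of_notMem_tsupport (fun h => hx (hts h)) a
      simp [Set.indicator, this]
    rw [h4] at h3
    refine h3.trans ?_
    have hε2 : ε ≤ 2 := by
      rw [hε, div_le_iff₀ hk]
      have : (0 : ℝ) ≤ k := by positivity
      linarith
    refine (mul_le_mul_of_nonneg_left (hvol ε (by positivity) hε2) (by positivity)).trans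
      (le_of_eq ?_)
    rw [hε]
    field_simp
    ring
  refine squeeze_zero_norm hbound ?_
  simpa using (tendsto_one_div_add_atTop_nhds_zero_nat (𝕜 := ℝ)).const_mul
    ((C₀ * C₂ + C₁) * C * 4)

/-- At a point off `A` the cutoff is eventually zero, and `A` is a null set of the face, so
dominated convergence applies. -/
theorem tendsto_integral_surf_mul_tubeCutoff {A : AffineSubspace ℝ (E d)}
    (hA : Module.finrank ℝ A.direction + 2 ≤ d) {x₀ : E d} (hx₀ : x₀ ∈ A) {F : Set (E d)}
    [IsFiniteMeasure (surf F)] {ψ : E d → ℝ} (hψ : ContDiff ℝ ∞ ψ) (hc : HasCompactSupport ψ) :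
    Tendsto (fun k => ∫ x, (ψ * tubeCutoff A.direction x₀ k) x ∂(surf F)) atTop (𝓝 0) := by
  obtain ⟨C₀, hC₀, h₀⟩ := exists_bound_of_hasCompactSupport hψ.continuous hc
  rw [← integral_zero (E d) ℝ (μ := surf F)]
  refine tendsto_integral_of_dominated_convergence (fun _ => C₀) (fun k => ?_)
    (integrable_const _) (fun k => ae_of_all _ fun x => ?_) ?_
  · exact (hψ.continuous.mul (contDiff_tubeCutoff _ _ _).continuous).aestronglyMeasurable
  · rw [Pi.mul_apply, norm_mul, Real.norm_of_nonneg (tubeCutoff_nonneg _ x₀ k x)]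
    exact (mul_le_of_le_one_right (norm_nonneg _) (tubeCutoff_le_one _ _ _ _)).trans (h₀ x)
  · have : ∀ᵐ x ∂(surf F), x ∉ (A : Set (E d)) :=
      measure_eq_zero_iff_ae_notMem.1 (surf_affineSubspace_eq_zero A hA F)
    filter_upwards [this] with x hx
    have hpos : 0 < ‖perp A.direction (x - x₀)‖ := by
      rw [norm_pos_iff]
      intro h
      have hmem : x - x₀ ∈ A.direction := by
        have := (Submodule.orthogonalProjectionOnto_eq_zero_iff (K := A.directionᗮ)).1 h
        rwa [Submodule.orthogonal_orthogonal] at this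
      apply hx
      have := AffineSubspace.vadd_mem_of_mem_direction hmem hx₀
      simpa using this
    refine tendsto_const_nhds.congr' ?_
    obtain ⟨N, hN⟩ := exists_nat_gt (2 / ‖perp A.direction (x - x₀)‖)
    filter_upwards [eventually_ge_atTop N] with k hk
    rw [Pi.mul_apply, tubeCutoff_eq_zero, mul_zero]
    rw [div_lt_iff₀ hpos] at hN
    have : (N : ℝ) ≤ (k : ℝ) + 1 := by
      have : (N : ℝ) ≤ k := by exact_mod_cast hk
      linarith
    exact hN.le.trans (mul_le_mul_of_nonneg_right this hpos.le)

theorem IsPolytope.tendsto_greenDefect_mul_tubeCutoff {K : Set (E d)} {Fs : Finset (Set (E d))}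
    (hK : IsPolytope K Fs) (a : E d) {A : AffineSubspace ℝ (E d)}
    (hA : Module.finrank ℝ A.direction + 2 ≤ d) {x₀ : E d} (hx₀ : x₀ ∈ A)
    {ψ : E d → ℝ} (hψ : ContDiff ℝ ∞ ψ) (hc : HasCompactSupport ψ) :
    Tendsto (fun k => greenDefect K Fs a (ψ * tubeCutoff A.direction x₀ k)) atTop (𝓝 0) := by
  have h1 := tendsto_integral_fderiv_mul_tubeCutoff hA x₀ a hK.isOpen.measurableSet hψ hc
  have h2 : Tendsto (fun k => ∑ F ∈ Fs, ⟪faceNormal K F, a⟫ *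
      ∫ x, (ψ * tubeCutoff A.direction x₀ k) x ∂(surf F)) atTop
      (𝓝 (∑ F ∈ Fs, ⟪faceNormal K F, a⟫ * 0)) := by
    refine tendsto_finsetSum _ fun F hF => ?_
    have := hK.isFiniteMeasure_surf hF
    exact (tendsto_integral_surf_mul_tubeCutoff hA hx₀ hψ hc).const_mul _
  simpa [greenDefect] using h1.sub h2

/-- If Green's formula holds for all test functions supported away from finitely many affine
subspaces of codimension two, it holds for all test functions. -/
theorem IsPolytope.greenDefect_eq_zero_of_away {K : Set (E d)} {Fs : Finset (Set (E d))}
    (hK : IsPolytope K Fs) (a : E d) (L : Finset (AffineSubspace ℝ (E d)))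
    (hL : ∀ A ∈ L, Module.finrank ℝ A.direction + 2 ≤ d)
    (h : ∀ ψ : E d → ℝ, ContDiff ℝ ∞ ψ → HasCompactSupport ψ →
      (∀ A ∈ L, Disjoint (tsupport ψ) (A : Set (E d))) → greenDefect K Fs a ψ = 0)
    {ψ : E d → ℝ} (hψ : ContDiff ℝ ∞ ψ) (hc : HasCompactSupport ψ) :
    greenDefect K Fs a ψ = 0 := by
  induction L using Finset.induction_on generalizing ψ with
  | empty => exact h ψ hψ hc (by simp)
  | insert A L hAL ih =>
    refine ih (fun B hB => hL B (Finset.mem_insert_of_mem hB)) (fun η hη hηc hηL => ?_) hψ hc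
    have hA := hL A (Finset.mem_insert_self _ _)
    rcases (A : Set (E d)).eq_empty_or_nonempty with hemp | ⟨x₀, hx₀⟩
    · refine h η hη hηc fun B hB => ?_
      rcases Finset.mem_insert.1 hB with rfl | hB
      · rw [hemp]; exact Set.disjoint_empty _
      · exact hηL B hB
    -- The factor `1 - tubeCutoff` vanishes near `A`, so that part of `η` falls under the
    -- hypothesis. The defect of `η` therefore sits entirely in the tube, for every `k`, and a
    -- constant sequence tending to zero is zero.
    · have hsplit : ∀ k, greenDefect K Fs a (η * tubeCutoff A.direction x₀ k) =
          greenDefect K Fs a η := by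
        intro k
        have hcut := contDiff_tubeCutoff A.direction x₀ k
        have hone : ContDiff ℝ ∞ (1 - tubeCutoff A.direction x₀ k) := contDiff_const.sub hcut
        have e : η = η * (1 - tubeCutoff A.direction x₀ k) +
            η * tubeCutoff A.direction x₀ k := by ring
        have hz : greenDefect K Fs a (η * (1 - tubeCutoff A.direction x₀ k)) = 0 := by
          refine h _ (hη.mul hone) hηc.mul_right fun B hB => ?_
          rcases Finset.mem_insert.1 hB with rfl | hB
          · rw [Set.disjoint_left]
            intro x hx hxB
            have hsub : tsupport (η * (1 - tubeCutoff B.direction x₀ k)) ⊆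
                {x | 1 ≤ ((k : ℝ) + 1) * ‖perp B.direction (x - x₀)‖} := by
              refine closure_minimal (fun y hy => ?_)
                (isClosed_le continuous_const (by fun_prop))
              by_contra hlt
              have hlt' : ((k : ℝ) + 1) * ‖perp B.direction (y - x₀)‖ < 1 := not_le.1 hlt
              apply hy
              simp [tubeCutoff_eq_one hlt'.le]
            have h1 : (1 : ℝ) ≤ ((k : ℝ) + 1) * ‖perp B.direction (x - x₀)‖ := hsub hx
            have h2 : perp B.direction (x - x₀) = 0 := by
              refine Submodule.orthogonalProjectionOnto_eq_zero_iff.2 ?_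
              rw [Submodule.orthogonal_orthogonal]
              exact AffineSubspace.vsub_mem_direction hxB hx₀
            rw [h2, norm_zero, mul_zero] at h1
            linarith
          · exact (hηL B hB).mono_left tsupport_mul_subset_left
        have hadd := hK.greenDefect_add a (hη.mul hone) (hη.mul hcut)
        calc greenDefect K Fs a (η * tubeCutoff A.direction x₀ k)
            = greenDefect K Fs a (η * (1 - tubeCutoff A.direction x₀ k)) +
              greenDefect K Fs a (η * tubeCutoff A.direction x₀ k) := by rw [hz, zero_add]
          _ = greenDefect K Fs a (η * (1 - tubeCutoff A.direction x₀ k) +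
              η * tubeCutoff A.direction x₀ k) := hadd.symm
          _ = greenDefect K Fs a η := by rw [← e]
      have ht := hK.tendsto_greenDefect_mul_tubeCutoff a hA hx₀ hη hηc
      simp only [hsplit] at ht
      exact tendsto_nhds_unique tendsto_const_nhds ht

/-- Once the relative boundaries of the faces are excluded, every point of the support lies in `K`,
in a relatively open face, or outside the closure of `K`, and the defect vanishes locally in each
case. -/
theorem IsPolytope.greenDefect_eq_zero {K : Set (E d)} {Fs : Finset (Set (E d))}
    (hK : IsPolytope K Fs) (hdis : (Fs : Set (Set (E d))).PairwiseDisjoint id) (a : E d)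
    {ψ : E d → ℝ} (hψ : ContDiff ℝ ∞ ψ) (hc : HasCompactSupport ψ) :
    greenDefect K Fs a ψ = 0 := by
  have hbd : ∀ F : Set (E d), ∃ L : Finset (AffineSubspace ℝ (E d)), F ∈ Fs →
      (∀ A ∈ L, Module.finrank ℝ A.direction + 2 ≤ d) ∧
        closure F \ F ⊆ ⋃ A ∈ L, (A : Set (E d)) := by
    intro F
    by_cases hF : F ∈ Fs
    · obtain ⟨L, hL⟩ := (hK.face F hF).boundary
      exact ⟨L, fun _ => hL⟩
    · exact ⟨∅, fun h => absurd h hF⟩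
  choose L hL using hbd
  refine hK.greenDefect_eq_zero_of_away a (Fs.biUnion L) (fun A hA => ?_)
    (fun η hη hηc hηL => ?_) hψ hc
  · obtain ⟨F, hF, hAF⟩ := Finset.mem_biUnion.1 hA
    exact (hL F hF).1 A hAF
  refine eq_zero_of_locally_eq_zero (greenDefect K Fs a)
    (fun _ _ h1 h2 => hK.greenDefect_add a h1 h2) hη hηc fun x hx => ?_
  by_cases hxK : x ∈ K
  · exact ⟨K, hK.isOpen, hxK, fun ζ hζ hζc _ h => hK.greenDefect_of_tsupport_subset a hζ hζc h⟩
  by_cases hxc : x ∈ closure K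
  · have hfr : x ∈ frontier K := by rw [hK.isOpen.frontier_eq]; exact ⟨hxc, hxK⟩
    rw [hK.frontier_eq] at hfr
    simp only [Set.mem_iUnion] at hfr
    obtain ⟨F, hF, hxF⟩ := hfr
    have hxF' : x ∈ F := by
      by_contra hn
      obtain ⟨A, hA, hxA⟩ := Set.mem_iUnion₂.1 ((hL F hF).2 ⟨hxF, hn⟩)
      exact Set.disjoint_left.1 (hηL A (Finset.mem_biUnion.2 ⟨F, hF, hA⟩)) hx hxA
    obtain ⟨r, hr, h⟩ := hK.exists_greenDefect_eq_zero_of_mem_face hdis a hF hxF'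
    exact ⟨Metric.ball x r, Metric.isOpen_ball, Metric.mem_ball_self hr,
      fun ζ hζ hζc _ hs => h ζ hζ hζc hs⟩
  · exact ⟨(closure K)ᶜ, isClosed_closure.isOpen_compl, hxc,
      fun ζ _ _ _ h => hK.greenDefect_of_disjoint a h⟩

/-- Green's formula on a polytope. -/
theorem IsPolytope.integral_fderiv {K : Set (E d)} {Fs : Finset (Set (E d))}
    (hK : IsPolytope K Fs) (hdis : (Fs : Set (Set (E d))).PairwiseDisjoint id) (a : E d)
    {φ : E d → ℝ} (hφ : ContDiff ℝ ∞ φ) :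
    ∫ x in K, fderiv ℝ φ x a = ∑ F ∈ Fs, ⟪faceNormal K F, a⟫ * ∫ x, φ x ∂(surf F) := by
  obtain ⟨R, hR0, hR⟩ := hK.bounded.closure.subset_ball_lt 0 (0 : E d)
  -- The function `φ` need not have compact support; multiplication by a bump equal to `1` near the
  -- closure of `K` alters neither side.
  set χ : ContDiffBump (0 : E d) := ⟨R, R + 1, hR0, by linarith⟩ with hχ
  have hχ1 : ∀ x ∈ closure K, χ =ᶠ[𝓝 x] 1 := fun x hx =>
    χ.eventuallyEq_one_of_mem_ball (hR hx)
  have h := hK.greenDefect_eq_zero hdis a (ψ := φ * χ) (hφ.mul χ.contDiff)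
    χ.hasCompactSupport.mul_left
  rw [greenDefect, sub_eq_zero] at h
  have e1 : ∫ x in K, fderiv ℝ (φ * ⇑χ) x a = ∫ x in K, fderiv ℝ φ x a := by
    refine setIntegral_congr_fun hK.isOpen.measurableSet fun x hx => ?_
    have : (φ * ⇑χ) =ᶠ[𝓝 x] φ := by
      filter_upwards [hχ1 x (subset_closure hx)] with y hy
      simp [hy]
    rw [this.fderiv_eq]
  rw [← e1, h]
  refine Finset.sum_congr rfl fun F hF => ?_
  congr 1
  refine integral_congr_ae ?_
  filter_upwards [hK.ae_surf_mem hF] with x hx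
  have := (hχ1 x (frontier_subset_closure (hK.face_subset hF hx))).eq_of_nhds
  simp [this]

/-! ### Gradients of smooth and of affine functions -/

theorem continuous_gradient {φ : E d → ℝ} (hφ : ContDiff ℝ ∞ φ) : Continuous (∇ φ) :=
  (InnerProductSpace.toDual ℝ (E d)).symm.continuous.comp (hφ.continuous_fderiv (by simp))

theorem gradient_eq_zero_of_notMem_tsupport {φ : E d → ℝ} {x : E d} (hx : x ∉ tsupport φ) :
    ∇ φ x = 0 := by
  have h : fderiv ℝ φ x = 0 := by
    by_contra h
    exact hx (support_fderiv_subset ℝ h)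
  simp [gradient, h]

theorem hasCompactSupport_gradient {φ : E d → ℝ} (hφ : HasCompactSupport φ) :
    HasCompactSupport (∇ φ) :=
  HasCompactSupport.of_support_subset_isCompact hφ fun x hx => by
    by_contra h
    exact hx (gradient_eq_zero_of_notMem_tsupport h)

theorem gradient_mul {φ η : E d → ℝ} (hφ : ContDiff ℝ ∞ φ) (hη : ContDiff ℝ ∞ η) (x : E d) :
    ∇ (φ * η) x = φ x • ∇ η x + η x • ∇ φ x := by
  rw [gradient, fderiv_mul (hφ.differentiable (by simp) x) (hη.differentiable (by simp) x)]
  simp [gradient]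

theorem gradient_sub {φ η : E d → ℝ} (hφ : ContDiff ℝ ∞ φ) (hη : ContDiff ℝ ∞ η) :
    ∇ (φ - η) = ∇ φ - ∇ η := by
  funext x
  rw [gradient, fderiv_sub (hφ.differentiable (by simp) x) (hη.differentiable (by simp) x)]
  simp [gradient]

/-- The gradient of an affine function. -/
noncomputable def slope (p : P1 d) : E d :=
  (InnerProductSpace.toDual ℝ (E d)).symm p.linear.toContinuousLinearMap

theorem inner_slope (p : P1 d) (v : E d) : ⟪slope p, v⟫ = p.linear v := by
  simp [slope, InnerProductSpace.toDual_symm_apply]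

theorem affine_apply (p : P1 d) (x : E d) : p x = ⟪slope p, x⟫ + p 0 := by
  rw [inner_slope]
  exact congrFun p.decomp x

theorem contDiff_affine (p : P1 d) : ContDiff ℝ ∞ (p : E d → ℝ) := by
  have : (p : E d → ℝ) = fun x => ⟪slope p, x⟫ + p 0 := funext (affine_apply p)
  rw [this]
  exact (contDiff_const.inner ℝ contDiff_id).add contDiff_const

theorem hasGradientAt_affine (p : P1 d) (x : E d) : HasGradientAt (p : E d → ℝ) (slope p) x := by
  have h : HasFDerivAt (fun x => ⟪slope p, x⟫ + p 0)
      (InnerProductSpace.toDual ℝ (E d) (slope p)) x :=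
    (InnerProductSpace.toDual ℝ (E d) (slope p)).hasFDerivAt.add_const _
  rw [hasGradientAt_iff_hasFDerivAt]
  exact h.congr_of_eventuallyEq (Eventually.of_forall (affine_apply p))

theorem gradient_affine (p : P1 d) (x : E d) : ∇ (p : E d → ℝ) x = slope p :=
  (hasGradientAt_affine p x).gradient

theorem slope_sub (p q : P1 d) : slope (p - q) = slope p - slope q := by
  refine ext_inner_right ℝ fun v => ?_
  rw [inner_sub_left, inner_slope, inner_slope, inner_slope]
  simp

/-- The affine function with gradient `g` and value `c` at the origin. -/
noncomputable def affineOf (g : E d) (c : ℝ) : P1 d :=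
  (InnerProductSpace.toDual ℝ (E d) g).toLinearMap.toAffineMap + AffineMap.const ℝ (E d) c

theorem affineOf_apply (g : E d) (c : ℝ) (x : E d) : affineOf g c x = ⟪g, x⟫ + c := by
  simp [affineOf]

theorem slope_affineOf (g : E d) (c : ℝ) : slope (affineOf g c) = g := by
  refine ext_inner_right ℝ fun v => ?_
  rw [inner_slope]
  simp [affineOf]

theorem affine_ext {p q : P1 d} (h : slope p = slope q) (h0 : p 0 = q 0) : p = q := by
  ext x
  rw [affine_apply p, affine_apply q, h, h0]

/-! ### Convergence in `L²` -/

section L2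

variable {V : Type*} [NormedAddCommGroup V] {μ : Measure (E d)}

theorem TendstoL2.congr {φ : ℕ → E d → V} {v w : E d → V} (h : TendstoL2 μ φ v) (hvw : v =ᵐ[μ] w) :
    TendstoL2 μ φ w := by
  refine Tendsto.congr (fun k => eLpNorm_congr_ae ?_) h
  filter_upwards [hvw] with x hx
  simp [hx]

theorem TendstoL2.mono_measure {ν : Measure (E d)} {φ : ℕ → E d → V} {v : E d → V}
    (h : TendstoL2 μ φ v) (hν : ν ≤ μ) : TendstoL2 ν φ v :=
  tendsto_of_tendsto_of_tendsto_of_le_of_le tendsto_const_nhds h (fun _ => bot_le)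
    fun _ => eLpNorm_mono_measure _ hν

theorem TendstoL2.sub {φ ψ : ℕ → E d → V} {v w : E d → V} (hv : TendstoL2 μ φ v)
    (hw : TendstoL2 μ ψ w) (hφ : ∀ k, AEStronglyMeasurable (φ k - v) μ)
    (hψ : ∀ k, AEStronglyMeasurable (ψ k - w) μ) :
    TendstoL2 μ (fun k => φ k - ψ k) (v - w) := by
  have h : Tendsto (fun k => eLpNorm (φ k - v) 2 μ + eLpNorm (ψ k - w) 2 μ) atTop (𝓝 0) := by
    simpa using hv.add hw
  refine tendsto_of_tendsto_of_tendsto_of_le_of_le tendsto_const_nhds h (fun _ => bot_le)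
    fun k => ?_
  have : φ k - ψ k - (v - w) = (φ k - v) - (ψ k - w) := by abel
  simp only [this]
  exact eLpNorm_sub_le (hφ k) (hψ k) (by norm_num)

theorem tendstoL2_const (v : E d → V) : TendstoL2 μ (fun _ => v) v := by
  simp [TendstoL2]

variable [InnerProductSpace ℝ V]

theorem integrable_inner_of_memLp {v w : E d → V} (hv : MemLp v 2 μ) (hw : MemLp w 2 μ) :
    Integrable (fun x => ⟪v x, w x⟫) μ := by
  refine (L2.integrable_inner (𝕜 := ℝ) (hv.toLp v) (hw.toLp w)).congr ?_
  filter_upwards [hv.coeFn_toLp, hw.coeFn_toLp] with x h1 h2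
  rw [h1, h2]

theorem inner_toLp {v w : E d → V} (hv : MemLp v 2 μ) (hw : MemLp w 2 μ) :
    ⟪hv.toLp v, hw.toLp w⟫ = ∫ x, ⟪v x, w x⟫ ∂μ := by
  rw [L2.inner_def]
  refine integral_congr_ae ?_
  filter_upwards [hv.coeFn_toLp, hw.coeFn_toLp] with x h1 h2
  rw [h1, h2]

theorem TendstoL2.tendsto_integral_inner {φ : ℕ → E d → V} {v w : E d → V}
    (h : TendstoL2 μ φ v) (hφ : ∀ k, MemLp (φ k) 2 μ) (hv : MemLp v 2 μ) (hw : MemLp w 2 μ) :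
    Tendsto (fun k => ∫ x, ⟪φ k x, w x⟫ ∂μ) atTop (𝓝 (∫ x, ⟪v x, w x⟫ ∂μ)) := by
  have h1 := (Lp.tendsto_Lp_iff_tendsto_eLpNorm'' φ hφ v hv).2 h
  have h2 := Filter.Tendsto.inner (𝕜 := ℝ) h1 (tendsto_const_nhds (x := hw.toLp w))
  simpa only [inner_toLp] using h2

theorem TendstoL2.tendsto_integral_mul {φ : ℕ → E d → ℝ} {v w : E d → ℝ}
    (h : TendstoL2 μ φ v) (hφ : ∀ k, MemLp (φ k) 2 μ) (hv : MemLp v 2 μ) (hw : MemLp w 2 μ) :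
    Tendsto (fun k => ∫ x, w x * φ k x ∂μ) atTop (𝓝 (∫ x, w x * v x ∂μ)) := by
  simpa using h.tendsto_integral_inner hφ hv hw

end L2

/-! ### Weak gradients -/

theorem IsTest.mono {D D' : Set (E d)} {φ : E d → ℝ} (h : IsTest D φ) (hD : D ⊆ D') :
    IsTest D' φ := ⟨h.1, h.2.1, h.2.2.trans hD⟩

/-- A locally square integrable function that is orthogonal to all test functions vanishes. -/
theorem ae_eq_of_forall_isTest {V : Type*} [NormedAddCommGroup V] [NormedSpace ℝ V]
    [CompleteSpace V] {μ : Measure (E d)} {D : Set (E d)} (hD : IsOpen D)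
    (hμ : ∀ᵐ x ∂μ, x ∈ D) {G H : E d → V} (hG : LocallyIntegrable G μ)
    (hH : LocallyIntegrable H μ)
    (h : ∀ φ, IsTest D φ → ∫ x, φ x • G x ∂μ = ∫ x, φ x • H x ∂μ) : G =ᵐ[μ] H := by
  have h1 := hD.ae_eq_zero_of_integral_contDiff_smul_eq_zero (μ := μ) (f := fun x => G x - H x)
    ((hG.sub hH).locallyIntegrableOn D) (fun φ h1 h2 h3 => by
      simp only [smul_sub]
      rw [integral_sub (hG.integrable_smul_left_of_hasCompactSupport h1.continuous h2)
        (hH.integrable_smul_left_of_hasCompactSupport h1.continuous h2), h φ ⟨h1, h2, h3⟩,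
        sub_self])
  filter_upwards [h1, hμ] with x h2 h3
  exact sub_eq_zero.1 (h2 h3)

theorem locallyIntegrable_of_memLp_two {V : Type*} [NormedAddCommGroup V] {D : Set (E d)}
    {G : E d → V} (hG : MemLp G 2 (volume.restrict D)) :
    LocallyIntegrable G (volume.restrict D) :=
  hG.locallyIntegrable (by norm_num)

theorem IsWeakGrad.ae_eq {D : Set (E d)} (hD : IsOpen D) {v : E d → ℝ} {G H : E d → E d}
    (hG : IsWeakGrad D v G) (hH : IsWeakGrad D v H) : G =ᵐ[volume.restrict D] H := by
  refine ae_eq_of_forall_isTest hD (ae_restrict_mem hD.measurableSet)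
    (locallyIntegrable_of_memLp_two hG.1) (locallyIntegrable_of_memLp_two hH.1) fun φ hφ => ?_
  have h1 := hG.2 φ hφ
  rw [hH.2 φ hφ] at h1
  exact (neg_injective h1).symm

theorem MemH1.isWeakGrad_grad {D : Set (E d)} {v : E d → ℝ} (h : MemH1 D v) :
    IsWeakGrad D v (grad D v) := Classical.epsilon_spec h.2

theorem IsWeakGrad.grad_ae_eq {D : Set (E d)} (hD : IsOpen D) {v : E d → ℝ} {G : E d → E d}
    (h : IsWeakGrad D v G) : grad D v =ᵐ[volume.restrict D] G :=
  IsWeakGrad.ae_eq hD (Classical.epsilon_spec ⟨G, h⟩) h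

theorem MemH1.memLp_grad {D : Set (E d)} {v : E d → ℝ} (h : MemH1 D v) :
    MemLp (grad D v) 2 (volume.restrict D) := h.isWeakGrad_grad.1

theorem IsWeakGrad.sub {D : Set (E d)} {v w : E d → ℝ} {G H : E d → E d}
    (hv : MemLp v 2 (volume.restrict D)) (hw : MemLp w 2 (volume.restrict D))
    (hG : IsWeakGrad D v G) (hH : IsWeakGrad D w H) : IsWeakGrad D (v - w) (G - H) := by
  refine ⟨hG.1.sub hH.1, fun φ hφ => ?_⟩
  have hc := hφ.1.continuous
  have hg := continuous_gradient hφ.1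
  have hgc := hasCompactSupport_gradient hφ.2.1
  simp only [Pi.sub_apply, sub_smul, smul_sub]
  rw [integral_sub
      ((locallyIntegrable_of_memLp_two hv).integrable_smul_right_of_hasCompactSupport hg hgc)
      ((locallyIntegrable_of_memLp_two hw).integrable_smul_right_of_hasCompactSupport hg hgc),
    integral_sub
      ((locallyIntegrable_of_memLp_two hG.1).integrable_smul_left_of_hasCompactSupport hc hφ.2.1)
      ((locallyIntegrable_of_memLp_two hH.1).integrable_smul_left_of_hasCompactSupport hc hφ.2.1),
    hG.2 φ hφ, hH.2 φ hφ]
  abel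

theorem MemH1.sub {D : Set (E d)} {v w : E d → ℝ} (hv : MemH1 D v) (hw : MemH1 D w) :
    MemH1 D (v - w) :=
  ⟨hv.1.sub hw.1, _, hv.isWeakGrad_grad.sub hv.1 hw.1 hw.isWeakGrad_grad⟩

theorem grad_sub_ae_eq {D : Set (E d)} (hD : IsOpen D) {v w : E d → ℝ} (hv : MemH1 D v)
    (hw : MemH1 D w) : grad D (v - w) =ᵐ[volume.restrict D] grad D v - grad D w :=
  (hv.isWeakGrad_grad.sub hv.1 hw.1 hw.isWeakGrad_grad).grad_ae_eq hD

/-- A test function of the smaller set is one of the larger set, and both integrands vanish on the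
difference. -/
theorem IsWeakGrad.mono {D D' : Set (E d)} (hD' : MeasurableSet D') (h : D ⊆ D')
    {v : E d → ℝ} {G : E d → E d}
    (hG : IsWeakGrad D' v G) : IsWeakGrad D v G := by
  refine ⟨hG.1.mono_measure (Measure.restrict_mono h le_rfl), fun φ hφ => ?_⟩
  have h1 := hG.2 φ (hφ.mono h)
  rwa [setIntegral_eq_of_subset_of_forall_sdiff_eq_zero hD' h,
    setIntegral_eq_of_subset_of_forall_sdiff_eq_zero hD' h] at h1
  · rintro x ⟨-, hx⟩
    rw [image_eq_zero_of_notMem_tsupport fun hx' => hx (hφ.2.2 hx'), zero_smul]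
  · rintro x ⟨-, hx⟩
    rw [gradient_eq_zero_of_notMem_tsupport fun hx' => hx (hφ.2.2 hx'), smul_zero]

/-- The gradient of a smooth function is its weak gradient. -/
theorem isWeakGrad_gradient {D : Set (E d)} {φ : E d → ℝ} (hφ : ContDiff ℝ ∞ φ)
    (hL : MemLp (∇ φ) 2 (volume.restrict D)) : IsWeakGrad D φ (∇ φ) := by
  refine ⟨hL, fun η hη => ?_⟩
  have i1 : Integrable (fun x => φ x • ∇ η x) (volume.restrict D) :=
    (hφ.continuous.smul (continuous_gradient hη.1)).integrable_of_hasCompactSupport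
      (hasCompactSupport_gradient hη.2.1).smul_left
  have i2 : Integrable (fun x => η x • ∇ φ x) (volume.restrict D) :=
    (hη.1.continuous.smul (continuous_gradient hφ)).integrable_of_hasCompactSupport
      hη.2.1.smul_right
  rw [eq_neg_iff_add_eq_zero, ← integral_add i1 i2]
  -- Paired with a constant vector, the integrand becomes a directional derivative of the compactly
  -- supported product `φ * η`, whose integral is zero.
  refine ext_inner_left ℝ fun a => ?_
  have i3 : Integrable (fun x => φ x • ∇ η x + η x • ∇ φ x) (volume.restrict D) := i1.add i2
  rw [← integral_inner i3, inner_zero_right]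
  have hc : HasCompactSupport (φ * η) := hη.2.1.mul_left
  have e : ∀ x, ⟪a, φ x • ∇ η x + η x • ∇ φ x⟫ = fderiv ℝ (φ * η) x a := fun x => by
    rw [← gradient_mul hφ hη.1, real_inner_comm, inner_gradient_left]
  simp only [e]
  rw [setIntegral_eq_integral_of_forall_compl_eq_zero]
  · exact integral_fderiv_apply_eq_zero (hφ.mul hη.1) hc a
  · intro x hx
    exact fderiv_apply_eq_zero_of_notMem_tsupport
      (fun h => hx (hη.2.2 (tsupport_mul_subset_right h))) a

section

variable {K : Set (E d)} {Fs : Finset (Set (E d))}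

/-! ### Smooth functions on a polytope -/

theorem IsPolytope.isWeakGrad_gradient (hK : IsPolytope K Fs) {φ : E d → ℝ}
    (hφ : ContDiff ℝ ∞ φ) : IsWeakGrad K φ (∇ φ) :=
  NCVEM.isWeakGrad_gradient hφ (hK.memLp_volume (continuous_gradient hφ) 2)

theorem IsPolytope.memH1 (hK : IsPolytope K Fs) {φ : E d → ℝ} (hφ : ContDiff ℝ ∞ φ) :
    MemH1 K φ :=
  ⟨hK.memLp_volume hφ.continuous 2, _, hK.isWeakGrad_gradient hφ⟩

theorem IsPolytope.grad_ae_eq (hK : IsPolytope K Fs) {φ : E d → ℝ} (hφ : ContDiff ℝ ∞ φ) :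
    grad K φ =ᵐ[volume.restrict K] ∇ φ :=
  (hK.isWeakGrad_gradient hφ).grad_ae_eq hK.isOpen

theorem IsPolytope.isTrace_self (hK : IsPolytope K Fs) {φ : E d → ℝ} (hφ : ContDiff ℝ ∞ φ) :
    IsTrace K Fs φ φ :=
  ⟨fun _ => φ, fun _ => hφ, tendstoL2_const _,
    (tendstoL2_const _).congr (hK.grad_ae_eq hφ).symm,
    fun _ hF => ⟨hK.memLp_surf hF hφ.continuous 2, tendstoL2_const _⟩⟩

/-! ### Traces -/

theorem isTrace_trace {v : E d → ℝ} (h : ∃ g, IsTrace K Fs v g) : IsTrace K Fs v (trace K Fs v) :=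
  Classical.epsilon_spec h

theorem IsTrace.memLp {v g : E d → ℝ} (h : IsTrace K Fs v g) {F : Set (E d)} (hF : F ∈ Fs) :
    MemLp g 2 (surf F) := by
  obtain ⟨_, -, -, -, h⟩ := h
  exact (h F hF).1

theorem IsPolytope.integrable_of_isTrace (hK : IsPolytope K Fs) {v g : E d → ℝ}
    (h : IsTrace K Fs v g) {F : Set (E d)} (hF : F ∈ Fs) : Integrable g (surf F) := by
  have := hK.isFiniteMeasure_surf hF
  exact (h.memLp hF).integrable (by norm_num)

/-- Green's formula for the trace of a Sobolev function. -/
theorem IsPolytope.green_trace (hK : IsPolytope K Fs)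
    (hdis : (Fs : Set (Set (E d))).PairwiseDisjoint id) {v g : E d → ℝ} (hv : MemH1 K v)
    (h : IsTrace K Fs v g) {η : E d → ℝ} (hη : ContDiff ℝ ∞ η) (a : E d) :
    ∑ F ∈ Fs, ⟪faceNormal K F, a⟫ * ∫ x, η x * g x ∂(surf F) =
      (∫ x in K, ⟪grad K v x, η x • a⟫) + ∫ x in K, ⟪∇ η x, a⟫ * v x := by
  obtain ⟨φ, hφ, h1, h2, h3⟩ := h
  have hηa : Continuous fun x => η x • a := hη.continuous.smul continuous_const
  have hga : Continuous fun x => ⟪∇ η x, a⟫ := (continuous_gradient hη).inner continuous_const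
  -- For the smooth approximants the identity is Green's formula for `η * φ k`; both sides pass to
  -- the limit by the `L²` convergences that define a trace.
  have t1 : Tendsto (fun k => ∑ F ∈ Fs, ⟪faceNormal K F, a⟫ * ∫ x, η x * φ k x ∂(surf F)) atTop
      (𝓝 (∑ F ∈ Fs, ⟪faceNormal K F, a⟫ * ∫ x, η x * g x ∂(surf F))) := by
    refine tendsto_finsetSum _ fun F hF => ?_
    exact ((h3 F hF).2.tendsto_integral_mul (fun k => hK.memLp_surf hF (hφ k).continuous 2)
      (h3 F hF).1 (hK.memLp_surf hF hη.continuous 2)).const_mul _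
  have t2 := (h2.tendsto_integral_inner
    (fun k => hK.memLp_volume (continuous_gradient (hφ k)) 2) hv.memLp_grad
    (hK.memLp_volume hηa 2)).add
    (h1.tendsto_integral_mul (fun k => hK.memLp_volume (hφ k).continuous 2) hv.1
      (hK.memLp_volume hga 2))
  refine tendsto_nhds_unique t1 (t2.congr fun k => ?_)
  have hgr := hK.integral_fderiv hdis a (hη.mul (hφ k))
  rw [← integral_add]
  · refine Eq.trans (integral_congr_ae (ae_of_all _ fun x => ?_)) hgr
    simp only
    rw [← inner_gradient_left (𝕜 := ℝ)]
    have : ∇ (fun x => η x * φ k x) x = η x • ∇ (φ k) x + φ k x • ∇ η x :=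
      gradient_mul hη (hφ k) x
    rw [this, inner_add_left, inner_smul_left, inner_smul_left, inner_smul_right]
    simp [mul_comm]
  · exact hK.integrable_volume ((continuous_gradient (hφ k)).inner hηa)
  · exact hK.integrable_volume (hga.mul (hφ k).continuous)

theorem IsPolytope.isTrace_sub (hK : IsPolytope K Fs) {v w g h : E d → ℝ} (hv : MemH1 K v)
    (hw : MemH1 K w) (hg : IsTrace K Fs v g) (hh : IsTrace K Fs w h) :
    IsTrace K Fs (v - w) (g - h) := by
  obtain ⟨φ, hφ, h1, h2, h3⟩ := hg
  obtain ⟨ψ, hψ, k1, k2, k3⟩ := hh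
  refine ⟨fun k => φ k - ψ k, fun k => (hφ k).sub (hψ k), ?_, ?_, fun F hF => ⟨?_, ?_⟩⟩
  · exact h1.sub k1
      (fun k => (hφ k).continuous.aestronglyMeasurable.sub hv.1.aestronglyMeasurable)
      (fun k => (hψ k).continuous.aestronglyMeasurable.sub hw.1.aestronglyMeasurable)
  · simp only [gradient_sub (hφ _) (hψ _)]
    refine TendstoL2.congr (h2.sub k2 (fun k => ?_) (fun k => ?_))
      (grad_sub_ae_eq hK.isOpen hv hw).symm
    · exact (continuous_gradient (hφ k)).aestronglyMeasurable.sub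
        hv.memLp_grad.aestronglyMeasurable
    · exact (continuous_gradient (hψ k)).aestronglyMeasurable.sub
        hw.memLp_grad.aestronglyMeasurable
  · exact (h3 F hF).1.sub (k3 F hF).1
  · exact (h3 F hF).2.sub (k3 F hF).2
      (fun k => (hφ k).continuous.aestronglyMeasurable.sub (h3 F hF).1.aestronglyMeasurable)
      (fun k => (hψ k).continuous.aestronglyMeasurable.sub (k3 F hF).1.aestronglyMeasurable)

/-- Functions on the faces that agree when tested against all smooth functions agree. -/
theorem IsPolytope.ae_eq_of_sum_eq (hK : IsPolytope K Fs)
    (hdis : (Fs : Set (Set (E d))).PairwiseDisjoint id) {g h : E d → ℝ} {F : Set (E d)}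
    (hF : F ∈ Fs) (hg : Integrable g (surf F)) (hh : Integrable h (surf F)) {c : Set (E d) → ℝ}
    (hc : c F ≠ 0)
    (hs : ∀ φ : E d → ℝ, ContDiff ℝ ∞ φ → ∑ F ∈ Fs, c F * ∫ x, φ x * g x ∂(surf F) =
      ∑ F ∈ Fs, c F * ∫ x, φ x * h x ∂(surf F)) : g =ᵐ[surf F] h := by
  -- Test functions supported away from the closures of the other faces isolate the term of `F` in
  -- the sum.
  refine ae_eq_of_forall_isTest (isOpen_awayFrom Fs F)
    ((hK.ae_surf_mem hF).mono fun x hx => hK.subset_awayFrom hdis hF hx)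
    hg.locallyIntegrable hh.locallyIntegrable fun φ hφ => ?_
  have h1 : ∀ k : E d → ℝ, ∑ F ∈ Fs, c F * ∫ x, φ x * k x ∂(surf F) =
      c F * ∫ x, φ x * k x ∂(surf F) := by
    intro k
    refine Finset.sum_eq_single F (fun F' hF' hne => ?_) (fun h => absurd hF h)
    rw [integral_eq_zero_of_ae, mul_zero]
    filter_upwards [hK.ae_surf_mem hF'] with x hx
    rw [image_eq_zero_of_notMem_tsupport fun hx' =>
      Set.disjoint_left.1 (disjoint_awayFrom hF' hne) hx (hφ.2.2 hx'), zero_mul]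
    rfl
  have h2 := hs φ hφ.1
  rw [h1, h1] at h2
  exact mul_left_cancel₀ hc h2

theorem IsPolytope.norm_faceNormal (hK : IsPolytope K Fs) {F : Set (E d)} (hF : F ∈ Fs) :
    ‖faceNormal K F‖ = 1 := (hK.faceNormal_spec hF).1

/-- The trace is unique. -/
theorem IsPolytope.isTrace_unique (hK : IsPolytope K Fs)
    (hdis : (Fs : Set (Set (E d))).PairwiseDisjoint id) {v g h : E d → ℝ} (hv : MemH1 K v)
    (hg : IsTrace K Fs v g) (hh : IsTrace K Fs v h) {F : Set (E d)} (hF : F ∈ Fs) :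
    g =ᵐ[surf F] h := by
  -- Green's formula in the direction of the normal of `F` itself gives the term of `F` the weight
  -- `1`; the weights of the other faces are irrelevant. Its volume side does not involve the trace.
  refine hK.ae_eq_of_sum_eq hdis hF (hK.integrable_of_isTrace hg hF)
    (hK.integrable_of_isTrace hh hF) (c := fun F' => ⟪faceNormal K F', faceNormal K F⟫) ?_
    fun φ hφ => ?_
  · rw [real_inner_self_eq_norm_sq, hK.norm_faceNormal hF]; simp
  · rw [hK.green_trace hdis hv hg hφ, hK.green_trace hdis hv hh hφ]

theorem IsPolytope.integral_trace_eq (hK : IsPolytope K Fs)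
    (hdis : (Fs : Set (Set (E d))).PairwiseDisjoint id) {v g : E d → ℝ} (hv : MemH1 K v)
    (hg : IsTrace K Fs v g) {F : Set (E d)} (hF : F ∈ Fs) :
    ∫ x, trace K Fs v x ∂(surf F) = ∫ x, g x ∂(surf F) :=
  integral_congr_ae (hK.isTrace_unique hdis hv (isTrace_trace ⟨g, hg⟩) hg hF)

theorem IsPolytope.integral_trace_sub (hK : IsPolytope K Fs)
    (hdis : (Fs : Set (Set (E d))).PairwiseDisjoint id) {v w : E d → ℝ} (hv : MemH1 K v)
    (hw : MemH1 K w) (hg : ∃ g, IsTrace K Fs v g) (hh : ∃ g, IsTrace K Fs w g) {F : Set (E d)}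
    (hF : F ∈ Fs) : ∫ x, trace K Fs (v - w) x ∂(surf F) =
      (∫ x, trace K Fs v x ∂(surf F)) - ∫ x, trace K Fs w x ∂(surf F) := by
  rw [hK.integral_trace_eq hdis (hv.sub hw)
    (hK.isTrace_sub hv hw (isTrace_trace hg) (isTrace_trace hh)) hF]
  exact integral_sub (hK.integrable_of_isTrace (isTrace_trace hg) hF)
    (hK.integrable_of_isTrace (isTrace_trace hh) hF)

/-- This is Green's formula with `η = 1`. It makes the mean gradient a function of the face
integrals alone, which is how the interpolation conditions enter. -/
theorem IsPolytope.integral_grad_inner (hK : IsPolytope K Fs)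
    (hdis : (Fs : Set (Set (E d))).PairwiseDisjoint id) {v : E d → ℝ} (hv : MemH1 K v)
    (h : ∃ g, IsTrace K Fs v g) (a : E d) :
    ∫ x in K, ⟪grad K v x, a⟫ =
      ∑ F ∈ Fs, ⟪faceNormal K F, a⟫ * ∫ x, trace K Fs v x ∂(surf F) := by
  have := hK.green_trace hdis hv (isTrace_trace h) (η := fun _ => 1) contDiff_const a
  simpa using this.symm

/-! ### Normal derivatives -/

/-- The outward normal as a function on the union of the faces. -/
noncomputable def normalField (K : Set (E d)) (Fs : Finset (Set (E d))) (x : E d) : E d :=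
  if h : ∃ F, F ∈ Fs ∧ x ∈ F then faceNormal K h.choose else 0

theorem normalField_eq (hdis : (Fs : Set (Set (E d))).PairwiseDisjoint id) {F : Set (E d)}
    (hF : F ∈ Fs) {x : E d} (hx : x ∈ F) : normalField K Fs x = faceNormal K F := by
  have h : ∃ F, F ∈ Fs ∧ x ∈ F := ⟨F, hF, hx⟩
  rw [normalField, dif_pos h]
  have : h.choose = F := by
    by_contra hne
    exact Set.disjoint_left.1 (hdis h.choose_spec.1 hF hne) h.choose_spec.2 hx
  rw [this]

theorem IsPolytope.integral_normalField_mul (hK : IsPolytope K Fs)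
    (hdis : (Fs : Set (Set (E d))).PairwiseDisjoint id) {F : Set (E d)}
    (hF : F ∈ Fs) (a : E d) (φ : E d → ℝ) :
    ∫ x, ⟪normalField K Fs x, a⟫ * φ x ∂(surf F) =
      ⟪faceNormal K F, a⟫ * ∫ x, φ x ∂(surf F) := by
  rw [← integral_const_mul]
  refine integral_congr_ae ?_
  filter_upwards [hK.ae_surf_mem hF] with x hx
  rw [normalField_eq hdis hF hx]

theorem IsPolytope.integrable_normalField (hK : IsPolytope K Fs)
    (hdis : (Fs : Set (Set (E d))).PairwiseDisjoint id) {F : Set (E d)}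
    (hF : F ∈ Fs) (a : E d) : Integrable (fun x => ⟪normalField K Fs x, a⟫) (surf F) := by
  have := hK.isFiniteMeasure_surf hF
  refine (integrable_const ⟪faceNormal K F, a⟫).congr ?_
  filter_upwards [hK.ae_surf_mem hF] with x hx
  rw [normalField_eq hdis hF hx]

theorem IsPolytope.isNormalDeriv_affine (hK : IsPolytope K Fs)
    (hdis : (Fs : Set (Set (E d))).PairwiseDisjoint id) (p : P1 d) :
    IsNormalDeriv K Fs p 0 (fun x => ⟪normalField K Fs x, slope p⟫) := by
  refine ⟨MemLp.zero, fun F hF => hK.integrable_normalField hdis hF _, fun φ hφ => ?_⟩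
  simp only [Pi.zero_apply, zero_mul, integral_zero, add_zero]
  rw [Finset.sum_congr rfl fun F hF => hK.integral_normalField_mul hdis hF (slope p) φ,
    ← hK.integral_fderiv hdis (slope p) hφ]
  refine integral_congr_ae ?_
  filter_upwards [hK.grad_ae_eq (contDiff_affine p)] with x hx
  rw [hx, gradient_affine, real_inner_comm, inner_gradient_left]

theorem IsPolytope.integrable_mul_of_continuous (hK : IsPolytope K Fs) {g φ : E d → ℝ}
    {F : Set (E d)} (hF : F ∈ Fs) (hg : Integrable g (surf F)) (hφ : Continuous φ) :
    Integrable (fun x => g x * φ x) (surf F) := by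
  obtain ⟨C, hC⟩ := ((hK.isBounded_face hF).isCompact_closure.image hφ).isBounded.exists_norm_le
  refine hg.mul_bdd (c := C) hφ.aestronglyMeasurable ?_
  filter_upwards [hK.ae_surf_mem hF] with x hx
  exact hC _ ⟨x, subset_closure hx, rfl⟩

theorem IsPolytope.integrable_mul_volume (hK : IsPolytope K Fs) {l φ : E d → ℝ}
    (hl : MemLp l 2 (volume.restrict K)) (hφ : Continuous φ) :
    Integrable (fun x => l x * φ x) (volume.restrict K) :=
  hl.integrable_mul (hK.memLp_volume hφ 2)

theorem IsPolytope.isNormalDeriv_sub (hK : IsPolytope K Fs) {v w l m g h : E d → ℝ}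
    (hv : MemH1 K v) (hw : MemH1 K w) (h1 : IsNormalDeriv K Fs v l g)
    (h2 : IsNormalDeriv K Fs w m h) : IsNormalDeriv K Fs (v - w) (l - m) (g - h) := by
  refine ⟨h1.1.sub h2.1, fun F hF => (h1.2.1 F hF).sub (h2.2.1 F hF), fun φ hφ => ?_⟩
  have hgφ := hK.memLp_volume (continuous_gradient hφ) 2
  have e1 : ∫ x in K, ⟪grad K (v - w) x, ∇ φ x⟫ =
      (∫ x in K, ⟪grad K v x, ∇ φ x⟫) - ∫ x in K, ⟪grad K w x, ∇ φ x⟫ := by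
    rw [← integral_sub (integrable_inner_of_memLp hv.memLp_grad hgφ)
      (integrable_inner_of_memLp hw.memLp_grad hgφ)]
    refine integral_congr_ae ?_
    filter_upwards [grad_sub_ae_eq hK.isOpen hv hw] with x hx
    rw [hx, Pi.sub_apply, inner_sub_left]
  have e2 : ∫ x in K, (l - m) x * φ x = (∫ x in K, l x * φ x) - ∫ x in K, m x * φ x := by
    rw [← integral_sub (hK.integrable_mul_volume h1.1 hφ.continuous)
      (hK.integrable_mul_volume h2.1 hφ.continuous)]
    simp only [Pi.sub_apply, sub_mul]
  have e3 : ∑ F ∈ Fs, ∫ x, (g - h) x * φ x ∂(surf F) =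
      ∑ F ∈ Fs, (∫ x, g x * φ x ∂(surf F)) - ∑ F ∈ Fs, ∫ x, h x * φ x ∂(surf F) := by
    rw [← Finset.sum_sub_distrib]
    refine Finset.sum_congr rfl fun F hF => ?_
    rw [← integral_sub (hK.integrable_mul_of_continuous hF (h1.2.1 F hF) hφ.continuous)
      (hK.integrable_mul_of_continuous hF (h2.2.1 F hF) hφ.continuous)]
    simp only [Pi.sub_apply, sub_mul]
  rw [e1, e2, e3, ← h1.2.2 φ hφ, ← h2.2.2 φ hφ]
  ring

theorem IsPolytope.sum_integral_isTest (hK : IsPolytope K Fs) {φ : E d → ℝ} (hφ : IsTest K φ)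
    (g : E d → ℝ) : ∑ F ∈ Fs, ∫ x, g x * φ x ∂(surf F) = 0 := by
  refine Finset.sum_eq_zero fun F hF => integral_eq_zero_of_ae ?_
  filter_upwards [hK.ae_surf_mem hF] with x hx
  have hxK : x ∉ K := by
    have := hK.face_subset hF hx
    rw [hK.isOpen.frontier_eq] at this
    exact this.2
  rw [image_eq_zero_of_notMem_tsupport fun h => hxK (hφ.2.2 h), mul_zero]
  rfl

/-- The weak Laplacian is unique. -/
theorem IsPolytope.laplacian_unique (hK : IsPolytope K Fs) {v l m g h : E d → ℝ}
    (h1 : IsNormalDeriv K Fs v l g) (h2 : IsNormalDeriv K Fs v m h) :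
    l =ᵐ[volume.restrict K] m := by
  refine ae_eq_of_forall_isTest hK.isOpen (ae_restrict_mem hK.isOpen.measurableSet)
    (locallyIntegrable_of_memLp_two h1.1) (locallyIntegrable_of_memLp_two h2.1) fun φ hφ => ?_
  have e1 := h1.2.2 φ hφ.1
  have e2 := h2.2.2 φ hφ.1
  rw [hK.sum_integral_isTest hφ] at e1 e2
  simp only [smul_eq_mul, mul_comm (φ _)]
  linarith

/-- The normal derivative is unique. -/
theorem IsPolytope.isNormalDeriv_unique (hK : IsPolytope K Fs)
    (hdis : (Fs : Set (Set (E d))).PairwiseDisjoint id) {v l m g h : E d → ℝ}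
    (h1 : IsNormalDeriv K Fs v l g) (h2 : IsNormalDeriv K Fs v m h) {F : Set (E d)}
    (hF : F ∈ Fs) : g =ᵐ[surf F] h := by
  refine hK.ae_eq_of_sum_eq hdis hF (h1.2.1 F hF) (h2.2.1 F hF) (c := fun _ => 1) one_ne_zero
    fun φ hφ => ?_
  have e : ∫ x in K, l x * φ x = ∫ x in K, m x * φ x := by
    refine integral_congr_ae ?_
    filter_upwards [hK.laplacian_unique h1 h2] with x hx
    rw [hx]
  have e1 := h1.2.2 φ hφ
  have e2 := h2.2.2 φ hφ
  rw [e] at e1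
  simp only [one_mul, mul_comm (φ _)]
  rw [← e1, ← e2]

theorem isNormalDeriv_normalDeriv {v : E d → ℝ} (h : HasNormalDeriv K Fs v) :
    ∃ l, IsNormalDeriv K Fs v l (normalDeriv K Fs v) :=
  Classical.epsilon_spec (p := fun g => ∃ l, IsNormalDeriv K Fs v l g) h

theorem IsPolytope.normalDeriv_sub_affine (hK : IsPolytope K Fs)
    (hdis : (Fs : Set (Set (E d))).PairwiseDisjoint id) {v : E d → ℝ} (hv : MemH1 K v)
    (h : HasNormalDeriv K Fs v) (p : P1 d) {F : Set (E d)} (hF : F ∈ Fs) :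
    normalDeriv K Fs (v - ⇑p) =ᵐ[surf F]
      fun x => normalDeriv K Fs v x - ⟪faceNormal K F, slope p⟫ := by
  obtain ⟨l, hl⟩ := isNormalDeriv_normalDeriv h
  have h1 := hK.isNormalDeriv_sub hv (hK.memH1 (contDiff_affine p)) hl
    (hK.isNormalDeriv_affine hdis p)
  obtain ⟨m, hm⟩ := isNormalDeriv_normalDeriv ⟨_, _, h1⟩
  filter_upwards [hK.isNormalDeriv_unique hdis hm h1 hF, hK.ae_surf_mem hF] with x hx hxF
  rw [hx, Pi.sub_apply, normalField_eq hdis hF hxF]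

/-- `V_h(K)` is invariant under the addition of affine functions. -/
theorem IsPolytope.sub_affine_mem_localSpace (hK : IsPolytope K Fs)
    (hdis : (Fs : Set (Set (E d))).PairwiseDisjoint id) {v : E d → ℝ}
    (hv : v ∈ localSpace K Fs) (p : P1 d) : v - ⇑p ∈ localSpace K Fs := by
  obtain ⟨h1, ⟨g, hg⟩, k, hk, hkc⟩ := hv
  have hp := hK.memH1 (contDiff_affine p)
  refine ⟨h1.sub hp, ⟨_, hK.isTrace_sub h1 hp hg (hK.isTrace_self (contDiff_affine p))⟩,
    k - fun x => ⟪normalField K Fs x, slope p⟫, ?_, fun F hF => ?_⟩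
  · simpa using hK.isNormalDeriv_sub h1 hp hk (hK.isNormalDeriv_affine hdis p)
  · obtain ⟨c, hc⟩ := hkc F hF
    refine ⟨c - ⟪faceNormal K F, slope p⟫, fun x hx => ?_⟩
    rw [Pi.sub_apply, hc x hx, normalField_eq hdis hF hx]

end

section

variable {K : Set (E d)} {Fs : Finset (Set (E d))} {Ω : Set (E d)}

/-! ### Traces of functions in `H¹₀` -/

theorem isFiniteMeasureOnCompacts_surf_hyperplane {n : E d} (hn : ‖n‖ = 1) (x₀ : E d) :
    IsFiniteMeasureOnCompacts (surf {x : E d | ⟪n, x - x₀⟫ = 0}) :=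
  ⟨fun _ h => surf_hyperplane_lt_top hn x₀ h.isBounded⟩

theorem memLp_of_hasCompactSupport {V : Type*} [NormedAddCommGroup V] {μ : Measure (E d)}
    [IsFiniteMeasureOnCompacts μ] {φ : E d → V} (hφ : Continuous φ) (hc : HasCompactSupport φ) :
    MemLp φ 2 μ :=
  hφ.memLp_of_hasCompactSupport hc

/-- By Green's formula on the half-space, the integral of `ψ²` over the hyperplane is that of
`2ψ∂ₙψ` over the half-space, and `2ψ∂ₙψ ≤ ψ² + |∇ψ|²`. -/
theorem integral_sq_surf_le {n : E d} (hn : ‖n‖ = 1) (x₀ : E d) {F : Set (E d)}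
    (hF : F ⊆ {x : E d | ⟪n, x - x₀⟫ = 0}) {ψ : E d → ℝ} (hψ : ContDiff ℝ ∞ ψ)
    (hc : HasCompactSupport ψ) :
    ∫ x, ψ x * ψ x ∂(surf F) ≤ (∫ x, ψ x * ψ x) + ∫ x, ⟪∇ ψ x, ∇ ψ x⟫ := by
  have := isFiniteMeasureOnCompacts_surf_hyperplane hn x₀
  have hsq : ContDiff ℝ ∞ (ψ * ψ) := hψ.mul hψ
  have hsqc : HasCompactSupport (ψ * ψ) := hc.mul_left
  have hgc := continuous_gradient hψ
  have i1 : Integrable (fun x => ψ x * ψ x) := hsq.continuous.integrable_of_hasCompactSupport hsqc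
  have i2 : Integrable (fun x => ⟪∇ ψ x, ∇ ψ x⟫) := integrable_inner_of_memLp
    (memLp_of_hasCompactSupport hgc (hasCompactSupport_gradient hc))
    (memLp_of_hasCompactSupport hgc (hasCompactSupport_gradient hc))
  have hnn : ∀ x, 0 ≤ ψ x * ψ x + ⟪∇ ψ x, ∇ ψ x⟫ := fun x =>
    add_nonneg (mul_self_nonneg _) real_inner_self_nonneg
  calc ∫ x, ψ x * ψ x ∂(surf F) ≤ ∫ x, ψ x * ψ x ∂(surf {x : E d | ⟪n, x - x₀⟫ = 0}) := by
        rw [surf_eq_restrict hF]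
        exact setIntegral_le_integral
          (hsq.continuous.integrable_of_hasCompactSupport hsqc)
          (ae_of_all _ fun x => mul_self_nonneg _)
    _ = ∫ x in {x | ⟪n, x - x₀⟫ < 0}, fderiv ℝ (ψ * ψ) x n := by
        rw [integral_halfspace_fderiv hn x₀ hsq hsqc, real_inner_self_eq_norm_sq, hn]
        simp
    _ ≤ ∫ x in {x | ⟪n, x - x₀⟫ < 0}, (ψ x * ψ x + ⟪∇ ψ x, ∇ ψ x⟫) := by
        refine integral_mono
          ((continuous_fderiv_apply_const hsq n).integrable_of_hasCompactSupport
            (hasCompactSupport_fderiv_apply_const hsqc n)).integrableOn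
          (i1.add i2).integrableOn fun x => ?_
        simp only
        rw [← inner_gradient_left (𝕜 := ℝ), gradient_mul hψ hψ, inner_add_left, inner_smul_left]
        have h1 : ⟪∇ ψ x, n⟫ ^ 2 ≤ ⟪∇ ψ x, ∇ ψ x⟫ := by
          rw [real_inner_self_eq_norm_sq, sq_le_sq, abs_norm]
          simpa [hn] using abs_real_inner_le_norm (∇ ψ x) n
        simp only [conj_trivial]
        nlinarith [sq_nonneg (ψ x - ⟪∇ ψ x, n⟫)]
    _ ≤ ∫ x, (ψ x * ψ x + ⟪∇ ψ x, ∇ ψ x⟫) :=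
        setIntegral_le_integral (i1.add i2) (ae_of_all _ hnn)
    _ = _ := integral_add i1 i2

/-- The trace inequality on a piece of a hyperplane. -/
theorem norm_toLp_surf_le {n : E d} (hn : ‖n‖ = 1) (x₀ : E d) {F : Set (E d)}
    (hF : F ⊆ {x : E d | ⟪n, x - x₀⟫ = 0}) {ψ : E d → ℝ} (hψ : IsTest Ω ψ)
    (h₀ : MemLp ψ 2 (surf F)) (h₁ : MemLp ψ 2 (volume.restrict Ω))
    (h₂ : MemLp (∇ ψ) 2 (volume.restrict Ω)) :
    ‖h₀.toLp ψ‖ ≤ ‖h₁.toLp ψ‖ + ‖h₂.toLp (∇ ψ)‖ := by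
  have key := integral_sq_surf_le hn x₀ hF hψ.1 hψ.2.1
  have e0 : ‖h₀.toLp ψ‖ ^ 2 = ∫ x, ψ x * ψ x ∂(surf F) := by
    rw [← real_inner_self_eq_norm_sq, inner_toLp]
    rfl
  have e1 : ‖h₁.toLp ψ‖ ^ 2 = ∫ x, ψ x * ψ x := by
    rw [← real_inner_self_eq_norm_sq, inner_toLp]
    refine setIntegral_eq_integral_of_forall_compl_eq_zero fun x hx => ?_
    rw [image_eq_zero_of_notMem_tsupport fun h => hx (hψ.2.2 h), inner_zero_left]
  have e2 : ‖h₂.toLp (∇ ψ)‖ ^ 2 = ∫ x, ⟪∇ ψ x, ∇ ψ x⟫ := by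
    rw [← real_inner_self_eq_norm_sq, inner_toLp]
    refine setIntegral_eq_integral_of_forall_compl_eq_zero fun x hx => ?_
    rw [gradient_eq_zero_of_notMem_tsupport fun h => hx (hψ.2.2 h), inner_zero_left]
  rw [← e0, ← e1, ← e2] at key
  refine le_of_sq_le_sq ?_ (by positivity)
  nlinarith [norm_nonneg (h₁.toLp ψ), norm_nonneg (h₂.toLp (∇ ψ))]

theorem IsTest.memLp {μ : Measure (E d)} [IsFiniteMeasureOnCompacts μ] {φ : E d → ℝ}
    (h : IsTest Ω φ) : MemLp φ 2 μ := memLp_of_hasCompactSupport h.1.continuous h.2.1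

theorem IsTest.memLp_gradient {μ : Measure (E d)} [IsFiniteMeasureOnCompacts μ] {φ : E d → ℝ}
    (h : IsTest Ω φ) : MemLp (∇ φ) 2 μ :=
  memLp_of_hasCompactSupport (continuous_gradient h.1) (hasCompactSupport_gradient h.2.1)

theorem IsTest.sub {φ η : E d → ℝ} (hφ : IsTest Ω φ) (hη : IsTest Ω η) : IsTest Ω (φ - η) :=
  ⟨hφ.1.sub hη.1, hφ.2.1.sub hη.2.1,
    (tsupport_sub φ η).trans (Set.union_subset hφ.2.2 hη.2.2)⟩

/-- The trace inequality applied to differences makes the restrictions to `F` a Cauchy sequence in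
`L²`, which is complete. -/
theorem exists_tendstoL2_surf {F : Set (E d)} (hF : IsFlatFace F) [IsFiniteMeasure (surf F)]
    {φ : ℕ → E d → ℝ} {v : E d → ℝ} {G : E d → E d} (hφ : ∀ k, IsTest Ω (φ k))
    (hv : MemLp v 2 (volume.restrict Ω)) (hG : MemLp G 2 (volume.restrict Ω))
    (h1 : TendstoL2 (volume.restrict Ω) φ v)
    (h2 : TendstoL2 (volume.restrict Ω) (fun k => ∇ (φ k)) G) :
    ∃ g, MemLp g 2 (surf F) ∧ TendstoL2 (surf F) φ g := by
  obtain ⟨n, x₀, hn, hFH⟩ := hF.exists_hyperplane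
  have m0 : ∀ k, MemLp (φ k) 2 (surf F) := fun k => (hφ k).memLp
  have m1 : ∀ k, MemLp (φ k) 2 (volume.restrict Ω) := fun k => (hφ k).memLp
  have m2 : ∀ k, MemLp (∇ (φ k)) 2 (volume.restrict Ω) := fun k => (hφ k).memLp_gradient
  have c1 := ((Lp.tendsto_Lp_iff_tendsto_eLpNorm'' φ m1 v hv).2 h1).cauchySeq
  have c2 := ((Lp.tendsto_Lp_iff_tendsto_eLpNorm'' _ m2 G hG).2 h2).cauchySeq
  have c0 : CauchySeq fun k => (m0 k).toLp (φ k) := by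
    rw [Metric.cauchySeq_iff] at c1 c2 ⊢
    intro ε hε
    obtain ⟨N₁, hN₁⟩ := c1 (ε / 2) (half_pos hε)
    obtain ⟨N₂, hN₂⟩ := c2 (ε / 2) (half_pos hε)
    refine ⟨max N₁ N₂, fun k hk l hl => ?_⟩
    have e1 := hN₁ k (le_of_max_le_left hk) l (le_of_max_le_left hl)
    have e2 := hN₂ k (le_of_max_le_right hk) l (le_of_max_le_right hl)
    rw [dist_eq_norm, ← MemLp.toLp_sub] at e1 e2 ⊢
    have ht := (hφ k).sub (hφ l)
    have h3 : MemLp (∇ (φ k - φ l)) 2 (volume.restrict Ω) := ht.memLp_gradient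
    have key := norm_toLp_surf_le hn x₀ hFH ht ((m0 k).sub (m0 l)) ((m1 k).sub (m1 l)) h3
    have e3 : h3.toLp _ = ((m2 k).sub (m2 l)).toLp _ := by
      congr 1
      exact gradient_sub (hφ k).1 (hφ l).1
    rw [e3] at key
    linarith
  obtain ⟨g, hg⟩ := cauchySeq_tendsto_of_complete c0
  refine ⟨g, Lp.memLp g, ?_⟩
  rw [TendstoL2, ← Lp.tendsto_Lp_iff_tendsto_eLpNorm'' φ m0 g (Lp.memLp g), Lp.toLp_coeFn]
  exact hg

theorem MemH1.mono {v : E d → ℝ} (h : MemH1 Ω v) (hΩ : MeasurableSet Ω) (hK : K ⊆ Ω) :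
    MemH1 K v :=
  ⟨h.1.mono_measure (Measure.restrict_mono hK le_rfl), _, h.isWeakGrad_grad.mono hΩ hK⟩

theorem MemH1.grad_ae_eq_of_subset {v : E d → ℝ} (h : MemH1 Ω v) (hΩ : MeasurableSet Ω)
    (hKo : IsOpen K) (hK : K ⊆ Ω) : grad K v =ᵐ[volume.restrict K] grad Ω v :=
  (h.isWeakGrad_grad.mono hΩ hK).grad_ae_eq hKo

/-- The approximants are compactly supported in `Ω`, so the inequality on whole hyperplanes suffices
and no trace theorem on `K` is required. The limits obtained on the individual faces are glued using
disjointness of the faces. -/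
theorem IsPolytope.exists_isTrace_of_memH10 (hK : IsPolytope K Fs)
    (hdis : (Fs : Set (Set (E d))).PairwiseDisjoint id) (hΩ : MeasurableSet Ω) (hKΩ : K ⊆ Ω)
    {u : E d → ℝ} (hu : MemH10 Ω u) : ∃ g, IsTrace K Fs u g := by
  obtain ⟨hu1, φ, hφ, h1, h2⟩ := hu
  have hex : ∀ F : Set (E d), ∃ g, F ∈ Fs → MemLp g 2 (surf F) ∧ TendstoL2 (surf F) φ g := by
    intro F
    by_cases hF : F ∈ Fs
    · have := hK.isFiniteMeasure_surf hF
      obtain ⟨g, hg⟩ := exists_tendstoL2_surf (hK.face F hF) hφ hu1.1 hu1.memLp_grad h1 h2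
      exact ⟨g, fun _ => hg⟩
    · exact ⟨0, fun h => absurd h hF⟩
  choose g hg using hex
  have hres : volume.restrict K ≤ volume.restrict Ω := Measure.restrict_mono hKΩ le_rfl
  let G : E d → ℝ := fun x => if h : ∃ F, F ∈ Fs ∧ x ∈ F then g h.choose x else 0
  have hG : ∀ F ∈ Fs, g F =ᵐ[surf F] G := by
    intro F hF
    filter_upwards [hK.ae_surf_mem hF] with x hx
    have h : ∃ F, F ∈ Fs ∧ x ∈ F := ⟨F, hF, hx⟩
    have hch : h.choose = F := by
      by_contra hne
      exact Set.disjoint_left.1 (hdis h.choose_spec.1 hF hne) h.choose_spec.2 hx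
    simp only [G, dif_pos h, hch]
  refine ⟨G, φ, fun k => (hφ k).1, h1.mono_measure hres, ?_, fun F hF => ⟨?_, ?_⟩⟩
  · exact (h2.mono_measure hres).congr (hu1.grad_ae_eq_of_subset hΩ hK.isOpen hKΩ).symm
  · exact (memLp_congr_ae (hG F hF)).1 (hg F hF).1
  · exact (hg F hF).2.congr (hG F hF)

theorem IsTest.memH10 (hΩ : IsOpen Ω) {φ : E d → ℝ} (h : IsTest Ω φ) : MemH10 Ω φ := by
  have hw := isWeakGrad_gradient (D := Ω) h.1 h.memLp_gradient
  exact ⟨⟨h.memLp, _, hw⟩, fun _ => φ, fun _ => h, tendstoL2_const _,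
    (tendstoL2_const _).congr (hw.grad_ae_eq hΩ).symm⟩

theorem IsWeakSolution.integral_test (hΩ : IsOpen Ω) {f u φ : E d → ℝ}
    (hu : IsWeakSolution Ω f u) (h : IsTest Ω φ) :
    ∫ x in Ω, ⟪grad Ω u x, ∇ φ x⟫ = ∫ x in Ω, f x * φ x := by
  rw [← hu.2 φ (h.memH10 hΩ)]
  refine integral_congr_ae ?_
  filter_upwards [(isWeakGrad_gradient (D := Ω) h.1 h.memLp_gradient).grad_ae_eq hΩ] with x hx
  rw [hx]

/-- On an element, the weak Laplacian of the weak solution is `-f`. -/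
theorem IsWeakSolution.laplacian_ae_eq (hΩ : IsOpen Ω) (hK : IsPolytope K Fs) (hKΩ : K ⊆ Ω)
    {f u l g : E d → ℝ} (hf : MemLp f 2 (volume.restrict Ω)) (hu : IsWeakSolution Ω f u)
    (h : IsNormalDeriv K Fs u l g) : l =ᵐ[volume.restrict K] -f := by
  have hfK : MemLp f 2 (volume.restrict K) := hf.mono_measure (Measure.restrict_mono hKΩ le_rfl)
  refine ae_eq_of_forall_isTest hK.isOpen (ae_restrict_mem hK.isOpen.measurableSet)
    (locallyIntegrable_of_memLp_two h.1) (locallyIntegrable_of_memLp_two hfK.neg) fun φ hφ => ?_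
  have e1 := h.2.2 φ hφ.1
  rw [hK.sum_integral_isTest hφ] at e1
  have e2 := hu.integral_test hΩ (hφ.mono hKΩ)
  rw [setIntegral_eq_of_subset_of_forall_sdiff_eq_zero hΩ.measurableSet hKΩ,
    setIntegral_eq_of_subset_of_forall_sdiff_eq_zero hΩ.measurableSet hKΩ] at e2
  · have e3 : ∫ x in K, ⟪grad K u x, ∇ φ x⟫ = ∫ x in K, ⟪grad Ω u x, ∇ φ x⟫ := by
      refine integral_congr_ae ?_
      filter_upwards [hu.1.1.grad_ae_eq_of_subset hΩ.measurableSet hK.isOpen hKΩ] with x hx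
      rw [hx]
    simp only [smul_eq_mul, mul_comm (φ _), Pi.neg_apply, neg_mul, integral_neg]
    linarith
  · rintro x ⟨-, hx⟩
    rw [image_eq_zero_of_notMem_tsupport fun hx' => hx (hφ.2.2 hx'), mul_zero]
  · rintro x ⟨-, hx⟩
    rw [gradient_eq_zero_of_notMem_tsupport fun hx' => hx (hφ.2.2 hx'), inner_zero_right]

/-! ### Geometry of a mesh -/

theorem IsOutwardNormal.eventually_mem {F : Set (E d)} {n x v : E d}
    (h : IsOutwardNormal K F n) (hx : x ∈ F) (hv : ⟪n, v⟫ < 0) :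
    ∀ᶠ t : ℝ in 𝓝[>] 0, x + t • v ∈ K := by
  obtain ⟨r, hr, he⟩ := h.2 x hx
  have hc : Tendsto (fun t : ℝ => x + t • v) (𝓝[>] 0) (𝓝 x) := by
    have : Continuous fun t : ℝ => x + t • v := by fun_prop
    simpa using (this.tendsto 0).mono_left nhdsWithin_le_nhds
  filter_upwards [hc (Metric.ball_mem_nhds x hr), self_mem_nhdsWithin] with t ht ht0
  have : x + t • v ∈ {y | ⟪n, y - x⟫ < 0} ∩ Metric.ball x r := by
    refine ⟨?_, ht⟩
    simp only [Set.mem_ofPred_eq, add_sub_cancel_left, inner_smul_right]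
    exact mul_neg_of_pos_of_neg ht0 hv
  rw [← he] at this
  exact this.1

theorem IsOutwardNormal.eventually_notMem {F : Set (E d)} {n x v : E d}
    (h : IsOutwardNormal K F n) (hx : x ∈ F) (hv : 0 < ⟪n, v⟫) :
    ∀ᶠ t : ℝ in 𝓝[>] 0, x + t • v ∉ closure K := by
  obtain ⟨r, hr, he⟩ := h.2 x hx
  have hc : Tendsto (fun t : ℝ => x + t • v) (𝓝[>] 0) (𝓝 x) := by
    have : Continuous fun t : ℝ => x + t • v := by fun_prop
    simpa using (this.tendsto 0).mono_left nhdsWithin_le_nhds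
  filter_upwards [hc (Metric.ball_mem_nhds x hr), self_mem_nhdsWithin] with t ht ht0 hmem
  have hpos : 0 < ⟪n, x + t • v - x⟫ := by
    rw [add_sub_cancel_left, inner_smul_right]
    exact mul_pos ht0 hv
  have hopen : IsOpen ({y | 0 < ⟪n, y - x⟫} ∩ Metric.ball x r) :=
    (isOpen_lt continuous_const (by fun_prop)).inter Metric.isOpen_ball
  obtain ⟨z, ⟨hz, hzr⟩, hzK⟩ := mem_closure_iff.1 hmem _ hopen ⟨hpos, ht⟩
  have : z ∈ {y | ⟪n, y - x⟫ < 0} ∩ Metric.ball x r := he ▸ ⟨hzK, hzr⟩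
  exact lt_asymm (a := ⟪n, z - x⟫) this.1 hz

theorem eq_of_inner_eq_one {n m : E d} (hn : ‖n‖ = 1) (hm : ‖m‖ = 1) (h : 1 ≤ ⟪n, m⟫) : n = m := by
  have h1 : ⟪n, m⟫ = 1 := le_antisymm (by simpa [hn, hm] using real_inner_le_norm n m) h
  exact (inner_eq_one_iff_of_norm_eq_one hn hm).1 h1

/-- Disjoint elements that share a face have opposite normals. -/
theorem IsOutwardNormal.eq_neg {K' F : Set (E d)} {n m : E d} (hn : IsOutwardNormal K F n)
    (hm : IsOutwardNormal K' F m) (hF : F.Nonempty) (hd : Disjoint K K') : m = -n := by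
  obtain ⟨x, hx⟩ := hF
  refine eq_of_inner_eq_one hm.1 (by rw [norm_neg, hn.1]) ?_
  -- If `⟪n, m⟫ > -1`, the direction `-(n + m)` points strictly into both elements, which would then
  -- intersect.
  by_contra hlt
  rw [inner_neg_right, not_le] at hlt
  have h1 : ⟪n, -(n + m)⟫ < 0 := by
    rw [inner_neg_right, inner_add_right, real_inner_self_eq_norm_sq, hn.1, real_inner_comm]
    linarith
  have h2 : ⟪m, -(n + m)⟫ < 0 := by
    rw [inner_neg_right, inner_add_right, real_inner_self_eq_norm_sq, hm.1]
    linarith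
  obtain ⟨t, ht⟩ := ((hn.eventually_mem hx h1).and (hm.eventually_mem hx h2)).exists
  exact Set.disjoint_left.1 hd ht.1 ht.2

/-- For distinct unit normals the direction `m - n` enters `K` but leaves the closure of `K'`,
against the inclusion. -/
theorem IsOutwardNormal.eq_of_subset {K' F : Set (E d)} {n m : E d} (hn : IsOutwardNormal K F n)
    (hm : IsOutwardNormal K' F m) (hF : F.Nonempty) (hd : K ⊆ K') : m = n := by
  obtain ⟨x, hx⟩ := hF
  refine eq_of_inner_eq_one hm.1 hn.1 ?_
  by_contra hlt
  rw [not_le] at hlt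
  have h1 : ⟪n, m - n⟫ < 0 := by
    rw [inner_sub_right, real_inner_self_eq_norm_sq, hn.1, real_inner_comm]
    linarith
  have h2 : 0 < ⟪m, m - n⟫ := by
    rw [inner_sub_right, real_inner_self_eq_norm_sq, hm.1]
    linarith
  obtain ⟨t, ht⟩ := ((hn.eventually_mem hx h1).and (hm.eventually_notMem hx h2)).exists
  exact ht.2 (subset_closure (hd ht.1))

namespace Mesh

variable (T : Mesh Ω)

theorem mem_facesOf {F : Set (E d)} : F ∈ T.facesOf K ↔ F ∈ T.faces ∧ F ⊆ frontier K := by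
  simp [facesOf, facesOn]

theorem facesOf_disjoint (K : Set (E d)) :
    (T.facesOf K : Set (Set (E d))).PairwiseDisjoint id :=
  T.faces_disjoint.subset fun _ hF => (T.mem_facesOf.1 hF).1

theorem disjoint_elems {K' : Set (E d)} (hK : K ∈ T.elems) (hK' : K' ∈ T.elems) (hne : K ≠ K') :
    Disjoint K K' := T.elems_disjoint hK hK' hne

/-- The elements that have `F` as a face. -/
noncomputable def adjacent (F : Set (E d)) : Finset (Set (E d)) :=
  T.elems.filter fun K => F ⊆ frontier K

theorem mem_adjacent {F : Set (E d)} : K ∈ T.adjacent F ↔ K ∈ T.elems ∧ F ⊆ frontier K := by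
  simp [adjacent]

theorem mem_facesOf_of_mem_adjacent {F : Set (E d)} (hF : F ∈ T.faces) (hK : K ∈ T.adjacent F) :
    F ∈ T.facesOf K :=
  T.mem_facesOf.2 ⟨hF, (T.mem_adjacent.1 hK).2⟩

theorem sum_elems_faces (c : Set (E d) → Set (E d) → ℝ) :
    ∑ K ∈ T.elems, ∑ F ∈ T.facesOf K, c K F = ∑ F ∈ T.faces, ∑ K ∈ T.adjacent F, c K F := by
  refine Finset.sum_comm' fun K F => ?_
  rw [mem_facesOf, mem_adjacent]
  tauto

theorem adjacent_nonempty {F : Set (E d)} (hF : F ∈ T.faces) : (T.adjacent F).Nonempty := by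
  rw [← Finset.card_pos, adjacent]
  rcases T.face_cases F hF with h | h
  · rw [T.interior_face F hF h]; norm_num
  · rw [T.boundary_face F hF h]; norm_num

theorem face_nonempty {F : Set (E d)} (hF : F ∈ T.faces) : F.Nonempty := by
  obtain ⟨K, hK⟩ := T.adjacent_nonempty hF
  exact ((T.element K (T.mem_adjacent.1 hK).1).face F
    (T.mem_facesOf_of_mem_adjacent hF hK)).connected.nonempty

theorem faceNormal_eq_neg {K' F : Set (E d)} (hF : F ∈ T.faces) (hK : K ∈ T.adjacent F)
    (hK' : K' ∈ T.adjacent F) (hne : K ≠ K') : faceNormal K' F = -faceNormal K F := by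
  have h1 := T.mem_adjacent.1 hK
  have h2 := T.mem_adjacent.1 hK'
  exact ((T.element K h1.1).faceNormal_spec (T.mem_facesOf_of_mem_adjacent hF hK)).eq_neg
    ((T.element K' h2.1).faceNormal_spec (T.mem_facesOf_of_mem_adjacent hF hK'))
    (T.face_nonempty hF) (T.disjoint_elems h1.1 h2.1 hne)

theorem exists_adjacent_eq_pair {F : Set (E d)} (hF : F ∈ T.faces) (hFΩ : F ⊆ Ω) :
    ∃ K K', K ≠ K' ∧ T.adjacent F = {K, K'} :=
  Finset.card_eq_two.1 (T.interior_face F hF hFΩ)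

/-- An interior face avoids the closures of all other faces. -/
theorem subset_awayFrom {F : Set (E d)} (hF : F ∈ T.faces) (hFΩ : F ⊆ Ω) :
    F ⊆ awayFrom T.faces F := by
  intro x hx hmem
  simp only [Set.mem_iUnion] at hmem
  obtain ⟨F', hF', hxF'⟩ := hmem
  obtain ⟨hne, hF'⟩ := Finset.mem_erase.1 hF'
  obtain ⟨K₃, hK₃⟩ := T.adjacent_nonempty hF'
  obtain ⟨K₁, K₂, h12, hadj⟩ := T.exists_adjacent_eq_pair hF hFΩ
  have hK₁ : K₁ ∈ T.adjacent F := by rw [hadj]; simp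
  have hK₂ : K₂ ∈ T.adjacent F := by rw [hadj]; simp
  have e₁ := (T.mem_adjacent.1 hK₁).1
  have e₂ := (T.mem_adjacent.1 hK₂).1
  have e₃ := (T.mem_adjacent.1 hK₃).1
  have hx₃ : x ∈ frontier K₃ :=
    closure_minimal (T.mem_adjacent.1 hK₃).2 isClosed_frontier hxF'
  -- Two faces of one element are already known to be separated, so it is enough that `K₃` also has
  -- `F` as a face. Otherwise `K₃` is a third element near `x`, where the two neighbours of `F` fill
  -- both open half-balls; `K₃` would be squeezed into a hyperplane, although it is open and
  -- accumulates at `x`.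
  suffices h : K₃ ∈ T.adjacent F from
    Set.disjoint_left.1 ((T.element K₃ e₃).disjoint_closure (T.facesOf_disjoint K₃)
      (T.mem_facesOf_of_mem_adjacent hF h) (T.mem_facesOf_of_mem_adjacent hF' hK₃) hne.symm) hx hxF'
  by_contra hK₃F
  have h31 : K₃ ≠ K₁ := fun h => hK₃F (h ▸ hK₁)
  have h32 : K₃ ≠ K₂ := fun h => hK₃F (h ▸ hK₂)
  have hn₁ := (T.element K₁ e₁).faceNormal_spec (T.mem_facesOf_of_mem_adjacent hF hK₁)
  have hn₂ := (T.element K₂ e₂).faceNormal_spec (T.mem_facesOf_of_mem_adjacent hF hK₂)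
  rw [T.faceNormal_eq_neg hF hK₁ hK₂ h12] at hn₂
  set n := faceNormal K₁ F
  obtain ⟨r₁, hr₁, b₁⟩ := hn₁.2 x hx
  obtain ⟨r₂, hr₂, b₂⟩ := hn₂.2 x hx
  have hflat : K₃ ∩ Metric.ball x (min r₁ r₂) ⊆ {y | ⟪n, y - x⟫ = 0} := by
    rintro y ⟨hy, hyr⟩
    have hy₁ := Metric.ball_subset_ball (min_le_left r₁ r₂) hyr
    have hy₂ := Metric.ball_subset_ball (min_le_right r₁ r₂) hyr
    by_contra hne0
    rcases lt_or_gt_of_ne (a := ⟪n, y - x⟫) hne0 with hlt | hgt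
    · have : y ∈ K₁ ∩ Metric.ball x r₁ := by rw [b₁]; exact ⟨hlt, hy₁⟩
      exact Set.disjoint_left.1 (T.disjoint_elems e₃ e₁ h31) hy this.1
    · have : y ∈ K₂ ∩ Metric.ball x r₂ := by
        rw [b₂]
        refine ⟨?_, hy₂⟩
        simp only [Set.mem_ofPred_eq, inner_neg_left]
        linarith
      exact Set.disjoint_left.1 (T.disjoint_elems e₃ e₂ h32) hy this.1
  have hopen : IsOpen (K₃ ∩ Metric.ball x (min r₁ r₂)) :=
    (T.element K₃ e₃).isOpen.inter Metric.isOpen_ball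
  obtain ⟨y, hyr, hy⟩ := mem_closure_iff.1 hx₃.1 _ Metric.isOpen_ball
    (Metric.mem_ball_self (lt_min hr₁ hr₂))
  have hvol := hopen.measure_pos volume ⟨y, hy, hyr⟩
  exact hvol.ne' (measure_mono_null hflat (volume_hyperplane hn₁.1 x))

/-- The integral over the domain is the sum of the integrals over the elements. -/
theorem integral_eq_sum {h : E d → ℝ} (hh : Integrable h (volume.restrict Ω)) :
    ∫ x in Ω, h x = ∑ K ∈ T.elems, ∫ x in K, h x := by
  rw [← integral_biUnion_finset T.elems (fun K hK => (T.element K hK).isOpen.measurableSet)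
    T.elems_disjoint (fun K hK => hh.mono_measure
      (Measure.restrict_mono (T.elems_subset K hK) le_rfl))]
  refine setIntegral_congr_set ?_
  have hsub : (⋃ K ∈ T.elems, K) ⊆ Ω := Set.iUnion₂_subset T.elems_subset
  refine (ae_eq_set (s := Ω) (t := ⋃ K ∈ T.elems, K)).2 ⟨?_, ?_⟩
  · have hnull : volume (⋃ K ∈ T.elems, frontier K) = 0 :=
      (measure_biUnion_null_iff T.elems.countable_toSet).2 fun K hK =>
        (T.element K hK).volume_frontier
    refine measure_mono_null ?_ hnull
    rintro x ⟨hx, hx'⟩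
    have hxc : x ∈ closure Ω := subset_closure hx
    rw [T.cover] at hxc
    obtain ⟨K, hK, hxK⟩ := Set.mem_iUnion₂.1 hxc
    refine Set.mem_iUnion₂.2 ⟨K, hK, ?_⟩
    rw [(T.element K hK).isOpen.frontier_eq]
    exact ⟨hxK, fun h => hx' (Set.mem_iUnion₂.2 ⟨K, hK, h⟩)⟩
  · rw [Set.sdiff_eq_empty.2 hsub, measure_empty]

end Mesh

end

section

variable {Ω : Set (E d)}

namespace Mesh

variable (T : Mesh Ω)

/-! ### Continuity of the flux -/

/-- On each element Green's formula with `Δu = -f` expresses the flux pairing through volume terms,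
and these add up to the weak equation tested with `φ`. -/
theorem sum_integral_normalDeriv_mul_test {f u : E d → ℝ} (hf : MemLp f 2 (volume.restrict Ω))
    (hu : IsWeakSolution Ω f u) (hun : ∀ K ∈ T.elems, HasNormalDeriv K (T.facesOf K) u)
    {φ : E d → ℝ} (hφ : IsTest Ω φ) :
    ∑ K ∈ T.elems, ∑ F ∈ T.facesOf K,
      ∫ x, normalDeriv K (T.facesOf K) u x * φ x ∂(surf F) = 0 := by
  have hΩ := T.domain.isOpen
  have h1 := hu.integral_test hΩ hφ
  rw [T.integral_eq_sum (integrable_inner_of_memLp hu.1.1.memLp_grad hφ.memLp_gradient),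
    T.integral_eq_sum (T.domain.integrable_mul_volume hf hφ.1.continuous), ← sub_eq_zero,
    ← Finset.sum_sub_distrib] at h1
  rw [← h1]
  refine Finset.sum_congr rfl fun K hK => ?_
  obtain ⟨l, hl⟩ := isNormalDeriv_normalDeriv (hun K hK)
  have hP := T.element K hK
  rw [← hl.2.2 φ hφ.1, sub_eq_add_neg, ← integral_neg]
  congr 1
  · refine integral_congr_ae ?_
    filter_upwards [hu.1.1.grad_ae_eq_of_subset hΩ.measurableSet hP.isOpen
      (T.elems_subset K hK)] with x hx
    rw [hx]
  · refine integral_congr_ae ?_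
    filter_upwards [hu.laplacian_ae_eq hΩ hP (T.elems_subset K hK) hf hl] with x hx
    rw [hx, Pi.neg_apply, neg_mul]

/-- The normal derivatives of the weak solution from both sides of an interior face cancel. -/
theorem sum_integral_normalDeriv {f u : E d → ℝ} (hf : MemLp f 2 (volume.restrict Ω))
    (hu : IsWeakSolution Ω f u) (hun : ∀ K ∈ T.elems, HasNormalDeriv K (T.facesOf K) u)
    {F : Set (E d)} (hF : F ∈ T.faces) (hFΩ : F ⊆ Ω) :
    ∑ K ∈ T.adjacent F, ∫ x, normalDeriv K (T.facesOf K) u x ∂(surf F) = 0 := by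
  have hint : ∀ K ∈ T.adjacent F, Integrable (normalDeriv K (T.facesOf K) u) (surf F) := by
    intro K hK
    obtain ⟨l, hl⟩ := isNormalDeriv_normalDeriv (hun K (T.mem_adjacent.1 hK).1)
    exact hl.2.1 F (T.mem_facesOf_of_mem_adjacent hF hK)
  have hmem : ∀ F' ∈ T.faces, ∀ᵐ x ∂(surf F'), x ∈ F' := by
    intro F' hF'
    obtain ⟨K, hK⟩ := T.adjacent_nonempty hF'
    exact (T.element K (T.mem_adjacent.1 hK).1).ae_surf_mem (T.mem_facesOf_of_mem_adjacent hF' hK)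
  have hsum : (fun x => ∑ K ∈ T.adjacent F, normalDeriv K (T.facesOf K) u x) =ᵐ[surf F] 0 := by
    -- Test functions supported in `Ω` and away from all other faces are admissible in the weak
    -- equation and see only `F`.
    refine ae_eq_of_forall_isTest ((isOpen_awayFrom T.faces F).inter T.domain.isOpen)
      ((hmem F hF).mono fun x hx => ⟨T.subset_awayFrom hF hFΩ hx, hFΩ hx⟩)
      (integrable_finsetSum _ hint).locallyIntegrable
      (integrable_zero (E d) ℝ (surf F)).locallyIntegrable fun φ hφ => ?_
    have h1 := T.sum_integral_normalDeriv_mul_test hf hu hun (hφ.mono Set.inter_subset_right)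
    rw [T.sum_elems_faces (fun K F => ∫ x, normalDeriv K (T.facesOf K) u x * φ x ∂(surf F)),
      Finset.sum_eq_single F (fun F' hF' hne => Finset.sum_eq_zero fun K hK => ?_)
        (fun h => absurd hF h)] at h1
    · simp only [Pi.zero_apply, smul_eq_mul, mul_zero, integral_zero, Finset.mul_sum]
      rw [integral_finsetSum]
      · simpa only [mul_comm (φ _)] using h1
      · intro K hK
        exact (hint K hK).locallyIntegrable.integrable_smul_left_of_hasCompactSupport
          hφ.1.continuous hφ.2.1
    · refine integral_eq_zero_of_ae ?_
      filter_upwards [hmem F' hF'] with x hx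
      rw [image_eq_zero_of_notMem_tsupport fun hx' =>
        Set.disjoint_left.1 (disjoint_awayFrom hF' hne) hx (hφ.2.2 hx').1, mul_zero]
      rfl
  rw [← integral_finsetSum _ hint, integral_congr_ae hsum]
  simp

theorem isFiniteMeasure_surf {F : Set (E d)} (hF : F ∈ T.faces) : IsFiniteMeasure (surf F) := by
  obtain ⟨K, hK⟩ := T.adjacent_nonempty hF
  exact (T.element K (T.mem_adjacent.1 hK).1).isFiniteMeasure_surf
    (T.mem_facesOf_of_mem_adjacent hF hK)

theorem integrable_surf {F : Set (E d)} (hF : F ∈ T.faces) {g : E d → ℝ} (hg : Continuous g) :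
    Integrable g (surf F) := by
  obtain ⟨K, hK⟩ := T.adjacent_nonempty hF
  exact (T.element K (T.mem_adjacent.1 hK).1).integrable_surf
    (T.mem_facesOf_of_mem_adjacent hF hK) hg

/-- The mean times the measure is the integral. -/
theorem chi_mul_measure {F : Set (E d)} (hF : F ∈ T.faces) (K : Set (E d)) (v : E d → ℝ) :
    T.chi K F v * (surf F).real Set.univ = ∫ x, trace K (T.facesOf K) v x ∂(surf F) := by
  have := T.isFiniteMeasure_surf hF
  -- For a face of measure zero the inverse in `chi` takes the value `0` and both sides vanish, so
  -- positivity of face measures need not be proved.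
  by_cases h : (surf F).real Set.univ = 0
  · have h0 : surf F = 0 := by
      rwa [measureReal_eq_zero_iff, Measure.measure_univ_eq_zero] at h
    simp [h0]
  · rw [chi, mul_comm, ← mul_assoc, mul_inv_cancel₀ h, one_mul]

theorem memH1_of_mem_space {v : E d → ℝ} (hv : v ∈ T.space) {K : Set (E d)} (hK : K ∈ T.elems) :
    MemH1 K v := (hv.2.1 K hK).1

theorem exists_isTrace_of_mem_space {v : E d → ℝ} (hv : v ∈ T.space) {K : Set (E d)}
    (hK : K ∈ T.elems) : ∃ g, IsTrace K (T.facesOf K) v g := (hv.2.1 K hK).2.1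

/-- The fluxes of the weak solution do not see functions in `V_h` through their means. -/
theorem sum_chi_mul_integral_normalDeriv {f u v : E d → ℝ}
    (hf : MemLp f 2 (volume.restrict Ω)) (hu : IsWeakSolution Ω f u)
    (hun : ∀ K ∈ T.elems, HasNormalDeriv K (T.facesOf K) u) (hv : v ∈ T.space) :
    ∑ K ∈ T.elems, ∑ F ∈ T.facesOf K,
      T.chi K F v * ∫ x, normalDeriv K (T.facesOf K) u x ∂(surf F) = 0 := by
  rw [T.sum_elems_faces
    fun K F => T.chi K F v * ∫ x, normalDeriv K (T.facesOf K) u x ∂(surf F)]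
  refine Finset.sum_eq_zero fun F hF => ?_
  -- On an interior face the mean of `v` is common to both neighbours and factors out of the
  -- cancelling fluxes; on a boundary face the mean is zero.
  rcases T.face_cases F hF with h | h
  · obtain ⟨K₀, hK₀⟩ := T.adjacent_nonempty hF
    have e₀ := T.mem_adjacent.1 hK₀
    rw [Finset.sum_congr rfl fun K hK => ?_, ← Finset.mul_sum,
      T.sum_integral_normalDeriv hf hu hun hF h, mul_zero]
    · exact T.chi K₀ F v
    · have e := T.mem_adjacent.1 hK
      simp only [chi]
      rw [hv.2.2.1 K e.1 K₀ e₀.1 F hF h e.2 e₀.2]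
  · refine Finset.sum_eq_zero fun K hK => ?_
    have e := T.mem_adjacent.1 hK
    rw [chi, hv.2.2.2 K e.1 F hF h e.2, mul_zero, zero_mul]

end Mesh

namespace Patches

variable {T : Mesh Ω} (W : Patches T) {K : Set (E d)}

/-! ### The boundary of a patch -/

/-- Crossing `F` along the outward normal of `K'` leads either into the other neighbour, which is
not in the patch, or out of `Ω`, whose outward normal along a boundary face is that of `K'`. In both
cases the patch is left immediately. -/
theorem mem_bdryFaces (hK : K ∈ T.elems) {F K' : Set (E d)} (hF : F ∈ T.faces)
    (hK' : K' ∈ W.elems K) (hFK' : F ⊆ frontier K')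
    (huniq : ∀ K'' ∈ T.adjacent F, K'' ∈ W.elems K → K'' = K') : F ∈ W.bdryFaces K := by
  have hK'T := W.subset K hK hK'
  have hadj : K' ∈ T.adjacent F := T.mem_adjacent.2 ⟨hK'T, hFK'⟩
  have hn := (T.element K' hK'T).faceNormal_spec (T.mem_facesOf_of_mem_adjacent hF hadj)
  set n := faceNormal K' F with hn_def
  have hnn : (0 : ℝ) < ⟪n, n⟫ := by rw [real_inner_self_eq_norm_sq, hn.1]; norm_num
  rw [bdryFaces, facesOn, Finset.mem_filter]
  refine ⟨hF, fun x hx => ?_⟩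
  rw [frontier_eq_closure_inter_closure]
  refine ⟨subset_closure (Set.mem_iUnion₂.2 ⟨K', hK', frontier_subset_closure (hFK' hx)⟩), ?_⟩
  have hc : Tendsto (fun t : ℝ => x + t • n) (𝓝[>] 0) (𝓝 x) := by
    have : Continuous fun t : ℝ => x + t • n := by fun_prop
    simpa using (this.tendsto 0).mono_left nhdsWithin_le_nhds
  refine mem_closure_of_tendsto hc ?_
  rcases T.face_cases F hF with h | h
  · obtain ⟨K'', hK'', hne⟩ : ∃ K'' ∈ T.adjacent F, K'' ≠ K' := by
      refine Finset.exists_mem_ne ?_ K'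
      have := T.interior_face F hF h
      rw [Mesh.adjacent, this]; norm_num
    have e := T.mem_adjacent.1 hK''
    have hm := (T.element K'' e.1).faceNormal_spec (T.mem_facesOf_of_mem_adjacent hF hK'')
    rw [T.faceNormal_eq_neg hF hadj hK'' hne.symm, ← hn_def] at hm
    filter_upwards [hm.eventually_mem hx (v := n) (by rw [inner_neg_left]; linarith)] with t ht hmem
    obtain ⟨K₃, hK₃, hcl⟩ := Set.mem_iUnion₂.1 hmem
    have h3 : K'' ≠ K₃ := by
      rintro rfl
      exact hne (huniq _ hK'' hK₃)
    exact Set.disjoint_left.1 ((T.disjoint_elems e.1 (W.subset K hK hK₃) h3).closure_right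
      (T.element K'' e.1).isOpen) ht hcl
  · have hFΩ : F ∈ facesOn T.faces Ω := by simp [facesOn, hF, h]
    obtain ⟨m, hm⟩ := T.domain.normal F hFΩ
    rw [hn.eq_of_subset hm (T.face_nonempty hF) (T.elems_subset K' hK'T)] at hm
    filter_upwards [hm.eventually_notMem hx hnn] with t ht hmem
    obtain ⟨K₃, hK₃, hcl⟩ := Set.mem_iUnion₂.1 hmem
    exact ht (closure_mono (T.elems_subset K₃ (W.subset K hK hK₃)) hcl)

/-- The measure of the boundary of the patch. -/
noncomputable def bdryMeasure (K : Set (E d)) : ℝ := ∑ F ∈ W.bdryFaces K, (surf F).real Set.univ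

/-- Green's formula for an affine function with unit gradient `a`, in the direction `a`, gives the
volume of each element. Summed over the patch, faces shared by two patch elements cancel. If the
boundary of the patch were null, the volume of the patch would be zero. -/
theorem bdryMeasure_pos (hd : 0 < d) (hK : K ∈ T.elems) : 0 < W.bdryMeasure K := by
  by_contra hneg
  have h0 : W.bdryMeasure K = 0 :=
    le_antisymm (not_lt.1 hneg) (Finset.sum_nonneg fun F _ => measureReal_nonneg)
  have hzero : ∀ F ∈ W.bdryFaces K, surf F = 0 := by
    intro F hF
    have h1 := (Finset.sum_eq_zero_iff_of_nonneg fun F _ => measureReal_nonneg).1 h0 F hF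
    have := T.isFiniteMeasure_surf (Finset.mem_filter.1 hF).1
    rwa [measureReal_eq_zero_iff, Measure.measure_univ_eq_zero] at h1
  set a : E d := EuclideanSpace.single ⟨0, hd⟩ 1 with ha
  have haa : ⟪a, a⟫ = 1 := by rw [real_inner_self_eq_norm_sq, ha]; simp
  set p : P1 d := affineOf a 0 with hp
  have hgreen : ∀ K' ∈ W.elems K, volume.real K' =
      ∑ F ∈ T.facesOf K', ⟪faceNormal K' F, a⟫ * ∫ x, p x ∂(surf F) := by
    intro K' hK'
    rw [← (T.element K' (W.subset K hK hK')).integral_fderiv (T.facesOf_disjoint K') a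
      (contDiff_affine p)]
    simp only [← inner_gradient_left (𝕜 := ℝ), gradient_affine, hp, slope_affineOf, haa]
    simp
  have hsum : ∑ K' ∈ W.elems K, volume.real K' = 0 := by
    rw [Finset.sum_congr rfl hgreen]
    have hcomm : ∑ K' ∈ W.elems K, ∑ F ∈ T.facesOf K', ⟪faceNormal K' F, a⟫ * ∫ x, p x ∂(surf F) =
        ∑ F ∈ T.faces, ∑ K' ∈ (W.elems K).filter (fun K' => F ⊆ frontier K'),
          ⟪faceNormal K' F, a⟫ * ∫ x, p x ∂(surf F) := by
      refine Finset.sum_comm' fun K' F => ?_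
      rw [Mesh.mem_facesOf, Finset.mem_filter]
      tauto
    rw [hcomm]
    refine Finset.sum_eq_zero fun F hF => ?_
    by_cases hb : F ∈ W.bdryFaces K
    · simp [hzero F hb]
    · rcases Finset.eq_empty_or_nonempty ((W.elems K).filter fun K' => F ⊆ frontier K') with
        he | ⟨K', hK'⟩
      · rw [he, Finset.sum_empty]
      obtain ⟨hK', hFK'⟩ := Finset.mem_filter.1 hK'
      have hadj' : K' ∈ T.adjacent F := T.mem_adjacent.2 ⟨W.subset K hK hK', hFK'⟩
      obtain ⟨K'', hK'', hW, hne⟩ : ∃ K'' ∈ T.adjacent F, K'' ∈ W.elems K ∧ K'' ≠ K' := by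
        by_contra hcon
        push Not at hcon
        exact hb (W.mem_bdryFaces hK hF hK' hFK' hcon)
      -- No face has more than two neighbours, so `K'` and `K''` are all of them and their opposite
      -- normals cancel.
      have hcard : (T.adjacent F).card ≤ 2 := by
        rcases T.face_cases F hF with h | h
        · exact (T.interior_face F hF h).le
        · exact (T.boundary_face F hF h).le.trans (by norm_num)
      have hpair : ({K', K''} : Finset (Set (E d))) ⊆ T.adjacent F := by
        intro L hL
        rcases Finset.mem_insert.1 hL with rfl | hL
        · exact hadj'
        · rw [Finset.mem_singleton.1 hL]; exact hK''
      have heq : (W.elems K).filter (fun K' => F ⊆ frontier K') = {K', K''} := by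
        refine Finset.Subset.antisymm ?_ ?_
        · have : ({K', K''} : Finset (Set (E d))) = T.adjacent F :=
            Finset.eq_of_subset_of_card_le hpair (by rw [Finset.card_pair hne.symm]; exact hcard)
          rw [this]
          intro L hL
          obtain ⟨h1, h2⟩ := Finset.mem_filter.1 hL
          exact T.mem_adjacent.2 ⟨W.subset K hK h1, h2⟩
        · intro L hL
          rcases Finset.mem_insert.1 hL with rfl | hL
          · exact Finset.mem_filter.2 ⟨hK', hFK'⟩
          · rw [Finset.mem_singleton.1 hL]
            exact Finset.mem_filter.2 ⟨hW, (T.mem_adjacent.1 hK'').2⟩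
      rw [heq, Finset.sum_pair hne.symm, T.faceNormal_eq_neg hF hadj' hK'' hne.symm,
        inner_neg_left]
      ring
  have hpos : 0 < ∑ K' ∈ W.elems K, volume.real K' := by
    refine Finset.sum_pos (fun K' hK' => ?_) ⟨K, W.self_mem K hK⟩
    have hP := T.element K' (W.subset K hK hK')
    exact ENNReal.toReal_pos (hP.isOpen.measure_pos volume hP.connected.nonempty).ne'
      hP.bounded.measure_lt_top.ne
  exact hpos.ne' hsum

/-! ### The projections -/

theorem mem_faces_of_mem_bdryFaces {F : Set (E d)} (hF : F ∈ W.bdryFaces K) : F ∈ T.faces :=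
  (Finset.mem_filter.1 hF).1

theorem bdryIntegralP1_eq (K : Set (E d)) (p : P1 d) : W.bdryIntegralP1 K p =
    ∑ F ∈ W.bdryFaces K, (∫ x, ⟪slope p, x⟫ ∂(surf F)) + p 0 * W.bdryMeasure K := by
  rw [bdryIntegralP1, bdryMeasure, Finset.mul_sum, ← Finset.sum_add_distrib]
  refine Finset.sum_congr rfl fun F hF => ?_
  have := T.isFiniteMeasure_surf (W.mem_faces_of_mem_bdryFaces hF)
  rw [integral_congr_ae (ae_of_all _ (affine_apply p)),
    integral_add (T.integrable_surf (W.mem_faces_of_mem_bdryFaces hF) (by fun_prop))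
    (integrable_const _), integral_const]
  simp [mul_comm]

/-- Because the boundary of the patch has positive measure, the additive constant can be tuned to
any prescribed boundary integral. -/
theorem exists_slope_eq (hpos : 0 < W.bdryMeasure K) (g : E d) (b : ℝ) :
    ∃ p : P1 d, slope p = g ∧ W.bdryIntegralP1 K p = b := by
  refine ⟨affineOf g ((b - ∑ F ∈ W.bdryFaces K, ∫ x, ⟪g, x⟫ ∂(surf F)) / W.bdryMeasure K),
    slope_affineOf _ _, ?_⟩
  rw [bdryIntegralP1_eq, slope_affineOf, affineOf_apply, inner_zero_right, zero_add,
    div_mul_cancel₀ _ hpos.ne']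
  ring

theorem eq_of_slope_eq (hpos : 0 < W.bdryMeasure K) {p q : P1 d} (h : slope p = slope q)
    (hb : W.bdryIntegralP1 K p = W.bdryIntegralP1 K q) : p = q := by
  refine affine_ext h ?_
  rw [bdryIntegralP1_eq, bdryIntegralP1_eq, h] at hb
  exact mul_right_cancel₀ hpos.ne' (add_left_cancel hb)

theorem bdryIntegralP1_sub (p q : P1 d) :
    W.bdryIntegralP1 K (p - q) = W.bdryIntegralP1 K p - W.bdryIntegralP1 K q := by
  rw [bdryIntegralP1, bdryIntegralP1, bdryIntegralP1, ← Finset.sum_sub_distrib]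
  refine Finset.sum_congr rfl fun F hF => ?_
  have hF' := W.mem_faces_of_mem_bdryFaces hF
  rw [← integral_sub (T.integrable_surf hF' (contDiff_affine p).continuous)
    (T.integrable_surf hF' (contDiff_affine q).continuous)]
  rfl

theorem bdryIntegral_sub (hK : K ∈ T.elems) {v w : E d → ℝ} (hv : v ∈ T.space)
    (hw : w ∈ T.space) :
    W.bdryIntegral K (v - w) = W.bdryIntegral K v - W.bdryIntegral K w := by
  rw [bdryIntegral, bdryIntegral, bdryIntegral, ← Finset.sum_sub_distrib]
  refine Finset.sum_congr rfl fun F hF => ?_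
  rw [← Finset.sum_sub_distrib]
  refine Finset.sum_congr rfl fun K' hK' => ?_
  obtain ⟨h1, h2⟩ := Finset.mem_filter.1 hK'
  have hT := W.subset K hK h1
  exact (T.element K' hT).integral_trace_sub (T.facesOf_disjoint K')
    (T.memH1_of_mem_space hv hT) (T.memH1_of_mem_space hw hT)
    (T.exists_isTrace_of_mem_space hv hT) (T.exists_isTrace_of_mem_space hw hT)
    (T.mem_facesOf.2 ⟨W.mem_faces_of_mem_bdryFaces hF, h2⟩)

/-- The orthogonality relation determines the gradient of the projection. -/
theorem forall_inner_slope_iff {D : Set (E d)} (h0 : volume.real D ≠ 0) (p : P1 d) (m : E d) :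
    (∀ q : P1 d, ∫ x in D, ⟪∇ p x, ∇ q x⟫ = ⟪m, slope q⟫) ↔
      slope p = (volume.real D)⁻¹ • m := by
  have e : ∀ q : P1 d, ∫ x in D, ⟪∇ p x, ∇ q x⟫ = ⟪volume.real D • slope p, slope q⟫ := by
    intro q
    simp only [gradient_affine]
    rw [setIntegral_const, inner_smul_left]
    simp
  simp only [e]
  constructor
  · intro h
    have : volume.real D • slope p = m := ext_inner_right ℝ fun b => by
      simpa only [slope_affineOf] using h (affineOf b 0)
    rw [← this, smul_smul, inv_mul_cancel₀ h0, one_smul]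
  · intro h q
    rw [h, smul_smul, mul_inv_cancel₀ h0, one_smul]

theorem integral_grad_inner_gradient (hK : K ∈ T.elems) {v : E d → ℝ} (hv : MemH1 K v)
    (q : P1 d) : ∫ x in K, ⟪grad K v x, ∇ q x⟫ = ⟪∫ x in K, grad K v x, slope q⟫ := by
  have := (T.element K hK).isFiniteMeasure_restrict
  simp only [gradient_affine]
  rw [real_inner_comm, ← integral_inner (hv.memLp_grad.integrable (by norm_num))]
  simp only [real_inner_comm]

theorem volume_real_elem_ne_zero (hK : K ∈ T.elems) : volume.real K ≠ 0 :=
  (ENNReal.toReal_pos ((T.element K hK).isOpen.measure_pos volume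
    (T.element K hK).connected.nonempty).ne' (T.element K hK).bounded.measure_lt_top.ne).ne'

theorem volume_real_region_ne_zero (hK : K ∈ T.elems) : volume.real (W.region K) ≠ 0 := by
  have hsub : K ⊆ W.region K := fun x hx =>
    Set.mem_iUnion₂.2 ⟨K, W.self_mem K hK, subset_closure hx⟩
  have hb : Bornology.IsBounded (W.region K) :=
    (Bornology.isBounded_biUnion_finset _).2 fun K' hK' =>
      (T.element K' (W.subset K hK hK')).bounded.closure
  have hpos := (T.element K hK).isOpen.measure_pos volume (T.element K hK).connected.nonempty
  exact (ENNReal.toReal_pos (hpos.trans_le (measure_mono hsub)).ne' hb.measure_lt_top.ne).ne'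

theorem isProjK_iff (hK : K ∈ T.elems) {v : E d → ℝ} (hv : MemH1 K v) (p : P1 d) :
    W.IsProjK K v p ↔ slope p = (volume.real K)⁻¹ • (∫ x in K, grad K v x) ∧
      W.bdryIntegralP1 K p = W.bdryIntegral K v := by
  rw [IsProjK, ← forall_inner_slope_iff (volume_real_elem_ne_zero hK)]
  simp only [integral_grad_inner_gradient hK hv]

theorem isProjPatch_iff (hK : K ∈ T.elems) {v : E d → ℝ} (hv : ∀ K' ∈ T.elems, MemH1 K' v)
    (p : P1 d) : W.IsProjPatch K v p ↔
      slope p = (volume.real (W.region K))⁻¹ • (∑ K' ∈ W.elems K, ∫ x in K', grad K' v x) ∧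
      W.bdryIntegralP1 K p = W.bdryIntegral K v := by
  have e : ∀ q : P1 d, ∑ K' ∈ W.elems K, ∫ x in K', ⟪grad K' v x, ∇ q x⟫ =
      ⟪∑ K' ∈ W.elems K, ∫ x in K', grad K' v x, slope q⟫ := by
    intro q
    rw [sum_inner]
    exact Finset.sum_congr rfl fun K' hK' =>
      integral_grad_inner_gradient (W.subset K hK hK') (hv K' (W.subset K hK hK')) q
  rw [IsProjPatch, ← forall_inner_slope_iff (W.volume_real_region_ne_zero hK)]
  simp only [e]

theorem isProjK_projK (hd : 0 < d) (hK : K ∈ T.elems) {v : E d → ℝ} (hv : MemH1 K v) :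
    W.IsProjK K v (W.projK K v) := by
  obtain ⟨p, hp⟩ := W.exists_slope_eq (W.bdryMeasure_pos hd hK)
    ((volume.real K)⁻¹ • (∫ x in K, grad K v x)) (W.bdryIntegral K v)
  exact Classical.epsilon_spec ⟨p, (W.isProjK_iff hK hv p).2 hp⟩

theorem isProjPatch_projPatch (hd : 0 < d) (hK : K ∈ T.elems) {v : E d → ℝ}
    (hv : ∀ K' ∈ T.elems, MemH1 K' v) : W.IsProjPatch K v (W.projPatch K v) := by
  obtain ⟨p, hp⟩ := W.exists_slope_eq (W.bdryMeasure_pos hd hK)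
    ((volume.real (W.region K))⁻¹ • (∑ K' ∈ W.elems K, ∫ x in K', grad K' v x))
    (W.bdryIntegral K v)
  exact Classical.epsilon_spec ⟨p, (W.isProjPatch_iff hK hv p).2 hp⟩

theorem integral_grad_sub (hK : K ∈ T.elems) {v w : E d → ℝ} (hv : MemH1 K v) (hw : MemH1 K w) :
    ∫ x in K, grad K (v - w) x = (∫ x in K, grad K v x) - ∫ x in K, grad K w x := by
  have := (T.element K hK).isFiniteMeasure_restrict
  rw [integral_congr_ae (grad_sub_ae_eq (T.element K hK).isOpen hv hw)]
  exact integral_sub (hv.memLp_grad.integrable (by norm_num))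
    (hw.memLp_grad.integrable (by norm_num))

/-- The gradient and the boundary integral depend linearly on the function, and together they
determine the affine polynomial. -/
theorem projK_sub (hd : 0 < d) (hK : K ∈ T.elems) {v w : E d → ℝ} (hv : v ∈ T.space)
    (hw : w ∈ T.space) : W.projK K (v - w) = W.projK K v - W.projK K w := by
  have h1 := T.memH1_of_mem_space hv hK
  have h2 := T.memH1_of_mem_space hw hK
  obtain ⟨a1, b1⟩ := (W.isProjK_iff hK h1 _).1 (W.isProjK_projK hd hK h1)
  obtain ⟨a2, b2⟩ := (W.isProjK_iff hK h2 _).1 (W.isProjK_projK hd hK h2)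
  obtain ⟨a3, b3⟩ := (W.isProjK_iff hK (h1.sub h2) _).1 (W.isProjK_projK hd hK (h1.sub h2))
  refine W.eq_of_slope_eq (W.bdryMeasure_pos hd hK) ?_ ?_
  · rw [slope_sub, a1, a2, a3, integral_grad_sub hK h1 h2, smul_sub]
  · rw [bdryIntegralP1_sub, b1, b2, b3, W.bdryIntegral_sub hK hv hw]

theorem projPatch_sub (hd : 0 < d) (hK : K ∈ T.elems) {v w : E d → ℝ} (hv : v ∈ T.space)
    (hw : w ∈ T.space) : W.projPatch K (v - w) = W.projPatch K v - W.projPatch K w := by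
  have h1 : ∀ K' ∈ T.elems, MemH1 K' v := fun K' hK' => T.memH1_of_mem_space hv hK'
  have h2 : ∀ K' ∈ T.elems, MemH1 K' w := fun K' hK' => T.memH1_of_mem_space hw hK'
  have h3 : ∀ K' ∈ T.elems, MemH1 K' (v - w) := fun K' hK' => (h1 K' hK').sub (h2 K' hK')
  obtain ⟨a1, b1⟩ := (W.isProjPatch_iff hK h1 _).1 (W.isProjPatch_projPatch hd hK h1)
  obtain ⟨a2, b2⟩ := (W.isProjPatch_iff hK h2 _).1 (W.isProjPatch_projPatch hd hK h2)
  obtain ⟨a3, b3⟩ := (W.isProjPatch_iff hK h3 _).1 (W.isProjPatch_projPatch hd hK h3)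
  refine W.eq_of_slope_eq (W.bdryMeasure_pos hd hK) ?_ ?_
  · rw [slope_sub, a1, a2, a3, ← smul_sub, ← Finset.sum_sub_distrib]
    congr 1
    refine Finset.sum_congr rfl fun K' hK' => ?_
    have hT := W.subset K hK hK'
    exact integral_grad_sub hT (h1 K' hT) (h2 K' hT)
  · rw [bdryIntegralP1_sub, b1, b2, b3, W.bdryIntegral_sub hK hv hw]

end Patches

end

section

variable {Ω : Set (E d)}

namespace Patches

variable {T : Mesh Ω} (W : Patches T) {K : Set (E d)}

/-! ### The error equation -/

theorem ah_sub (hd : 0 < d) {S : Set (E d) → (E d → ℝ) → (E d → ℝ) → ℝ}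
    (hS : ∀ K ∈ T.elems, IsBilinearOn (localSpace K (T.facesOf K)) (S K)) {v w z : E d → ℝ}
    (hv : v ∈ T.space) (hw : w ∈ T.space) (hz : z ∈ T.space) :
    W.ah S (v - w) z = W.ah S v z - W.ah S w z := by
  rw [ah, ah, ah, ← Finset.sum_sub_distrib]
  refine Finset.sum_congr rfl fun K hK => ?_
  have hloc : ∀ y ∈ T.space, y - ⇑(W.projPatch K y) ∈ localSpace K (T.facesOf K) := fun y hy =>
    (T.element K hK).sub_affine_mem_localSpace (T.facesOf_disjoint K) (hy.2.1 K hK) _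
  -- The difference is brought into the form `a • w₁ + w₂` with `a = -1`, both terms lying in the
  -- local space, the only place where `S K` is known to be bilinear.
  have hsplit : v - w - ⇑(W.projPatch K (v - w)) =
      (-1 : ℝ) • (w - ⇑(W.projPatch K w)) + (v - ⇑(W.projPatch K v)) := by
    rw [W.projPatch_sub hd hK hv hw, AffineMap.coe_sub, neg_one_smul]
    abel
  rw [hsplit, (hS K hK).1 (-1) _ (hloc w hw) _ (hloc v hv) _ (hloc z hz),
    W.projK_sub hd hK hv hw]
  have hgrad : ∫ x in K, ⟪∇ (W.projK K v - W.projK K w : P1 d) x, ∇ (W.projK K z) x⟫ =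
      (∫ x in K, ⟪∇ (W.projK K v) x, ∇ (W.projK K z) x⟫) -
        ∫ x in K, ⟪∇ (W.projK K w) x, ∇ (W.projK K z) x⟫ := by
    simp only [gradient_affine, slope_sub, inner_sub_left, setIntegral_const, smul_sub]
  rw [hgrad]
  ring

/-- The projection of the interpolant has the same energy pairing with affine functions as the
weak solution. -/
theorem integral_gradient_projK_interpolant (hd : 0 < d) (hK : K ∈ T.elems) {f u uI : E d → ℝ}
    (hu : IsWeakSolution Ω f u) (huI : T.IsInterpolant u uI) (q : P1 d) :
    ∫ x in K, ⟪∇ (W.projK K uI) x, ∇ q x⟫ = ∫ x in K, ⟪grad K u x, ∇ q x⟫ := by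
  have hP := T.element K hK
  have hΩ := T.domain.isOpen.measurableSet
  have hKΩ := T.elems_subset K hK
  have hI := T.memH1_of_mem_space huI.1 hK
  rw [(W.isProjK_projK hd hK hI).1 q]
  simp only [gradient_affine]
  -- Both mean gradients are now written through face integrals of traces, which coincide by the
  -- interpolation conditions.
  rw [hP.integral_grad_inner (T.facesOf_disjoint K) hI (T.exists_isTrace_of_mem_space huI.1 hK),
    hP.integral_grad_inner (T.facesOf_disjoint K) (hu.1.1.mono hΩ hKΩ)
      (hP.exists_isTrace_of_memH10 (T.facesOf_disjoint K) hΩ hKΩ hu.1)]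
  refine Finset.sum_congr rfl fun F hF => ?_
  have hF' := (T.mem_facesOf.1 hF).1
  rw [← T.chi_mul_measure hF', ← T.chi_mul_measure hF', huI.2 K hK F hF]

/-- Green's formula for the weak solution on an element. -/
theorem integral_mul_affine_sub (hK : K ∈ T.elems) {f u : E d → ℝ}
    (hf : MemLp f 2 (volume.restrict Ω)) (hu : IsWeakSolution Ω f u)
    (hun : HasNormalDeriv K (T.facesOf K) u) (q : P1 d) :
    (∫ x in K, f x * q x) - ∫ x in K, ⟪grad K u x, ∇ q x⟫ =
      -∑ F ∈ T.facesOf K, ∫ x, normalDeriv K (T.facesOf K) u x * q x ∂(surf F) := by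
  obtain ⟨l, hl⟩ := isNormalDeriv_normalDeriv hun
  rw [← hl.2.2 q (contDiff_affine q)]
  have e : ∫ x in K, l x * q x = -∫ x in K, f x * q x := by
    rw [← integral_neg]
    refine integral_congr_ae ?_
    filter_upwards [hu.laplacian_ae_eq T.domain.isOpen (T.element K hK) (T.elems_subset K hK)
      hf hl] with x hx
    rw [hx, Pi.neg_apply, neg_mul]
  rw [e]
  ring

/-- The normal derivative of an affine function is orthogonal to `Q_F v - Π_K v`. -/
theorem sum_faceNormal_mul_sub (hd : 0 < d) (hK : K ∈ T.elems) {v : E d → ℝ} (hv : v ∈ T.space)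
    (p : P1 d) :
    ∑ F ∈ T.facesOf K, ⟪faceNormal K F, slope p⟫ *
      ((∫ x, trace K (T.facesOf K) v x ∂(surf F)) - ∫ x, W.projK K v x ∂(surf F)) = 0 := by
  have hP := T.element K hK
  have hv1 := T.memH1_of_mem_space hv hK
  simp only [mul_sub, Finset.sum_sub_distrib]
  -- The two face sums are the boundary forms of the integrals of `∇v` and `∇Π_K v` against `slope
  -- p`, which agree by the definition of `Π_K`.
  rw [← hP.integral_grad_inner (T.facesOf_disjoint K) hv1 (T.exists_isTrace_of_mem_space hv hK),
    ← hP.integral_fderiv (T.facesOf_disjoint K) (slope p) (contDiff_affine (W.projK K v)),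
    sub_eq_zero]
  have h := (W.isProjK_projK hd hK hv1).1 p
  simp only [gradient_affine p] at h
  rw [← h]
  simp only [inner_gradient_left]

/-- The pairing is split according to how its parts are treated: the first cancels over the mesh by
continuity of the flux, the second survives, and the third cancels over the faces of each element
when `q` is the projection of `v`. -/
theorem integral_normalDeriv_sub_mul (hK : K ∈ T.elems) {u v : E d → ℝ} (hu : MemH1 K u)
    (hun : HasNormalDeriv K (T.facesOf K) u) (p q : P1 d) {F : Set (E d)}
    (hF : F ∈ T.facesOf K) :
    ∫ x, normalDeriv K (T.facesOf K) (u - ⇑p) x * (T.chi K F v - q x) ∂(surf F) =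
      T.chi K F v * (∫ x, normalDeriv K (T.facesOf K) u x ∂(surf F)) -
      (∫ x, normalDeriv K (T.facesOf K) u x * q x ∂(surf F)) -
      ⟪faceNormal K F, slope p⟫ *
        ((∫ x, trace K (T.facesOf K) v x ∂(surf F)) - ∫ x, q x ∂(surf F)) := by
  have hP := T.element K hK
  have hF' := (T.mem_facesOf.1 hF).1
  have hfin := T.isFiniteMeasure_surf hF'
  obtain ⟨l, hl⟩ := isNormalDeriv_normalDeriv hun
  have i1 := hl.2.1 F hF
  have hq := (contDiff_affine q).continuous
  have i2 := hP.integrable_mul_of_continuous hF i1 hq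
  have i3 := T.integrable_surf hF' hq
  set g := normalDeriv K (T.facesOf K) u
  set c := ⟪faceNormal K F, slope p⟫
  have e : ∫ x, normalDeriv K (T.facesOf K) (u - ⇑p) x * (T.chi K F v - q x) ∂(surf F) =
      ∫ x, (T.chi K F v * g x - g x * q x - (c * T.chi K F v - c * q x)) ∂(surf F) := by
    refine integral_congr_ae ?_
    filter_upwards [hP.normalDeriv_sub_affine (T.facesOf_disjoint K) hu hun p hF] with x hx
    rw [hx]
    ring
  have j1 : Integrable (fun x => T.chi K F v * g x - g x * q x) (surf F) :=
    (i1.const_mul _).sub i2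
  have j2 : Integrable (fun x => c * T.chi K F v - c * q x) (surf F) :=
    (integrable_const _).sub (i3.const_mul _)
  rw [e, integral_sub j1 j2,
    integral_sub (i1.const_mul _) i2, integral_sub (integrable_const _) (i3.const_mul _),
    integral_const, integral_const_mul, integral_const_mul, ← T.chi_mul_measure hF']
  simp only [smul_eq_mul]
  ring

end Patches

end

end NCVEM

theorem lemma4p3 {d : ℕ} (hd : d = 2 ∨ d = 3) {Ω : Set (NCVEM.E d)}
    (T : NCVEM.Mesh Ω) (W : NCVEM.Patches T)
    (S : Set (NCVEM.E d) → (NCVEM.E d → ℝ) → (NCVEM.E d → ℝ) → ℝ)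
    (hS : ∀ K ∈ T.elems, NCVEM.IsBilinearOn (NCVEM.localSpace K (T.facesOf K)) (S K))
    (f u uh uI : NCVEM.E d → ℝ)
    (hf : MemLp f 2 (volume.restrict Ω))
    (hu : NCVEM.IsWeakSolution Ω f u)
    (hun : ∀ K ∈ T.elems, NCVEM.HasNormalDeriv K (T.facesOf K) u)
    (huh : W.IsVEMSolution S f uh)
    (huI : T.IsInterpolant u uI)
    (uπ : Set (NCVEM.E d) → NCVEM.P1 d)
    (vh : NCVEM.E d → ℝ) (hvh : vh ∈ T.space) :
    W.ah S (uh - uI) vh =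
      (∑ K ∈ T.elems, ∑ F ∈ T.facesOf K,
        ∫ x, NCVEM.normalDeriv K (T.facesOf K) (u - ⇑(uπ K)) x *
          (T.chi K F vh - W.projK K vh x) ∂(NCVEM.surf F)) -
      ∑ K ∈ T.elems, S K (uI - ⇑(W.projPatch K uI)) (vh - ⇑(W.projPatch K vh)) := by
  have hd0 : 0 < d := by omega
  have hΩ := T.domain.isOpen.measurableSet
  -- Both sides of the error equation are reduced to the flux of `u` paired with `Π_K v_h`; here
  -- `u_h` is eliminated by the discrete equation and `u_I` by the exchange of `∇Π_K u_I` for `∇u`.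
  have hleft : W.ah S (uh - uI) vh =
      (-∑ K ∈ T.elems, ∑ F ∈ T.facesOf K,
        ∫ x, NCVEM.normalDeriv K (T.facesOf K) u x * W.projK K vh x ∂(NCVEM.surf F)) -
      ∑ K ∈ T.elems, S K (uI - ⇑(W.projPatch K uI)) (vh - ⇑(W.projPatch K vh)) := by
    rw [W.ah_sub hd0 hS huh.1 huI.1 hvh, huh.2 vh hvh, NCVEM.Patches.ah, Finset.sum_add_distrib,
      ← sub_sub, ← Finset.sum_sub_distrib, ← Finset.sum_neg_distrib]
    congr 1
    refine Finset.sum_congr rfl fun K hK => ?_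
    rw [W.integral_gradient_projK_interpolant hd0 hK hu huI,
      NCVEM.Patches.integral_mul_affine_sub hK hf hu (hun K hK)]
  -- The choice of `u_π` and the means `Q_F v_h` drop out of this sum.
  have hright : ∑ K ∈ T.elems, ∑ F ∈ T.facesOf K,
      ∫ x, NCVEM.normalDeriv K (T.facesOf K) (u - ⇑(uπ K)) x *
        (T.chi K F vh - W.projK K vh x) ∂(NCVEM.surf F) =
      -∑ K ∈ T.elems, ∑ F ∈ T.facesOf K,
        ∫ x, NCVEM.normalDeriv K (T.facesOf K) u x * W.projK K vh x ∂(NCVEM.surf F) := by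
    rw [← zero_sub, ← T.sum_chi_mul_integral_normalDeriv hf hu hun hvh, ← Finset.sum_sub_distrib]
    refine Finset.sum_congr rfl fun K hK => ?_
    rw [Finset.sum_congr rfl fun F hF => NCVEM.Patches.integral_normalDeriv_sub_mul hK
      (hu.1.1.mono hΩ (T.elems_subset K hK)) (hun K hK) (uπ K) (W.projK K vh) hF,
      Finset.sum_sub_distrib, W.sum_faceNormal_mul_sub hd0 hK hvh, sub_zero,
      Finset.sum_sub_distrib]
  rw [hleft, hright]
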